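/- **Setting.** Let $N\ge 2$, $n\ge 1$, $\omega=e^{2\pi i/N}$, and let $u,v,\varkappa,\theta,\alpha_\pm,\eta_-\in\mathbb C\setminus\{0\}$, $\eta_+\in\mathbb C$. On $\mathcal V=(\mathbb C^N)^{\otimes n}$, where each factor has basis $|\gamma\rangle$, $\gamma\in\mathbb Z_N$, let $\boldsymbol v_k,\boldsymbol u_k$ act in the $k$-th factor by $\boldsymbol v_k|\gamma\rangle=v\omega^\gamma|\gamma\rangle$, $\boldsymbol u_k|\gamma\rangle=u|\gamma-1\rangle$. Put $$L_k(\lambda)=\begin{pmatrix}1+\frac{\varkappa}{\lambda}\boldsymbol v_k&-\frac1\lambda\boldsymbol u_k\\ \boldsymbol u_k^{-1}\boldsymbol v_k&0\end{pmatrix},\quad \widetilde L_k(\lambda)=\begin{pmatrix}\varkappa\lambda+\omega\theta\boldsymbol v_k^{-1}&-\theta\boldsymbol u_k^{-1}\\ \lambda\boldsymbol v_k^{-1}\boldsymbol u_k&0\end{pmatrix},$$ $$K_-(\lambda)=\begin{pmatrix}\alpha_-(\frac\theta\lambda-\lambda)&\eta_-\\ \eta_-&0\end{pmatrix},\quad K_+(\lambda)=\begin{pmatrix}\alpha_+(\frac{\omega^2\theta}\lambda-\lambda)&\eta_+\\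 \omega\eta_+&0\end{pmatrix},$$ $U(\lambda)=\widetilde L_n(\lambda)\cdots\widetilde L_1(\lambda)K_-(\lambda)L_1(\lambda)\cdots L_n(\lambda)$ and $\boldsymbol t(\lambda)=\mathrm{Tr}\,K_+(\lambda)U(\lambda)$. For $E=(E_1,\dots,E_n)\in\mathbb C^n$ put $$t_E(\lambda)=-\Big(\frac{\omega^2\theta^2}{\lambda^2}-\theta\Big)(\lambda^2-\theta)\frac{\alpha_+\alpha_-\varkappa^n}{\theta}\Big(\Lambda^n+\sum_{j=1}^nE_j\Lambda^{n-j}\Big)+\eta_+\eta_-p_n(\lambda),\quad \Lambda=\lambda+\frac{\omega\theta}\lambda,$$ with $p_n(\lambda)=\Lambda\,\theta^{(n-1)/2}$ for $n$ odd and $p_n(\lambda)=(1+\omega)\theta^{n/2}$ for $n$ even. **Amplitudes.** For a point $p=(x,y)$, $y\neq 0$, of the Fermat curve $x^N+y^N=1$ let $w_p:\mathbb Z_N\to\mathbb C$ be given by $w_p(0)=1$, $w_p(s)/w_p(s-1)=y/(1-x\omega^s)$. Let $v_{m,r}$ ($1\le r\le m\le n$) and points $p_{m,r;m',r'}=(v_{m,r}/v_{m',r'},\,y_{m,r;m',r'})$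 of the Fermat curve satisfy $v_{1,1}=v$ and, for $2\le m\le n$ and $1\le l\le m-1$, $$\prod_{r=1}^mv_{m,r}=v\prod_{r=1}^{m-1}v_{m-1,r},\qquad \varkappa\prod_{s\ne l}\frac{y_{m-1,s;m-1,l}}{y_{m-1,l;m-1,s}}\cdot\frac{\prod_{k=1}^my_{m-1,l;m,k}}{\prod_{s=1}^{m-2}y_{m-2,s;m-1,l}}=1 .$$ Put $h_r=u\prod_{l=1}^{n-1}y_{n-1,l;n,r}$. Let $s_1,\dots,s_n\in\mathbb C\setminus\{0\}$, and let $\tilde p_{r,r'}=\tilde p_{r',r}$ ($r\ne r'$), $p^{\rm B}_{r,k}$, $\tilde p^{\rm B}_{r,k}$ be points of the Fermat curve with $x$-coordinates $\frac{\varkappa^2v_{n,r}v_{n,r'}}{\omega\theta}$, $\frac{v_{n,r}}{s_k}$, $\frac{\varkappa^2v_{n,r}s_k}{\omega\theta}$ and $y$-coordinates $\tilde y_{r,r'}$, $y^{\rm B}_{r,k}$, $\tilde y^{\rm B}_{r,k}$ satisfying, for $r=1,\dots,n$, $$\frac{\eta_-v_{n,r}^2}{\varkappa^{n-2}\omega^{n+1}\theta}\prod_{r'\ne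 r}\tilde y_{r,r'}=\alpha_-h_r\prod_{k=1}^ny^{\rm B}_{r,k}\tilde y^{\rm B}_{r,k}.$$ Assume general position: $v_{n,r}^N\ne v_{n,r'}^N$ and $\tilde y_{r,r'}\neq0$ for $r\ne r'$; $s_k^N\ne s_l^N$ for $k\neq l$; $(\varkappa^2s_ks_l)^N\ne\theta^N$ for all $k,l$ (including $k=l$). **Vectors.** For $\gamma_m\in\mathbb Z_N^m$ define $|\gamma_1\rangle$ as the basis vector and $$|\gamma_{m}\rangle=\sum_{\gamma_{m-1}}\frac{\omega^{\sum_l\gamma_{m-1,l}}\prod_{j\ne l}w_{p_{m-1,j;m-1,l}}(\gamma_{m-1,j}-\gamma_{m-1,l}-1)}{\prod_{k=1}^m\prod_{l=1}^{m-1}w_{p_{m-1,l;m,k}}(\gamma_{m-1,l}-\gamma_{m,k}-1)}\;|\gamma_{m-1}\rangle\otimes\Big|\sum_k\gamma_{m,k}-\sum_l\gamma_{m-1,l}\Big\rangle .$$ For $\sigma\in\mathbb Z_N^n$ put $$\Psi_\sigma=\sum_{\gamma\in\mathbb Z_N^n}\prod_r\omega^{\gamma_r^2+\gamma_r}\prod_{k,r}w_{p^{\rm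 B}_{r,k}}(\gamma_r-\sigma_k)\,w_{\tilde p^{\rm B}_{r,k}}(\gamma_r+\sigma_k)\prod_{r<r'}\frac{v_{n,r}\omega^{\gamma_r}-v_{n,r'}\omega^{\gamma_{r'}}}{w_{\tilde p_{r,r'}}(\gamma_r+\gamma_{r'})}\;|\gamma\rangle .$$ Write $\lambda_k=-\varkappa s_k\omega^{\sigma_k}$, $f_k=\prod_{r=1}^n\lambda_ky^{\rm B}_{r,k}/\tilde y^{\rm B}_{r,k}$, and, for functions $q_1,\dots,q_n:\mathbb Z_N\to\mathbb C$, $$\Phi=\sum_{\sigma}\prod_{i<j}(\lambda_i-\lambda_j)(\omega\theta-\lambda_i\lambda_j)\prod_kq_k(\sigma_k)\,\Psi_\sigma .$$ **Theorem.** (a) There are unique operators $H_1,\dots,H_n$ on $\mathcal V$ such that, for all $\lambda\neq0$, $$\boldsymbol t(\lambda)=-\Big(\frac{\omega^2\theta^2}{\lambda^2}-\theta\Big)(\lambda^2-\theta)\frac{\alpha_+\alpha_-\varkappa^n}{\theta}\Big(\Lambda^n+\sum_{j=1}^nH_j\Lambda^{n-j}\Big)+\eta_+\eta_-p_n(\lambda).$$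 A nonzero vector $X$ satisfies $H_jX=E_jX$ for all $j$ if and only if $\boldsymbol t(\lambda)X=t_E(\lambda)X$ for all $\lambda\ne0$; call $X$ then an eigenvector for $E$. (b) For every $E\in\mathbb C^n$ and all $q_1,\dots,q_n$, the vector $\Phi$ is an eigenvector for $E$ (in particular $\Phi\ne0$) if and only if, for every $k=1,\dots,n$, $q_k$ is not identically zero and satisfies, for all $\sigma_k\in\mathbb Z_N$, the Baxter equation $$t_E(\lambda_k)q_k(\sigma_k)=\eta_+\eta_-\frac{\theta-\lambda_k^2}{\omega\theta-\omega^{-2}\lambda_k^2}\,\omega^{1-2n}f_k\,q_k(\sigma_k-1)+\eta_+\eta_-\frac{\omega^2\theta-\lambda_k^2}{\theta-\omega\lambda_k^2}\,\omega^{n-1}\theta^nf_k^{-1}\,q_k(\sigma_k+1).$$ (c) For every $E\in\mathbb C^n$, there is an eigenvector for $E$ if and only if, for every $k=1,\dots,n$, the Baxter equation, a homogeneous system of $N$ linear equations for the $N$ unknowns $q_k(\sigma)$, $\sigma\in\mathbb Z_N$, has a nontrivial solution. -/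

import Mathlib

namespace RTC

noncomputable section

/-- The primitive root of unity `ω = exp (2πi / N)`. -/
def omega (N : ℕ) : ℂ := Complex.exp (2 * Real.pi * Complex.I / N)

/-- `ω ^ γ` for a residue class `γ` modulo `N`. -/
def omegaPow {N : ℕ} (γ : ZMod N) : ℂ := omega N ^ γ.val

/-- The parameters of the chain (`u`, `v`, `κ`), of the reflection algebra (`θ`) and of the two
boundary matrices (`α₋`, `η₋`, `α₊`, `η₊`); the other boundary parameters `β±`, `δ±` are zero. -/
structure Params where
  u : ℂ
  v : ℂ
  κ : ℂ
  θ : ℂ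
  αm : ℂ
  ηm : ℂ
  αp : ℂ
  ηp : ℂ

/-- All parameters are nonzero, except that `η₊` is arbitrary. -/
structure Params.Nondegenerate (P : Params) : Prop where
  u_ne : P.u ≠ 0
  v_ne : P.v ≠ 0
  κ_ne : P.κ ≠ 0
  θ_ne : P.θ ≠ 0
  αm_ne : P.αm ≠ 0
  ηm_ne : P.ηm ≠ 0
  αp_ne : P.αp ≠ 0

/-! ### The space of states and the transfer matrix -/

/-- The space of states `𝒱₁ ⊗ ⋯ ⊗ 𝒱ₙ`, each `𝒱ₖ` being `ℂ ^ N` with the basis `|γ⟩`, `γ ∈ ℤ/N`.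
A vector is given by its coordinates in the product basis `|γ₁⟩ ⊗ ⋯ ⊗ |γₙ⟩`. -/
abbrev States (N n : ℕ) : Type := (Fin n → ZMod N) → ℂ

/-- `vₖ |γ⟩ = v ω ^ γₖ |γ⟩`. -/
def vOp {N n : ℕ} (P : Params) (k : Fin n) : Module.End ℂ (States N n) where
  toFun f := fun γ => P.v * omegaPow (γ k) * f γ
  map_add' f g := by ext γ; simp [mul_add]
  map_smul' c f := by ext γ; simp [mul_left_comm]

/-- The inverse of `vₖ`. -/
def vInv {N n : ℕ} (P : Params) (k : Fin n) : Module.End ℂ (States N n) where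
  toFun f := fun γ => (P.v * omegaPow (γ k))⁻¹ * f γ
  map_add' f g := by ext γ; simp only [Pi.add_apply, mul_add]
  map_smul' c f := by ext γ; simp only [Pi.smul_apply, smul_eq_mul, RingHom.id_apply]; ring

/-- `uₖ |γ⟩ = u |γ₁, …, γₖ - 1, …, γₙ⟩`, so in coordinates `(uₖ f)(γ) = u f(…, γₖ + 1, …)`. -/
def uOp {N n : ℕ} (P : Params) (k : Fin n) : Module.End ℂ (States N n) where
  toFun f := fun γ => P.u * f (Function.update γ k (γ k + 1))
  map_add' f g := by ext γ; simp [mul_add]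
  map_smul' c f := by ext γ; simp [mul_left_comm]

/-- The inverse of `uₖ`. -/
def uInv {N n : ℕ} (P : Params) (k : Fin n) : Module.End ℂ (States N n) where
  toFun f := fun γ => P.u⁻¹ * f (Function.update γ k (γ k - 1))
  map_add' f g := by ext γ; simp [mul_add]
  map_smul' c f := by ext γ; simp [mul_left_comm]

theorem omega_ne_zero (N : ℕ) : omega N ≠ 0 := Complex.exp_ne_zero _

theorem omegaPow_ne_zero {N : ℕ} (γ : ZMod N) : omegaPow γ ≠ 0 :=
  pow_ne_zero _ (omega_ne_zero N)

theorem vOp_mul_vInv {N n : ℕ} (P : Params) (hP : P.v ≠ 0) (k : Fin n) :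
    (vOp P k * vInv P k : Module.End ℂ (States N n)) = 1 ∧
      (vInv P k * vOp P k : Module.End ℂ (States N n)) = 1 := by
  constructor <;>
  · refine LinearMap.ext fun f => funext fun γ => ?_
    have := omegaPow_ne_zero (γ k)
    simp only [vOp, vInv, Module.End.mul_apply, LinearMap.coe_mk, AddHom.coe_mk,
      Module.End.one_apply]
    field_simp

theorem uOp_mul_uInv {N n : ℕ} (P : Params) (hP : P.u ≠ 0) (k : Fin n) :
    (uOp P k * uInv P k : Module.End ℂ (States N n)) = 1 ∧
      (uInv P k * uOp P k : Module.End ℂ (States N n)) = 1 := by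
  constructor <;>
  · refine LinearMap.ext fun f => funext fun γ => ?_
    simp [uOp, uInv, hP]

/-- The Lax operator `Lₖ(z)`. -/
def lax {N n : ℕ} (P : Params) (k : Fin n) (z : ℂ) :
    Matrix (Fin 2) (Fin 2) (Module.End ℂ (States N n)) :=
  !![1 + (P.κ / z) • vOp P k, -((1 / z) • uOp P k);
     uInv P k * vOp P k, 0]

/-- The twisted Lax operator `L̃ₖ(z) = z σₓ Lₖ(θ / z)⁻¹ σₓ`, written out. -/
def laxTilde {N n : ℕ} (P : Params) (k : Fin n) (z : ℂ) :
    Matrix (Fin 2) (Fin 2) (Module.End ℂ (States N n)) :=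
  !![(P.κ * z) • 1 + (omega N * P.θ) • vInv P k, -(P.θ • uInv P k);
     z • (vInv P k * uOp P k), 0]

/-- The boundary matrix `K₋(z)` (with `β₋ = δ₋ = 0`). -/
def kMinus {N n : ℕ} (P : Params) (z : ℂ) :
    Matrix (Fin 2) (Fin 2) (Module.End ℂ (States N n)) :=
  !![(P.αm * (P.θ / z - z)) • 1, P.ηm • 1;
     P.ηm • 1, 0]

/-- The boundary matrix `K₊(z)` (with `β₊ = δ₊ = 0`). -/
def kPlus {N n : ℕ} (P : Params) (z : ℂ) :
    Matrix (Fin 2) (Fin 2) (Module.End ℂ (States N n)) :=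
  !![(P.αp * (omega N ^ 2 * P.θ / z - z)) • 1, P.ηp • 1;
     (P.ηp * omega N) • 1, 0]

/-- `U(z) = L̃ₙ(z) ⋯ L̃₁(z) K₋(z) L₁(z) ⋯ Lₙ(z)`. -/
def monodromy {N n : ℕ} (P : Params) (z : ℂ) :
    Matrix (Fin 2) (Fin 2) (Module.End ℂ (States N n)) :=
  (List.ofFn fun k : Fin n => laxTilde P k z).reverse.prod * kMinus P z *
    (List.ofFn fun k : Fin n => lax P k z).prod

/-- The two-boundary transfer matrix `t(z) = Tr (K₊(z) U(z))`. -/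
def transfer {N n : ℕ} (P : Params) (z : ℂ) : Module.End ℂ (States N n) :=
  (kPlus P z * monodromy P z).trace

/-- The Laurent polynomial `pₙ(z)`. -/
def pPoly (N n : ℕ) (P : Params) (z : ℂ) : ℂ :=
  if Odd n then (z + omega N * P.θ / z) * P.θ ^ ((n - 1) / 2)
  else (1 + omega N) * P.θ ^ (n / 2)

/-- The prefactor `-(ω²θ²/z² - θ)(z² - θ) α₊ α₋ κⁿ / θ` in the expansion of `t(z)`. -/
def prefactor (N n : ℕ) (P : Params) (z : ℂ) : ℂ :=
  -(omega N ^ 2 * P.θ ^ 2 / z ^ 2 - P.θ) * (z ^ 2 - P.θ) * (P.αp * P.αm * P.κ ^ n / P.θ)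

/-- The operators `H 0, …, H (n-1)` (the Hamiltonians `H₁, …, Hₙ` of the two-boundary chain) are
the coefficients of the expansion of `t(z)` in powers of `z + ωθ/z`. -/
def IsHamiltonians {N n : ℕ} (P : Params) (H : Fin n → Module.End ℂ (States N n)) : Prop :=
  ∀ z : ℂ, z ≠ 0 →
    transfer P z =
      prefactor N n P z •
          ((z + omega N * P.θ / z) ^ n • (1 : Module.End ℂ (States N n)) +
            ∑ j : Fin n, (z + omega N * P.θ / z) ^ (n - 1 - (j : ℕ)) • H j) +
        (P.ηp * P.ηm * pPoly N n P z) • (1 : Module.End ℂ (States N n))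

/-- The eigenvalue polynomial `t_E(z)` attached to `E = (E₁, …, Eₙ)`. -/
def eigenvaluePoly {n : ℕ} (N : ℕ) (P : Params) (E : Fin n → ℂ) (z : ℂ) : ℂ :=
  prefactor N n P z *
      ((z + omega N * P.θ / z) ^ n +
        ∑ j : Fin n, E j * (z + omega N * P.θ / z) ^ (n - 1 - (j : ℕ))) +
    P.ηp * P.ηm * pPoly N n P z

/-! ### Amplitudes and points of the Fermat curve -/

/-- The cyclic function `w_p(s)` for the point `p = (x, y)` of the Fermat curve `x^N + y^N = 1`,
normalised by `w_p(0) = 1`. -/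
def cyc {N : ℕ} (x y : ℂ) (s : ZMod N) : ℂ :=
  ∏ j ∈ Finset.Icc 1 s.val, y / (1 - x * omega N ^ j)

theorem omega_isPrimitiveRoot (N : ℕ) [NeZero N] : IsPrimitiveRoot (omega N) N :=
  Complex.isPrimitiveRoot_exp N (NeZero.ne N)

theorem prod_one_sub (N : ℕ) [NeZero N] (x : ℂ) :
    ∏ j ∈ Finset.range N, (1 - x * omega N ^ j) = 1 - x ^ N := by
  have hprim := omega_isPrimitiveRoot N
  have h := hprim.pow_sub_pow_eq_prod_sub_mul 1 x (Nat.pos_of_ne_zero (NeZero.ne N))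
  rw [one_pow] at h
  rw [h]
  refine Finset.prod_bij (fun j _ => omega N ^ j) ?_ ?_ ?_ ?_
  · intro j _
    rw [Polynomial.mem_nthRootsFinset (Nat.pos_of_ne_zero (NeZero.ne N)), ← pow_mul, mul_comm,
      pow_mul, hprim.pow_eq_one, one_pow]
  · intro a ha b hb hab
    exact hprim.pow_inj (Finset.mem_range.1 ha) (Finset.mem_range.1 hb) hab
  · intro ζ hζ
    rw [Polynomial.mem_nthRootsFinset (Nat.pos_of_ne_zero (NeZero.ne N))] at hζ
    obtain ⟨i, hi, rfl⟩ := hprim.eq_pow_of_pow_eq_one hζ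
    exact ⟨i, Finset.mem_range.2 hi, rfl⟩
  · intro j _
    ring

theorem cyc_zero {N : ℕ} (x y : ℂ) : cyc x y (0 : ZMod N) = 1 := by
  simp [cyc]

/-- The defining recursion `w_p(s) / w_p(s - 1) = y / (1 - x ω^s)` holds for every residue
class. -/
theorem cyc_succ {N : ℕ} [NeZero N] {x y : ℂ} (h : x ^ N + y ^ N = 1) (hy : y ≠ 0)
    (s : ZMod N) :
    cyc x y (s + 1) = cyc x y s * (y / (1 - x * omegaPow (s + 1))) := by
  have hlt := ZMod.val_lt s
  have hs1 : (s + 1).val = (s.val + 1) % N := by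
    rw [ZMod.val_add, ZMod.val_one_eq_one_mod, Nat.add_mod_mod]
  rcases Nat.lt_or_ge (s.val + 1) N with hc | hc
  · rw [Nat.mod_eq_of_lt hc] at hs1
    rw [cyc, cyc, omegaPow, hs1, Finset.prod_Icc_succ_top (by omega)]
  · have hN : s.val + 1 = N := by omega
    rw [hN, Nat.mod_self] at hs1
    have h0 : s + 1 = 0 := (ZMod.val_eq_zero _).1 hs1
    have hp : ∏ j ∈ Finset.range (s.val + 1), (1 - x * omega N ^ j) = y ^ (s.val + 1) := by
      have h2 := prod_one_sub N x
      rw [← eq_sub_iff_add_eq'.2 h] at h2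
      rw [hN, h2]
    have hne : y ^ (s.val + 1) ≠ 0 := pow_ne_zero _ hy
    have hcyc : cyc x y s =
        y ^ s.val / ∏ k ∈ Finset.range s.val, (1 - x * omega N ^ (k + 1)) := by
      have hI : Finset.Icc 1 s.val = Finset.Ico 1 (s.val + 1) := by
        ext j
        simp only [Finset.mem_Icc, Finset.mem_Ico]
        omega
      rw [cyc, hI, Finset.prod_Ico_eq_prod_range, Finset.prod_div_distrib, Nat.add_sub_cancel]
      simp [add_comm]
    rw [Finset.prod_range_succ'] at hp
    rw [hcyc, h0, cyc_zero, omegaPow, ZMod.val_zero, div_mul_div_comm, hp, ← pow_succ,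
      div_self hne]

/-- The amplitudes entering the eigenvectors, with the `y`-coordinates of the Fermat points:
`v m r` is `v_{m,r}` and `y m r m' r'` belongs to the point `p_{m,r;m',r'}`;
`s k` is `s_k`; `yt r r'`, `yB r k`, `ytB r k` belong to the points `p̃_{r,r'}`, `p^B_{r,k}`,
`p̃^B_{r,k}`. Only the levels `m ≤ n` are used. -/
structure Amplitudes (n : ℕ) where
  v : (m : ℕ) → Fin m → ℂ
  y : (m : ℕ) → Fin m → (m' : ℕ) → Fin m' → ℂ
  s : Fin n → ℂ
  yt : Fin n → Fin n → ℂ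
  yB : Fin n → Fin n → ℂ
  ytB : Fin n → Fin n → ℂ

/-- The `x`-coordinate `v_{m,r} / v_{m',r'}` of `p_{m,r;m',r'}`. -/
def Amplitudes.x {n : ℕ} (D : Amplitudes n) (m : ℕ) (r : Fin m) (m' : ℕ) (r' : Fin m') : ℂ :=
  D.v m r / D.v m' r'

/-- The `x`-coordinate `κ² v_{n,r} v_{n,r'} / (ωθ)` of `p̃_{r,r'}`. -/
def Amplitudes.xt {n : ℕ} (D : Amplitudes n) (N : ℕ) (P : Params) (r r' : Fin n) : ℂ :=
  P.κ ^ 2 * D.v n r * D.v n r' / (omega N * P.θ)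

/-- The `x`-coordinate `v_{n,r} / s_k` of `p^B_{r,k}`. -/
def Amplitudes.xB {n : ℕ} (D : Amplitudes n) (r k : Fin n) : ℂ := D.v n r / D.s k

/-- The `x`-coordinate `κ² v_{n,r} s_k / (ωθ)` of `p̃^B_{r,k}`. -/
def Amplitudes.xtB {n : ℕ} (D : Amplitudes n) (N : ℕ) (P : Params) (r k : Fin n) : ℂ :=
  P.κ ^ 2 * D.v n r * D.s k / (omega N * P.θ)

/-- `h_r = u ∏_{l=1}^{n-1} y_{n-1,l;n,r}`. -/
def Amplitudes.h {n : ℕ} (D : Amplitudes n) (P : Params) (r : Fin n) : ℂ :=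
  P.u * ∏ l : Fin (n - 1), D.y (n - 1) l n r

/-- The defining equations of the amplitudes of the open chain: the points `p_{m,r;m',r'}` lie on
the Fermat curve, `∏_r v_{m,r} = v ∏_r v_{m-1,r}` (for `m = 1` this is `v_{1,1} = v`), and
`κ ∏_{s≠l} (y_{m-1,s;m-1,l} / y_{m-1,l;m-1,s}) ∏_k y_{m-1,l;m,k} / ∏_s y_{m-2,s;m-1,l} = 1`
(with `m = j + 2`). -/
structure Amplitudes.IsOpen {n : ℕ} (D : Amplitudes n) (N : ℕ) (P : Params) : Prop where
  fermat : ∀ m, m ≤ n → ∀ m', m' ≤ n → ∀ (r : Fin m) (r' : Fin m'),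
    D.x m r m' r' ^ N + D.y m r m' r' ^ N = 1
  prod_v : ∀ m, m + 1 ≤ n → ∏ r, D.v (m + 1) r = (∏ r, D.v m r) * P.v
  recurrence : ∀ j, j + 2 ≤ n → ∀ l : Fin (j + 1),
    P.κ * (∏ s ∈ Finset.univ.erase l, D.y (j + 1) s (j + 1) l / D.y (j + 1) l (j + 1) s) *
      ((∏ k : Fin (j + 2), D.y (j + 1) l (j + 2) k) / ∏ s : Fin j, D.y j s (j + 1) l) = 1

/-- The defining equations of the amplitudes of the one-boundary chain. -/
structure Amplitudes.IsBoundary {n : ℕ} (D : Amplitudes n) (N : ℕ) (P : Params) : Prop where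
  s_ne : ∀ k, D.s k ≠ 0
  fermat_t : ∀ r r', r ≠ r' → D.xt N P r r' ^ N + D.yt r r' ^ N = 1
  yt_symm : ∀ r r', D.yt r r' = D.yt r' r
  fermat_B : ∀ r k, D.xB r k ^ N + D.yB r k ^ N = 1
  fermat_tB : ∀ r k, D.xtB N P r k ^ N + D.ytB r k ^ N = 1
  equation : ∀ r,
    P.ηm * D.v n r ^ 2 / (P.κ ^ ((n : ℤ) - 2) * omega N ^ (n + 1) * P.θ) *
        ∏ r' ∈ Finset.univ.erase r, D.yt r r' =
      P.αm * D.h P r * ∏ k, D.yB r k * D.ytB r k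

/-- General position: the denominators occurring in the construction do not vanish, for any values
of the labels in `ℤ/N`. The conditions are `v_{n,r} ω^a ≠ v_{n,r'}` and `ỹ_{r,r'} ≠ 0` for
`r ≠ r'`, and, for the separated variables `λ_k = -κ s_k ω^{σ_k}`, `λ_k ≠ λ_l` for `k ≠ l` and
`λ_k λ_l ω^a ≠ θ` for all `k`, `l` and `a`. -/
structure Amplitudes.IsGeneric {n : ℕ} (D : Amplitudes n) (N : ℕ) (P : Params) : Prop where
  v_pow_ne : ∀ r r', r ≠ r' → D.v n r ^ N ≠ D.v n r' ^ N
  yt_ne : ∀ r r', r ≠ r' → D.yt r r' ≠ 0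
  s_pow_ne : ∀ k l, k ≠ l → D.s k ^ N ≠ D.s l ^ N
  s_mul_pow_ne : ∀ k l, (P.κ ^ 2 * D.s k * D.s l) ^ N ≠ P.θ ^ N

/-! ### Eigenvectors of the open and of the one-boundary chain -/

/-- `μ(γ_m) = ∏_{j≠l} w_{p_{m,j;m,l}}(γ_{m,j} - γ_{m,l} - 1)`. -/
def mu {N n : ℕ} (D : Amplitudes n) (m : ℕ) (γ : Fin m → ZMod N) : ℂ :=
  ∏ j, ∏ l ∈ Finset.univ.erase j, cyc (D.x m j m l) (D.y m j m l) (γ j - γ l - 1)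

/-- `Q(γ_m | γ_{m+1})`. -/
def openQ {N n : ℕ} (D : Amplitudes n) (m : ℕ) (γ : Fin m → ZMod N)
    (γ' : Fin (m + 1) → ZMod N) : ℂ :=
  omegaPow (∑ l, γ l) /
    ∏ k, ∏ l, cyc (D.x m l (m + 1) k) (D.y m l (m + 1) k) (γ l - γ' k - 1)

/-- The eigenvectors `|γ_m⟩` of the open chain with `m` particles, by recursion on `m`:
`|γ_{m+1}⟩ = ∑_{γ_m} μ(γ_m) Q(γ_m | γ_{m+1}) |γ_m⟩ ⊗ |∑ γ_{m+1} - ∑ γ_m⟩`. For `m + 1 = 1` the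
formula gives the basis vector `|γ_{1,1}⟩`. -/
def openVec {N n : ℕ} [NeZero N] (D : Amplitudes n) :
    (m : ℕ) → (Fin m → ZMod N) → States N m
  | 0, _ => fun _ => 1
  | m + 1, γ' => fun τ =>
      ∑ γ : Fin m → ZMod N, mu D m γ * openQ D m γ γ' *
        (openVec D m γ (fun i => τ i.castSucc) *
          if τ (Fin.last m) = ∑ k, γ' k - ∑ l, γ l then 1 else 0)

/-- The coefficient `Q(γ_n, σ)`. -/
def boundaryQ {N n : ℕ} (P : Params) (D : Amplitudes n) (γ σ : Fin n → ZMod N) : ℂ :=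
  (∏ r, omegaPow (γ r ^ 2 + γ r)) *
    (∏ k, ∏ r, cyc (D.xB r k) (D.yB r k) (γ r - σ k) *
      cyc (D.xtB N P r k) (D.ytB r k) (γ r + σ k)) *
    ∏ r, ∏ r' ∈ Finset.Ioi r,
      (D.v n r * omegaPow (γ r) - D.v n r' * omegaPow (γ r')) /
        cyc (D.xt N P r r') (D.yt r r') (γ r + γ r')

/-- The eigenvectors `Ψ_σ` of the one-boundary chain. -/
def psi {N n : ℕ} [NeZero N] (P : Params) (D : Amplitudes n) (σ : Fin n → ZMod N) :
    States N n :=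
  ∑ γ : Fin n → ZMod N, boundaryQ P D γ σ • openVec D n γ

/-! ### Separation of variables -/

/-- The separated variable `λ_k = -κ s_k ω^{σ_k}`. -/
def lam {N n : ℕ} (P : Params) (D : Amplitudes n) (k : Fin n) (σ : ZMod N) : ℂ :=
  -P.κ * D.s k * omegaPow σ

/-- `f_k = ∏_r λ_k y^B_{r,k} / ỹ^B_{r,k}`. -/
def fCoeff {N n : ℕ} (P : Params) (D : Amplitudes n) (k : Fin n) (σ : ZMod N) : ℂ :=
  ∏ r, lam P D k σ * D.yB r k / D.ytB r k

/-- `Φ = ∑_σ ∏_{i<j} (λ_i - λ_j)(ωθ - λ_i λ_j) ∏_k q_k(σ_k) Ψ_σ`. -/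
def phi {N n : ℕ} [NeZero N] (P : Params) (D : Amplitudes n) (q : Fin n → ZMod N → ℂ) :
    States N n :=
  ∑ σ : Fin n → ZMod N,
    ((∏ i, ∏ j ∈ Finset.Ioi i, (lam P D i (σ i) - lam P D j (σ j)) *
        (omega N * P.θ - lam P D i (σ i) * lam P D j (σ j))) *
      ∏ k, q k (σ k)) • psi P D σ

/-- The Baxter equation for the `k`-th separated variable: a homogeneous system of `N` linear
equations for the `N` unknowns `q σ`, `σ ∈ ℤ/N`. -/
def Baxter {N n : ℕ} (P : Params) (D : Amplitudes n) (E : Fin n → ℂ) (k : Fin n)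
    (q : ZMod N → ℂ) : Prop :=
  ∀ σ : ZMod N,
    eigenvaluePoly N P E (lam P D k σ) * q σ =
      P.ηp * P.ηm * ((P.θ - lam P D k σ ^ 2) /
          (omega N * P.θ - omega N ^ (-2 : ℤ) * lam P D k σ ^ 2)) *
          omega N ^ (1 - 2 * (n : ℤ)) * fCoeff P D k σ * q (σ - 1) +
        P.ηp * P.ηm * ((omega N ^ 2 * P.θ - lam P D k σ ^ 2) /
          (P.θ - omega N * lam P D k σ ^ 2)) *
          omega N ^ ((n : ℤ) - 1) * P.θ ^ n * (fCoeff P D k σ)⁻¹ * q (σ + 1)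

/-- `Φ` is a nonzero vector with `t(z) Φ = t_E(z) Φ` for all `z ≠ 0`. -/
def IsEigenvector {N n : ℕ} (P : Params) (E : Fin n → ℂ) (Φ : States N n) : Prop :=
  Φ ≠ 0 ∧ ∀ z : ℂ, z ≠ 0 → transfer P z Φ = eigenvaluePoly N P E z • Φ

end

end RTC

namespace RTC

noncomputable section

set_option linter.unusedSectionVars false

/-! ### Powers of the root of unity -/

section omegaPow
variable {N : ℕ} [NeZero N]

/-! The proof is a separation of variables in the sense of Sklyanin. Write A, B, C, D for the
entries 00, 01, 10, 11 of the open monodromy matrix L₁⋯Lₙ, and U₀₀, U₀₁, U₁₀, U₁₁ for those of U.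
The vectors |γ⟩ diagonalise A, with eigenvalue ∏(1 - ν_r/z) for the nodes ν_r = -κ v_{n,r} ω^{γ_r},
whereas B and C shift one label at a time (`openMon_openVec`, `openMon_10_openVec`). The relation
`crossing` expresses L̃ₙ⋯L̃₁ through the same entries at ωθ/z, and U₀₀ then acts on |γ⟩ by a
diagonal and by raising terms (`monodromy_00_openVec`). The equation on the boundary amplitudes is
what makes Ψ_σ an eigenvector of U₀₀ (`monodromy_00_psi`), with an eigenvalue that vanishes at z =
λ_k and at z = ωθ/λ_k.

At these points the relation `openMon_mul_monodromy_10` between U₀₀ and U₁₀ loses its U₀₀ term on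
Ψ_σ, so U₁₀ raises σ_k at λ_k and lowers it at ωθ/λ_k. By `transfer_poly`, t is up to the p_n term a
prefactor times a polynomial of degree n in Λ, which gives (a); the off-diagonal entries of U
involve two polynomials b and c, of which only b enters t. The two values of U₁₀ determine bΨ_σ, and
hence t(λ_k)Ψ_σ as a combination of the two neighbours Ψ_{σ±e_k} (`transfer_psi_lam`).

A polynomial of degree n in Λ with known leading term is fixed by its values at the n points Λ(λ_k).
The eigenvector equation for ∑ G(σ)Ψ_σ is therefore equivalent to one three-term equation for each σ
and k, relating G(σ) to its neighbours in the direction k (`separation`). The Lagrange factors in it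
still couple the variables; the product ∏(λ_i - λ_j)(ωθ - λ_iλ_j), split off from G, absorbs them,
and the remaining factor F satisfies the Baxter equation in each variable (`eigenvector_iff`). For F
= ∏ q_k this is (b). The Ψ_σ form a basis (`psi_linearIndependent`), so every eigenvector comes from
some F, and a nonzero slice of F in the direction k solves the k-th Baxter equation; this gives (c).
-/

theorem omega_pow_self (N : ℕ) [NeZero N] : omega N ^ N = 1 :=
  (omega_isPrimitiveRoot N).pow_eq_one

theorem omegaPow_natCast (k : ℕ) : omegaPow (k : ZMod N) = omega N ^ k := by
  rw [omegaPow, ZMod.val_natCast, ← pow_mod_orderOf (omega N) k,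
    ← (omega_isPrimitiveRoot N).eq_orderOf]

theorem omegaPow_zero : omegaPow (0 : ZMod N) = 1 := by simp [omegaPow]

theorem omegaPow_one : omegaPow (1 : ZMod N) = omega N := by
  simpa using omegaPow_natCast (N := N) 1

theorem omegaPow_add (a b : ZMod N) : omegaPow (a + b) = omegaPow a * omegaPow b := by
  have h := omegaPow_natCast (N := N) (a.val + b.val)
  rw [pow_add] at h
  simpa [omegaPow] using h

theorem omegaPow_sub (a b : ZMod N) : omegaPow (a - b) = omegaPow a / omegaPow b := by
  rw [eq_div_iff (omegaPow_ne_zero b), ← omegaPow_add, sub_add_cancel]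

theorem omegaPow_add_one (a : ZMod N) : omegaPow (a + 1) = omega N * omegaPow a := by
  rw [omegaPow_add, omegaPow_one, mul_comm]

theorem omegaPow_sub_one (a : ZMod N) : omegaPow (a - 1) = omegaPow a / omega N := by
  rw [omegaPow_sub, omegaPow_one]

theorem omegaPow_sum {ι : Type*} (s : Finset ι) (f : ι → ZMod N) :
    omegaPow (∑ i ∈ s, f i) = ∏ i ∈ s, omegaPow (f i) := by
  classical
  induction s using Finset.induction_on with
  | empty => simp [omegaPow_zero]
  | insert a s ha ih => rw [Finset.sum_insert ha, Finset.prod_insert ha, omegaPow_add, ih]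

theorem omegaPow_pow_self (a : ZMod N) : omegaPow a ^ N = 1 := by
  rw [omegaPow, ← pow_mul, mul_comm, pow_mul, omega_pow_self, one_pow]

theorem omegaPow_injective : Function.Injective (omegaPow : ZMod N → ℂ) := fun a b h =>
  ZMod.val_injective N
    ((omega_isPrimitiveRoot N).pow_inj (ZMod.val_lt a) (ZMod.val_lt b) h)

end omegaPow

/-! ### Cyclic functions -/

section cyc
variable {N : ℕ} [NeZero N] {x y : ℂ}

/-- A zero would force x^N = 1, hence y = 0 on the Fermat curve. Most nonvanishing statements about
denominators rest on this. -/
theorem one_sub_mul_omegaPow_ne_zero (h : x ^ N + y ^ N = 1) (hy : y ≠ 0) (s : ZMod N) :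
    1 - x * omegaPow s ≠ 0 := by
  intro h0
  have h1 : (x * omegaPow s) ^ N = 1 := by rw [← sub_eq_zero.1 h0, one_pow]
  rw [mul_pow, omegaPow_pow_self, mul_one] at h1
  rw [h1, add_eq_left] at h
  exact hy (pow_eq_zero_iff (NeZero.ne N) |>.1 h)

theorem cyc_ne_zero (h : x ^ N + y ^ N = 1) (hy : y ≠ 0) (s : ZMod N) : cyc x y s ≠ 0 := by
  refine Finset.prod_ne_zero_iff.2 fun j _ => div_ne_zero hy ?_
  rw [← omegaPow_natCast]
  exact one_sub_mul_omegaPow_ne_zero h hy _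

theorem cyc_eq_sub_one (h : x ^ N + y ^ N = 1) (hy : y ≠ 0) (s : ZMod N) :
    cyc x y s = cyc x y (s - 1) * (y / (1 - x * omegaPow s)) := by
  simpa using cyc_succ h hy (s - 1)

theorem cyc_sub_one (h : x ^ N + y ^ N = 1) (hy : y ≠ 0) (s : ZMod N) :
    cyc x y (s - 1) = cyc x y s * ((1 - x * omegaPow s) / y) := by
  have := one_sub_mul_omegaPow_ne_zero h hy s
  rw [cyc_eq_sub_one h hy s]
  field_simp

end cyc

/-! ### Adding a site -/

section lift
variable {N n : ℕ}

/-- The action of an operator on the first `n` factors of `n + 1`. -/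
def liftOp : Module.End ℂ (States N n) →ₐ[ℂ] Module.End ℂ (States N (n + 1)) where
  toFun O :=
    { toFun := fun f τ =>
        O (fun τ' => f (Fin.snoc (α := fun _ => ZMod N) τ' (τ (Fin.last n))))
          (fun i => τ i.castSucc)
      map_add' := fun f g => by
        ext τ
        exact congrFun (map_add O _ _) _
      map_smul' := fun c f => by
        ext τ
        exact congrFun (map_smul O c _) _ }
  map_one' := by
    ext1 f
    funext τ
    simp only [LinearMap.coe_mk, AddHom.coe_mk, Module.End.one_apply]
    exact congrArg f (Fin.snoc_init_self τ)
  map_mul' O O' := by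
    ext1 f
    funext τ
    simp [Module.End.mul_apply]
  map_zero' := rfl
  map_add' O O' := rfl
  commutes' c := by
    ext1 f
    funext τ
    simp only [LinearMap.coe_mk, AddHom.coe_mk, Module.algebraMap_end_apply, Pi.smul_apply]
    exact congrArg (fun a => c • f a) (Fin.snoc_init_self τ)

theorem liftOp_apply (O : Module.End ℂ (States N n)) (f : States N (n + 1))
    (τ : Fin (n + 1) → ZMod N) :
    liftOp O f τ = O (fun τ' => f (Fin.snoc (α := fun _ => ZMod N) τ' (τ (Fin.last n))))
      (fun i => τ i.castSucc) := rfl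

/-- The vector `ψ ⊗ |s⟩`. -/
def tens (ψ : States N n) (s : ZMod N) : States N (n + 1) := fun τ =>
  ψ (fun i => τ i.castSucc) * if τ (Fin.last n) = s then 1 else 0

theorem tens_smul (c : ℂ) (ψ : States N n) (s : ZMod N) : tens (c • ψ) s = c • tens ψ s := by
  funext τ; simp only [tens, Pi.smul_apply, smul_eq_mul, mul_assoc]

theorem tens_sum {ι : Type*} (t : Finset ι) (ψ : ι → States N n) (s : ZMod N) :
    tens (∑ i ∈ t, ψ i) s = ∑ i ∈ t, tens (ψ i) s := by
  funext τ; simp only [tens, Finset.sum_apply, Finset.sum_mul]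

theorem liftOp_tens (O : Module.End ℂ (States N n)) (ψ : States N n) (s : ZMod N) :
    liftOp O (tens ψ s) = tens (O ψ) s := by
  funext τ
  have h : (fun τ' : Fin n → ZMod N =>
      tens ψ s (Fin.snoc (α := fun _ => ZMod N) τ' (τ (Fin.last n)))) =
      (if τ (Fin.last n) = s then (1 : ℂ) else 0) • ψ := by
    funext τ'
    simp [tens, mul_comm]
  rw [liftOp_apply, h, map_smul, Pi.smul_apply, tens, smul_eq_mul, mul_comm]

theorem vOp_tens (P : Params) (ψ : States N n) (s : ZMod N) :
    vOp P (Fin.last n) (tens ψ s) = (P.v * omegaPow s) • tens ψ s := by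
  funext τ
  simp only [vOp, LinearMap.coe_mk, AddHom.coe_mk, tens, Pi.smul_apply, smul_eq_mul]
  split_ifs with h
  · rw [h]
  · simp

theorem vInv_tens (P : Params) (ψ : States N n) (s : ZMod N) :
    vInv P (Fin.last n) (tens ψ s) = (P.v * omegaPow s)⁻¹ • tens ψ s := by
  funext τ
  simp only [vInv, LinearMap.coe_mk, AddHom.coe_mk, tens, Pi.smul_apply, smul_eq_mul]
  split_ifs with h
  · rw [h]
  · simp

theorem castSucc_update_last (τ : Fin (n + 1) → ZMod N) (a : ZMod N) :
    (fun i : Fin n => Function.update τ (Fin.last n) a i.castSucc) =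
      fun i => τ i.castSucc := by
  funext i
  rw [Function.update_of_ne (Fin.castSucc_lt_last i).ne]

theorem uOp_tens (P : Params) (ψ : States N n) (s : ZMod N) :
    uOp P (Fin.last n) (tens ψ s) = P.u • tens ψ (s - 1) := by
  funext τ
  simp only [uOp, LinearMap.coe_mk, AddHom.coe_mk, tens, Pi.smul_apply, smul_eq_mul,
    castSucc_update_last, Function.update_self, eq_sub_iff_add_eq]

theorem uInv_tens (P : Params) (ψ : States N n) (s : ZMod N) :
    uInv P (Fin.last n) (tens ψ s) = P.u⁻¹ • tens ψ (s + 1) := by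
  funext τ
  simp only [uInv, LinearMap.coe_mk, AddHom.coe_mk, tens, Pi.smul_apply, smul_eq_mul,
    castSucc_update_last, Function.update_self, sub_eq_iff_eq_add]

theorem snoc_update_castSucc (τ' : Fin n → ZMod N) (s a : ZMod N) (k : Fin n) :
    Function.update (Fin.snoc (α := fun _ => ZMod N) τ' s) k.castSucc a =
      Fin.snoc (α := fun _ => ZMod N) (Function.update τ' k a) s := by
  rw [Fin.snoc_update]

theorem vOp_castSucc (P : Params) (k : Fin n) :
    (vOp P k.castSucc : Module.End ℂ (States N (n + 1))) = liftOp (vOp P k) := by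
  ext1 f
  funext τ
  simp only [liftOp_apply, vOp, LinearMap.coe_mk, AddHom.coe_mk]
  exact congrArg (fun a => P.v * omegaPow (τ k.castSucc) * f a) (Fin.snoc_init_self τ).symm

theorem vInv_castSucc (P : Params) (k : Fin n) :
    (vInv P k.castSucc : Module.End ℂ (States N (n + 1))) = liftOp (vInv P k) := by
  ext1 f
  funext τ
  simp only [liftOp_apply, vInv, LinearMap.coe_mk, AddHom.coe_mk]
  exact congrArg (fun a => (P.v * omegaPow (τ k.castSucc))⁻¹ * f a) (Fin.snoc_init_self τ).symm

theorem uOp_castSucc (P : Params) (k : Fin n) :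
    (uOp P k.castSucc : Module.End ℂ (States N (n + 1))) = liftOp (uOp P k) := by
  ext1 f
  funext τ
  simp only [liftOp_apply, uOp, LinearMap.coe_mk, AddHom.coe_mk]
  rw [← snoc_update_castSucc]
  exact congrArg (fun a => P.u * f (Function.update a k.castSucc (τ k.castSucc + 1)))
    (Fin.snoc_init_self τ).symm

theorem uInv_castSucc (P : Params) (k : Fin n) :
    (uInv P k.castSucc : Module.End ℂ (States N (n + 1))) = liftOp (uInv P k) := by
  ext1 f
  funext τ
  simp only [liftOp_apply, uInv, LinearMap.coe_mk, AddHom.coe_mk]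
  rw [← snoc_update_castSucc]
  exact congrArg (fun a => P.u⁻¹ * f (Function.update a k.castSucc (τ k.castSucc - 1)))
    (Fin.snoc_init_self τ).symm

theorem vOp_liftOp (P : Params) (O : Module.End ℂ (States N n)) :
    liftOp O * vOp P (Fin.last n) = vOp P (Fin.last n) * liftOp O := by
  ext1 f
  funext τ
  simp only [Module.End.mul_apply, liftOp_apply, vOp, LinearMap.coe_mk, AddHom.coe_mk,
    Fin.snoc_last]
  exact congrFun (map_smul O (P.v * omegaPow (τ (Fin.last n))) _) _

theorem snoc_update_last (τ' : Fin n → ZMod N) (s a : ZMod N) :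
    Function.update (Fin.snoc (α := fun _ => ZMod N) τ' s) (Fin.last n) a =
      Fin.snoc (α := fun _ => ZMod N) τ' a := by
  rw [Fin.update_snoc_last]

theorem uOp_liftOp (P : Params) (O : Module.End ℂ (States N n)) :
    liftOp O * uOp P (Fin.last n) = uOp P (Fin.last n) * liftOp O := by
  ext1 f
  funext τ
  simp only [Module.End.mul_apply, liftOp_apply, uOp, LinearMap.coe_mk, AddHom.coe_mk,
    Fin.snoc_last, snoc_update_last, castSucc_update_last, Function.update_self]
  exact congrFun (map_smul O P.u _) _

theorem uInv_liftOp (P : Params) (O : Module.End ℂ (States N n)) :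
    liftOp O * uInv P (Fin.last n) = uInv P (Fin.last n) * liftOp O := by
  ext1 f
  funext τ
  simp only [Module.End.mul_apply, liftOp_apply, uInv, LinearMap.coe_mk, AddHom.coe_mk,
    Fin.snoc_last, snoc_update_last, castSucc_update_last, Function.update_self]
  exact congrFun (map_smul O P.u⁻¹ _) _

end lift

/-! ### The monodromy matrices -/

section monodromy
variable {N n : ℕ}

/-- The monodromy matrix `L₁(z) ⋯ Lₙ(z)` of the open chain. -/
def openMon (P : Params) (n : ℕ) (z : ℂ) : Matrix (Fin 2) (Fin 2) (Module.End ℂ (States N n)) :=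
  (List.ofFn fun k : Fin n => lax P k z).prod

/-- The monodromy matrix `L̃ₙ(z) ⋯ L̃₁(z)` of the open chain. -/
def openMonTilde (P : Params) (n : ℕ) (z : ℂ) :
    Matrix (Fin 2) (Fin 2) (Module.End ℂ (States N n)) :=
  (List.ofFn fun k : Fin n => laxTilde P k z).reverse.prod

/-- `liftOp`, entry by entry. -/
def liftMat : Matrix (Fin 2) (Fin 2) (Module.End ℂ (States N n)) →ₐ[ℂ]
    Matrix (Fin 2) (Fin 2) (Module.End ℂ (States N (n + 1))) := liftOp.mapMatrix

theorem liftMat_apply (M : Matrix (Fin 2) (Fin 2) (Module.End ℂ (States N n))) (i j : Fin 2) :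
    liftMat M i j = liftOp (M i j) := rfl

theorem lax_castSucc (P : Params) (k : Fin n) (z : ℂ) :
    (lax P k.castSucc z : Matrix _ _ (Module.End ℂ (States N (n + 1)))) =
      liftMat (lax P k z) := by
  ext1 i j
  rw [liftMat_apply]
  fin_cases i <;> fin_cases j <;>
    simp [lax, vOp_castSucc, uOp_castSucc, uInv_castSucc]

theorem laxTilde_castSucc (P : Params) (k : Fin n) (z : ℂ) :
    (laxTilde P k.castSucc z : Matrix _ _ (Module.End ℂ (States N (n + 1)))) =
      liftMat (laxTilde P k z) := by
  ext1 i j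
  rw [liftMat_apply]
  fin_cases i <;> fin_cases j <;>
    simp [laxTilde, vInv_castSucc, uOp_castSucc, uInv_castSucc]

theorem liftMat_kMinus (P : Params) (z : ℂ) :
    liftMat (kMinus P z : Matrix _ _ (Module.End ℂ (States N n))) = kMinus P z := by
  ext1 i j
  rw [liftMat_apply]
  fin_cases i <;> fin_cases j <;> simp [kMinus]

theorem openMon_zero (P : Params) (z : ℂ) :
    (openMon P 0 z : Matrix _ _ (Module.End ℂ (States N 0))) = 1 := by
  simp [openMon]

theorem openMonTilde_zero (P : Params) (z : ℂ) :
    (openMonTilde P 0 z : Matrix _ _ (Module.End ℂ (States N 0))) = 1 := by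
  simp [openMonTilde]

theorem openMon_succ (P : Params) (z : ℂ) :
    (openMon P (n + 1) z : Matrix _ _ (Module.End ℂ (States N (n + 1)))) =
      liftMat (openMon P n z) * lax P (Fin.last n) z := by
  rw [openMon, List.ofFn_succ', List.concat_eq_append, List.prod_append, List.prod_singleton,
    openMon, map_list_prod, List.map_ofFn]
  simp only [lax_castSucc, Function.comp_def]

theorem openMonTilde_succ (P : Params) (z : ℂ) :
    (openMonTilde P (n + 1) z : Matrix _ _ (Module.End ℂ (States N (n + 1)))) =
      laxTilde P (Fin.last n) z * liftMat (openMonTilde P n z) := by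
  rw [openMonTilde, List.ofFn_succ', List.concat_eq_append, List.reverse_append,
    List.reverse_singleton, List.singleton_append, List.prod_cons,
    openMonTilde, map_list_prod, List.map_reverse, List.map_ofFn]
  simp only [laxTilde_castSucc, Function.comp_def]

theorem monodromy_eq (P : Params) (z : ℂ) :
    (monodromy P z : Matrix _ _ (Module.End ℂ (States N n))) =
      openMonTilde P n z * kMinus P z * openMon P n z := rfl

theorem monodromy_succ (P : Params) (z : ℂ) :
    (monodromy P z : Matrix _ _ (Module.End ℂ (States N (n + 1)))) =
      laxTilde P (Fin.last n) z * liftMat (monodromy P z) * lax P (Fin.last n) z := by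
  simp only [monodromy_eq, openMon_succ, openMonTilde_succ, map_mul, liftMat_kMinus, mul_assoc]

end monodromy

/-! ### Relations at the last site -/

section relations
variable {N n : ℕ} [NeZero N]

theorem uOp_mul_vOp (P : Params) (k : Fin n) :
    (uOp P k * vOp P k : Module.End ℂ (States N n)) = omega N • (vOp P k * uOp P k) := by
  refine LinearMap.ext fun f => funext fun τ => ?_
  simp only [Module.End.mul_apply, uOp, vOp, LinearMap.coe_mk, AddHom.coe_mk,
    Function.update_self, omegaPow_add_one, LinearMap.smul_apply, Pi.smul_apply, smul_eq_mul]
  ring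


theorem uInv_mul_vOp {P : Params} (k : Fin n) :
    (uInv P k * vOp P k : Module.End ℂ (States N n)) = (omega N)⁻¹ • (vOp P k * uInv P k) := by
  refine LinearMap.ext fun f => funext fun τ => ?_
  simp only [Module.End.mul_apply, uInv, vOp, LinearMap.coe_mk, AddHom.coe_mk,
    Function.update_self, omegaPow_sub_one, LinearMap.smul_apply, Pi.smul_apply, smul_eq_mul]
  ring

theorem uOp_mul_vInv {P : Params} (hP : P.Nondegenerate) (k : Fin n) :
    (uOp P k * vInv P k : Module.End ℂ (States N n)) = (omega N)⁻¹ • (vInv P k * uOp P k) := by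
  refine LinearMap.ext fun f => funext fun τ => ?_
  have := omega_ne_zero N
  have := omegaPow_ne_zero (τ k)
  have := hP.v_ne
  simp only [Module.End.mul_apply, uOp, vInv, LinearMap.coe_mk, AddHom.coe_mk,
    Function.update_self, omegaPow_add_one, LinearMap.smul_apply, Pi.smul_apply, smul_eq_mul]
  field_simp

theorem uInv_mul_vInv {P : Params} (hP : P.Nondegenerate) (k : Fin n) :
    (uInv P k * vInv P k : Module.End ℂ (States N n)) = omega N • (vInv P k * uInv P k) := by
  refine LinearMap.ext fun f => funext fun τ => ?_
  have := omega_ne_zero N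
  have := omegaPow_ne_zero (τ k)
  have := hP.v_ne
  simp only [Module.End.mul_apply, uInv, vInv, LinearMap.coe_mk, AddHom.coe_mk,
    Function.update_self, omegaPow_sub_one, LinearMap.smul_apply, Pi.smul_apply, smul_eq_mul]
  field_simp

/-- The relations between the operators `v, v⁻¹, u, u⁻¹` of one site. -/
structure SiteRel {R : Type*} [Ring R] [Algebra ℂ R] (q : ℂ) (v w u p : R) : Prop where
  vw : v * w = 1
  wv : w * v = 1
  up : u * p = 1
  pu : p * u = 1
  uv : u * v = q • (v * u)
  pv : p * v = q⁻¹ • (v * p)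
  uw : u * w = q⁻¹ • (w * u)
  pw : p * w = q • (w * p)

theorem siteRel {P : Params} (hP : P.Nondegenerate) (k : Fin n) :
    SiteRel (omega N) (vOp P k : Module.End ℂ (States N n)) (vInv P k) (uOp P k) (uInv P k) where
  vw := (vOp_mul_vInv P hP.v_ne k).1
  wv := (vOp_mul_vInv P hP.v_ne k).2
  up := (uOp_mul_uInv P hP.u_ne k).1
  pu := (uOp_mul_uInv P hP.u_ne k).2
  uv := uOp_mul_vOp P k
  pv := uInv_mul_vOp k
  uw := uOp_mul_vInv hP k
  pw := uInv_mul_vInv hP k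

end relations

namespace SiteRel
variable {R : Type*} [Ring R] [Algebra ℂ R] {q : ℂ} {v w u p : R}

theorem vw' (h : SiteRel q v w u p) (x : R) : v * (w * x) = x := by
  rw [← mul_assoc, h.vw, one_mul]

theorem wv' (h : SiteRel q v w u p) (x : R) : w * (v * x) = x := by
  rw [← mul_assoc, h.wv, one_mul]

theorem up' (h : SiteRel q v w u p) (x : R) : u * (p * x) = x := by
  rw [← mul_assoc, h.up, one_mul]

theorem pu' (h : SiteRel q v w u p) (x : R) : p * (u * x) = x := by
  rw [← mul_assoc, h.pu, one_mul]

theorem uv' (h : SiteRel q v w u p) (x : R) : u * (v * x) = q • (v * (u * x)) := by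
  rw [← mul_assoc, h.uv, smul_mul_assoc, mul_assoc]

theorem pv' (h : SiteRel q v w u p) (x : R) : p * (v * x) = q⁻¹ • (v * (p * x)) := by
  rw [← mul_assoc, h.pv, smul_mul_assoc, mul_assoc]

theorem pw' (h : SiteRel q v w u p) (x : R) : p * (w * x) = q • (w * (p * x)) := by
  rw [← mul_assoc, h.pw, smul_mul_assoc, mul_assoc]

end SiteRel

theorem end_neg_mul {N n : ℕ} (a b : Module.End ℂ (States N n)) : -a * b = -(a * b) :=
  neg_mul a b

theorem end_mul_neg {N n : ℕ} (a b : Module.End ℂ (States N n)) : a * -b = -(a * b) :=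
  mul_neg a b

/-! ### Entries of the monodromy matrices -/

section entries
variable {N n : ℕ} [NeZero N]

theorem vOp_liftOp' (P : Params) (O : Module.End ℂ (States N n)) (x) :
    liftOp O * (vOp P (Fin.last n) * x) = vOp P (Fin.last n) * (liftOp O * x) := by
  rw [← mul_assoc, vOp_liftOp, mul_assoc]

theorem uOp_liftOp' (P : Params) (O : Module.End ℂ (States N n)) (x) :
    liftOp O * (uOp P (Fin.last n) * x) = uOp P (Fin.last n) * (liftOp O * x) := by
  rw [← mul_assoc, uOp_liftOp, mul_assoc]

theorem uInv_liftOp' (P : Params) (O : Module.End ℂ (States N n)) (x) :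
    liftOp O * (uInv P (Fin.last n) * x) = uInv P (Fin.last n) * (liftOp O * x) := by
  rw [← mul_assoc, uInv_liftOp, mul_assoc]

theorem openMon_succ_00 (P : Params) (z : ℂ) :
    (openMon P (n + 1) z 0 0 : Module.End ℂ (States N (n + 1))) =
      (1 + (P.κ / z) • vOp P (Fin.last n)) * liftOp (openMon P n z 0 0) +
        uInv P (Fin.last n) * vOp P (Fin.last n) * liftOp (openMon P n z 0 1) := by
  rw [openMon_succ, Matrix.mul_apply, Fin.sum_univ_two]
  simp [liftMat_apply, lax, mul_add, add_mul, mul_assoc, vOp_liftOp, uInv_liftOp']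

theorem openMon_succ_01 (P : Params) (z : ℂ) :
    (openMon P (n + 1) z 0 1 : Module.End ℂ (States N (n + 1))) =
      -((1 / z) • (uOp P (Fin.last n) * liftOp (openMon P n z 0 0))) := by
  rw [openMon_succ, Matrix.mul_apply, Fin.sum_univ_two]
  simp [liftMat_apply, lax, uOp_liftOp, end_mul_neg]

theorem openMon_succ_10 (P : Params) (z : ℂ) :
    (openMon P (n + 1) z 1 0 : Module.End ℂ (States N (n + 1))) =
      (1 + (P.κ / z) • vOp P (Fin.last n)) * liftOp (openMon P n z 1 0) +
        uInv P (Fin.last n) * vOp P (Fin.last n) * liftOp (openMon P n z 1 1) := by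
  rw [openMon_succ, Matrix.mul_apply, Fin.sum_univ_two]
  simp [liftMat_apply, lax, mul_add, add_mul, mul_assoc, vOp_liftOp, uInv_liftOp']

theorem openMon_succ_11 (P : Params) (z : ℂ) :
    (openMon P (n + 1) z 1 1 : Module.End ℂ (States N (n + 1))) =
      -((1 / z) • (uOp P (Fin.last n) * liftOp (openMon P n z 1 0))) := by
  rw [openMon_succ, Matrix.mul_apply, Fin.sum_univ_two]
  simp [liftMat_apply, lax, uOp_liftOp, end_mul_neg]

theorem openMonTilde_succ_0 (P : Params) (z : ℂ) (j : Fin 2) :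
    (openMonTilde P (n + 1) z 0 j : Module.End ℂ (States N (n + 1))) =
      ((P.κ * z) • 1 + (omega N * P.θ) • vInv P (Fin.last n)) * liftOp (openMonTilde P n z 0 j) -
        P.θ • (uInv P (Fin.last n) * liftOp (openMonTilde P n z 1 j)) := by
  rw [openMonTilde_succ, Matrix.mul_apply, Fin.sum_univ_two]
  simp [liftMat_apply, laxTilde, sub_eq_add_neg, end_neg_mul]

theorem openMonTilde_succ_1 (P : Params) (z : ℂ) (j : Fin 2) :
    (openMonTilde P (n + 1) z 1 j : Module.End ℂ (States N (n + 1))) =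
      z • (vInv P (Fin.last n) * uOp P (Fin.last n) * liftOp (openMonTilde P n z 0 j)) := by
  rw [openMonTilde_succ, Matrix.mul_apply, Fin.sum_univ_two]
  simp [liftMat_apply, laxTilde]

/-- The product of the operators `ωθ vₖ⁻¹`. -/
def vInvProd (P : Params) : (n : ℕ) → Module.End ℂ (States N n)
  | 0 => 1
  | n + 1 => (omega N * P.θ) • (vInv P (Fin.last n) * liftOp (vInvProd P n))

/-- The crossing relation between the two open monodromy matrices. -/
theorem crossing {P : Params} (hP : P.Nondegenerate) (n : ℕ) {z : ℂ} (hz : z ≠ 0) :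
    (openMonTilde P n z 0 0 : Module.End ℂ (States N n)) =
        vInvProd P n * openMon P n (omega N * P.θ / z) 0 0 ∧
      (openMonTilde P n z 0 1 : Module.End ℂ (States N n)) =
        -(vInvProd P n * openMon P n (omega N * P.θ / z) 1 0) ∧
      (openMonTilde P n z 1 0 : Module.End ℂ (States N n)) =
        -(vInvProd P n * openMon P n (omega N * P.θ / z) 0 1) ∧
      (openMonTilde P n z 1 1 : Module.End ℂ (States N n)) =
        vInvProd P n * openMon P n (omega N * P.θ / z) 1 1 := by
  induction n with
  | zero => simp [openMon_zero, openMonTilde_zero, vInvProd]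
  | succ n ih =>
    obtain ⟨h00, h01, h10, h11⟩ := ih
    have h := siteRel (N := N) hP (Fin.last n)
    have hω := omega_ne_zero N
    have hθ := hP.θ_ne
    refine ⟨?_, ?_, ?_, ?_⟩
    -- The operators of the last site are moved to the left of the lifted ones and put in a fixed
    -- order, after which only scalar coefficients remain to be compared.
    all_goals
      simp only [openMonTilde_succ_0, openMonTilde_succ_1, openMon_succ_00, openMon_succ_01,
        openMon_succ_10, openMon_succ_11, h00, h01, h10, h11, vInvProd, map_mul, map_neg,
        mul_add, add_mul, mul_assoc, smul_mul_assoc, mul_smul_comm, end_mul_neg, one_mul,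
        smul_neg, smul_smul, vOp_liftOp', uOp_liftOp', uInv_liftOp', h.wv', h.pv']
      match_scalars <;> field_simp

/-- Inversion of the open monodromy matrix. -/
theorem openMon_mul_openMonTilde {P : Params} (hP : P.Nondegenerate) (n : ℕ) {z : ℂ}
    (hz : z ≠ 0) :
    (openMon P n (P.θ / z) * !![0, 1; 1, 0] * openMonTilde P n z :
      Matrix (Fin 2) (Fin 2) (Module.End ℂ (States N n))) = z ^ n • !![0, 1; 1, 0] := by
  induction n with
  | zero => simp [openMon_zero, openMonTilde_zero]
  | succ n ih =>
    have h := siteRel (N := N) hP (Fin.last n)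
    have hθ := hP.θ_ne
    -- Inversion at one site. The last site stands in the middle of the product, which therefore
    -- telescopes outwards, each site contributing a factor z.
    have hL : (lax P (Fin.last n) (P.θ / z) * !![0, 1; 1, 0] * laxTilde P (Fin.last n) z :
        Matrix (Fin 2) (Fin 2) (Module.End ℂ (States N (n + 1)))) =
        z • liftMat !![0, 1; 1, 0] := by
      have hω := omega_ne_zero N
      ext1 i j
      fin_cases i <;> fin_cases j <;>
        simp [lax, laxTilde, Matrix.mul_apply, Fin.sum_univ_two, liftMat_apply]
      all_goals
        try simp only [mul_add, add_mul, mul_assoc, smul_mul_assoc, mul_smul_comm, one_mul, mul_one,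
          end_mul_neg, end_neg_mul, smul_neg, smul_smul, h.vw',
          h.pw', h.vw, h.pu, h.up, h.pv, h.uw, smul_add]
        try (match_scalars <;> field_simp <;> ring)
    rw [openMon_succ, openMonTilde_succ]
    have e : (liftMat (openMon P n (P.θ / z)) * lax P (Fin.last n) (P.θ / z) * !![0, 1; 1, 0] *
        (laxTilde P (Fin.last n) z * liftMat (openMonTilde P n z)) :
        Matrix (Fin 2) (Fin 2) (Module.End ℂ (States N (n + 1)))) =
        liftMat (openMon P n (P.θ / z)) * (lax P (Fin.last n) (P.θ / z) * !![0, 1; 1, 0] *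
          laxTilde P (Fin.last n) z) * liftMat (openMonTilde P n z) := by
      simp only [mul_assoc]
    rw [e, hL, mul_smul_comm, smul_mul_assoc, ← map_mul, ← map_mul, ih, map_smul, smul_smul,
      pow_succ']
    congr 1
    ext1 i j
    rw [liftMat_apply]
    fin_cases i <;> fin_cases j <;> simp

end entries

/-! ### Vector-valued polynomial functions -/

section poly
variable {V W : Type*} [AddCommGroup V] [Module ℂ V] [AddCommGroup W] [Module ℂ W]

/-- `f` is a polynomial function of degree `< m`. -/
def PolyLT (m : ℕ) (f : ℂ → V) : Prop :=
  ∃ c : ℕ → V, ∀ x, f x = ∑ i ∈ Finset.range m, x ^ i • c i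

theorem PolyLT.zero (m : ℕ) : PolyLT m (fun _ => (0 : V)) := ⟨0, by simp⟩

theorem PolyLT.add {m : ℕ} {f g : ℂ → V} (hf : PolyLT m f) (hg : PolyLT m g) :
    PolyLT m (fun x => f x + g x) := by
  obtain ⟨c, hc⟩ := hf
  obtain ⟨d, hd⟩ := hg
  exact ⟨c + d, fun x => by simp [hc, hd, Finset.sum_add_distrib]⟩

theorem PolyLT.map {m : ℕ} {f : ℂ → V} (hf : PolyLT m f) (g : V →ₗ[ℂ] W) :
    PolyLT m (fun x => g (f x)) := by
  obtain ⟨c, hc⟩ := hf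
  exact ⟨fun i => g (c i), fun x => by simp [hc]⟩

theorem PolyLT.smul {m : ℕ} {f : ℂ → V} (hf : PolyLT m f) (a : ℂ) :
    PolyLT m (fun x => a • f x) := hf.map (a • LinearMap.id)

theorem PolyLT.neg {m : ℕ} {f : ℂ → V} (hf : PolyLT m f) : PolyLT m (fun x => -f x) :=
  hf.map (-LinearMap.id)

theorem PolyLT.sub {m : ℕ} {f g : ℂ → V} (hf : PolyLT m f) (hg : PolyLT m g) :
    PolyLT m (fun x => f x - g x) := by
  simpa only [sub_eq_add_neg] using hf.add hg.neg

theorem PolyLT.mono {m m' : ℕ} {f : ℂ → V} (hf : PolyLT m f) (h : m ≤ m') : PolyLT m' f := by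
  obtain ⟨c, hc⟩ := hf
  refine ⟨fun i => if i < m then c i else 0, fun x => ?_⟩
  rw [hc, ← Finset.sum_subset (Finset.range_mono h) (fun i _ hi => by
    simp only [if_neg (show ¬ i < m by simpa using hi), smul_zero])]
  exact Finset.sum_congr rfl fun i hi => by simp only [if_pos (Finset.mem_range.1 hi)]

theorem PolyLT.var_smul {m : ℕ} {f : ℂ → V} (hf : PolyLT m f) :
    PolyLT (m + 1) (fun x => x • f x) := by
  obtain ⟨c, hc⟩ := hf
  refine ⟨fun i => if i = 0 then 0 else c (i - 1), fun x => ?_⟩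
  simp [Finset.sum_range_succ', hc, Finset.smul_sum, smul_smul, pow_succ']

theorem PolyLT.pow_smul {m k : ℕ} (h : k < m) (v : V) : PolyLT m (fun x => x ^ k • v) := by
  refine ⟨fun i => if i = k then v else 0, fun x => ?_⟩
  simp [h]

theorem PolyLT.const {m : ℕ} (h : 0 < m) (v : V) : PolyLT m (fun _ => v) := by
  simpa using PolyLT.pow_smul h v

theorem PolyLT.sum {m : ℕ} {ι : Type*} (s : Finset ι) {f : ι → ℂ → V}
    (hf : ∀ i ∈ s, PolyLT m (f i)) : PolyLT m (fun x => ∑ i ∈ s, f i x) := by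
  classical
  induction s using Finset.induction_on with
  | empty => simpa using PolyLT.zero m
  | insert a s ha ih =>
    simp only [Finset.sum_insert ha]
    exact (hf a (Finset.mem_insert_self a s)).add
      (ih fun i hi => hf i (Finset.mem_insert_of_mem hi))

theorem PolyLT.linear_mul {m : ℕ} {f : ℂ → ℂ} (hf : PolyLT m f) (a b : ℂ) :
    PolyLT (m + 1) (fun x => (a + b * x) * f x) := by
  convert ((hf.smul a).mono m.le_succ).add (hf.smul b).var_smul using 2 with x
  simp only [smul_eq_mul]
  ring

/-- A product of linear factors, without its leading term. -/
theorem PolyLT.prod_sub {ι : Type*} (s : Finset ι) (a b : ι → ℂ) :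
    PolyLT s.card (fun x => ∏ i ∈ s, (a i + b i * x) - (∏ i ∈ s, b i) * x ^ s.card) := by
  classical
  induction s using Finset.induction_on with
  | empty => simpa using PolyLT.zero (V := ℂ) 0
  | insert i s hi ih =>
    rw [Finset.card_insert_of_notMem hi]
    convert (ih.linear_mul (a i) (b i)).add
      (PolyLT.pow_smul s.card.lt_succ_self (a i * ∏ j ∈ s, b j)) using 2 with x
    simp only [Finset.prod_insert hi, smul_eq_mul]
    ring

theorem PolyLT.prod {ι : Type*} (s : Finset ι) (a b : ι → ℂ) :
    PolyLT (s.card + 1) (fun x => ∏ i ∈ s, (a i + b i * x)) := by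
  convert ((PolyLT.prod_sub s a b).mono s.card.le_succ).add
    (PolyLT.pow_smul s.card.lt_succ_self (∏ j ∈ s, b j)) using 2 with x
  simp only [smul_eq_mul]
  ring

variable {ι : Type*} [Fintype ι] [DecidableEq ι]

/-- Lagrange interpolation of vector-valued polynomials. -/
theorem PolyLT.lagrange {f : ℂ → V} (hf : PolyLT (Fintype.card ι) f) {x : ι → ℂ}
    (hx : Function.Injective x) (t : ℂ) :
    f t = ∑ r, (∏ s ∈ Finset.univ.erase r, (t - x s) / (x r - x s)) • f (x r) := by
  obtain ⟨c, hc⟩ := hf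
  have key : ∀ i ∈ Finset.range (Fintype.card ι), t ^ i =
      ∑ r, (∏ s ∈ Finset.univ.erase r, (t - x s) / (x r - x s)) * x r ^ i := by
    intro i hi
    have h := Lagrange.eq_interpolate (s := Finset.univ) (v := x)
      (f := (Polynomial.X : Polynomial ℂ) ^ i) hx.injOn (by
        rw [Polynomial.degree_X_pow, Finset.card_univ]
        exact_mod_cast Finset.mem_range.1 hi)
    have h2 := congrArg (Polynomial.eval t) h
    rw [Polynomial.eval_pow, Polynomial.eval_X] at h2
    rw [h2, Lagrange.interpolate_apply, Polynomial.eval_finsetSum]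
    refine Finset.sum_congr rfl fun r _ => ?_
    simp only [Polynomial.eval_mul, Polynomial.eval_C, Polynomial.eval_pow, Polynomial.eval_X,
      Lagrange.basis, Polynomial.eval_prod, Lagrange.basisDivisor, Polynomial.eval_sub]
    rw [mul_comm]
    congr 1
    exact Finset.prod_congr rfl fun s _ => by rw [div_eq_inv_mul]
  simp only [hc, Finset.smul_sum, smul_smul]
  rw [Finset.sum_comm]
  refine Finset.sum_congr rfl fun i hi => ?_
  rw [key i hi, Finset.sum_smul]

theorem PolyLT.eq_zero {f : ℂ → V} (hf : PolyLT (Fintype.card ι) f) {x : ι → ℂ}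
    (hx : Function.Injective x) (h0 : ∀ r, f (x r) = 0) (t : ℂ) : f t = 0 := by
  simp [hf.lagrange hx t, h0]

/-- A polynomial of degree `< n` with `n` zeros has vanishing coefficients. -/
theorem coeff_eq_zero {n : ℕ} {x : Fin n → ℂ} (hx : Function.Injective x) {c : Fin n → V}
    (h : ∀ k, ∑ i : Fin n, x k ^ (i : ℕ) • c i = 0) (i : Fin n) : c i = 0 := by
  have hdet : IsUnit (Matrix.vandermonde x).det :=
    isUnit_iff_ne_zero.2 (Matrix.det_vandermonde_ne_zero_iff.2 hx)
  have hinv := Matrix.nonsing_inv_mul _ hdet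
  have e : ∑ k, (Matrix.vandermonde x)⁻¹ i k • ∑ j : Fin n, x k ^ (j : ℕ) • c j = c i := by
    simp only [Finset.smul_sum, smul_smul]
    rw [Finset.sum_comm]
    simp only [← Finset.sum_smul]
    have h2 : ∀ j : Fin n, ∑ k, (Matrix.vandermonde x)⁻¹ i k * x k ^ (j : ℕ) =
        (1 : Matrix (Fin n) (Fin n) ℂ) i j := by
      intro j
      rw [← hinv, Matrix.mul_apply]
      rfl
    simp [h2, Matrix.one_apply]
  rw [← e]
  simp [h]

/-- The version for coefficients numbered by falling powers, as the Hamiltonians are. -/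
theorem coeff_rev_eq_zero {n : ℕ} {x : Fin n → ℂ} (hx : Function.Injective x) {c : Fin n → V}
    (h : ∀ k, ∑ i : Fin n, x k ^ (n - 1 - (i : ℕ)) • c i = 0) (i : Fin n) : c i = 0 := by
  have h2 := coeff_eq_zero (c := fun i => c i.rev) hx (fun k => by
    rw [← h k, ← Equiv.sum_comp Fin.revPerm]
    refine Finset.sum_congr rfl fun i _ => ?_
    simp only [Fin.revPerm_apply, Fin.rev_rev, Fin.val_rev]
    congr 2
    omega) i.rev
  simpa using h2

end poly

/-! ### Polynomial structure of the transfer matrix -/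

section structure_U
variable {N n : ℕ} [NeZero N]

/-- The coefficients of `η₋` in the off-diagonal entries of the monodromy matrix that survive at
`z² = θ`. -/
def edge (P : Params) (z : ℂ) : ℕ → ℂ × ℂ
  | 0 => (1, 1)
  | n + 1 => (P.θ / z * (edge P z n).2, z * (edge P z n).1)

/-- The constants `(z β - (θ/z) χ) / (θ/z - z)` and `(β - χ) / (θ/z - z)` for `(β, χ) = edge`. -/
def edgeQuot (P : Params) : ℕ → ℂ × ℂ
  | 0 => (-1, 0)
  | n + 1 => (-P.θ * (edgeQuot P n).2, -(edgeQuot P n).1)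

/-- These two combinations of the η₋ parts enter the next first entry. That their quotients by θ/z -
z are constants keeps this entry divisible by θ/z - z with a polynomial quotient. -/
theorem edge_spec (P : Params) {z : ℂ} (hz : z ≠ 0) (n : ℕ) :
    z * (edge P z n).1 - P.θ / z * (edge P z n).2 = (P.θ / z - z) * (edgeQuot P n).1 ∧
      (edge P z n).1 - (edge P z n).2 = (P.θ / z - z) * (edgeQuot P n).2 := by
  induction n with
  | zero => simp [edge, edgeQuot]
  | succ n ih =>
    constructor
    · rw [edge, edgeQuot]
      have := ih.2
      field_simp
      field_simp at this
      linear_combination (-1) * P.θ * this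
    · rw [edge, edgeQuot]
      linear_combination -ih.1

theorem edge_add_two (P : Params) {z : ℂ} (hz : z ≠ 0) (n : ℕ) :
    edge P z (n + 2) = (P.θ * (edge P z n).1, P.θ * (edge P z n).2) := by
  simp only [edge]
  ext <;> field_simp

theorem edge_pPoly (P : Params) {z : ℂ} (hz : z ≠ 0) (n : ℕ) :
    (edge P z n).2 + omega N * (edge P z n).1 = pPoly N n P z := by
  induction n using Nat.twoStepInduction with
  | zero => simp [edge, pPoly]
  | one =>
    simp [edge, pPoly]
    ring
  | more n ih _ =>
    rw [edge_add_two P hz]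
    have e : pPoly N (n + 2) P z = P.θ * pPoly N n P z := by
      have h2 : (n + 2) / 2 = n / 2 + 1 := by omega
      by_cases hn : Odd n
      · have h1 : (n + 2 - 1) / 2 = (n - 1) / 2 + 1 := by
          obtain ⟨k, rfl⟩ := hn
          omega
        have hn2 : Odd (n + 2) := hn.add_even even_two
        rw [pPoly, pPoly, if_pos hn, if_pos hn2, h1, pow_succ]
        ring
      · have hn2 : ¬ Odd (n + 2) := fun h => hn (by
          rw [Nat.odd_add] at h
          exact h.2 even_two)
        rw [pPoly, pPoly, if_neg hn, if_neg hn2, h2, pow_succ]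
        ring
    rw [e, ← ih]
    ring

theorem monodromy_zero (P : Params) (z : ℂ) :
    (monodromy P z : Matrix _ _ (Module.End ℂ (States N 0))) = kMinus P z := by
  simp [monodromy]

theorem monodromy_succ_entries {P : Params} (hP : P.Nondegenerate) {z : ℂ} (hz : z ≠ 0) :
    let v := vOp P (Fin.last n)
    let w := vInv P (Fin.last n)
    let u := uOp P (Fin.last n)
    let p := uInv P (Fin.last n)
    let A : Module.End ℂ (States N (n + 1)) := liftOp (monodromy P z 0 0)
    let B : Module.End ℂ (States N (n + 1)) := liftOp (monodromy P z 0 1)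
    let C : Module.End ℂ (States N (n + 1)) := liftOp (monodromy P z 1 0)
    let D : Module.End ℂ (States N (n + 1)) := liftOp (monodromy P z 1 1)
    monodromy P z 0 0 = (P.κ * (z + omega N * P.θ / z)) • A + P.κ ^ 2 • (v * A) +
        (omega N * P.θ) • (w * A) + ((P.κ * z * (omega N)⁻¹) • (v * (p * B)) + P.θ • (p * B)) -
        (P.θ • (p * C) + (P.θ * (P.κ / z) * (omega N)⁻¹) • (v * (p * C))) -
        (P.θ * ((omega N)⁻¹ * (omega N)⁻¹)) • (v * (p * (p * D))) ∧
      monodromy P z 0 1 = -(P.κ • (u * A) + (omega N * P.θ / z) • (w * (u * A))) +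
        (P.θ / z) • C ∧
      monodromy P z 1 0 = z • (w * (u * A)) + (P.κ * omega N) • (u * A) + z • B ∧
      monodromy P z 1 1 = -(w * (u * (u * A))) := by
  intro v w u p A B C D
  have h := siteRel (N := N) hP (Fin.last n)
  have hω := omega_ne_zero N
  rw [monodromy_succ]
  simp only [Matrix.mul_apply, Fin.sum_univ_two, liftMat_apply]
  refine ⟨?_, ?_, ?_, ?_⟩
  all_goals
    simp only [lax, laxTilde, Matrix.of_apply, Matrix.cons_val_zero, Matrix.cons_val_one,
      Matrix.cons_val', Matrix.cons_val_fin_one, mul_zero, zero_mul, add_zero,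
      end_mul_neg, end_neg_mul, mul_add, add_mul, mul_assoc, mul_one, one_mul,
      smul_mul_assoc, mul_smul_comm, smul_neg, smul_add, smul_smul,
      vOp_liftOp, uOp_liftOp, uInv_liftOp', h.wv', h.pu', h.up', h.uv', h.pv', A, B, C, D, v, w, u, p]
    match_scalars <;> field_simp

/-- The entries of the monodromy matrix are, up to explicit terms, polynomials in
`z + ωθ / z`. -/
theorem monodromy_poly {P : Params} (hP : P.Nondegenerate) (n : ℕ) :
    ∃ a b c d : ℂ → Module.End ℂ (States N n),
      PolyLT n (fun x => a x - (P.αm * P.κ ^ n * x ^ n) • 1) ∧ PolyLT n b ∧ PolyLT n c ∧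
      PolyLT n d ∧ ∀ z : ℂ, z ≠ 0 →
        monodromy P z 0 0 = (P.θ / z - z) • a (z + omega N * P.θ / z) ∧
        monodromy P z 0 1 = (P.θ / z - z) • (c (z + omega N * P.θ / z) -
          (omega N * P.θ / z) • b (z + omega N * P.θ / z)) + (P.ηm * (edge P z n).1) • 1 ∧
        monodromy P z 1 0 = (P.θ / z - z) • (z • b (z + omega N * P.θ / z) -
          omega N • c (z + omega N * P.θ / z)) + (P.ηm * (edge P z n).2) • 1 ∧
        monodromy P z 1 1 = (P.θ / z - z) • d (z + omega N * P.θ / z) := by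
  have hω := omega_ne_zero N
  induction n with
  | zero =>
    refine ⟨fun _ => P.αm • 1, 0, 0, 0, ?_, PolyLT.zero 0, PolyLT.zero 0, PolyLT.zero 0, ?_⟩
    · simpa using PolyLT.zero (V := Module.End ℂ (States N 0)) 0
    · intro z hz
      rw [monodromy_zero]
      simp [kMinus, edge, smul_smul, mul_comm]
  | succ n ih =>
    obtain ⟨a, b, c, d, ha, hb, hc, hd, hU⟩ := ih
    have hlift : ∀ {f : ℂ → Module.End ℂ (States N n)} {m : ℕ}, PolyLT m f →
        PolyLT m (fun x => (liftOp (f x) : Module.End ℂ (States N (n + 1)))) :=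
      fun hf => hf.map liftOp.toLinearMap
    have hmul : ∀ {f : ℂ → Module.End ℂ (States N (n + 1))} {m : ℕ}
        (O : Module.End ℂ (States N (n + 1))), PolyLT m f → PolyLT m (fun x => O * f x) :=
      fun O hf => hf.map (LinearMap.mulLeft ℂ O)
    let v := (vOp P (Fin.last n) : Module.End ℂ (States N (n + 1)))
    let w := (vInv P (Fin.last n) : Module.End ℂ (States N (n + 1)))
    let u := (uOp P (Fin.last n) : Module.End ℂ (States N (n + 1)))
    let p := (uInv P (Fin.last n) : Module.End ℂ (States N (n + 1)))
    have ha' : PolyLT (n + 1) a := by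
      have h1 := (ha.mono n.le_succ).add (PolyLT.pow_smul n.lt_succ_self
        ((P.αm * P.κ ^ n) • (1 : Module.End ℂ (States N n))))
      convert h1 using 2 with x
      rw [smul_smul, mul_comm (x ^ n), sub_add_cancel]
    have hA := hlift ha'
    have hB := (hlift hb).mono n.le_succ
    have hC := (hlift hc).mono n.le_succ
    have hD := (hlift hd).mono n.le_succ
    have hxB := (hlift hb).var_smul
    have hxC := (hlift hc).var_smul
    -- After removal of the η₋ parts and of the factor θ/z - z, the off-diagonal entries are β = c -
    -- (ωθ/z)b and χ = zb - ωc. They are not polynomials in x = z + ωθ/z, but the new first entry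
    -- contains them only through zβ - (θ/z)χ = xc - (1+ω)θb and β - χ = (1+ω)c - xb. The η₋ parts
    -- of these combinations are given by `edgeQuot`.
    refine ⟨fun x => (P.κ * x) • liftOp (a x) + P.κ ^ 2 • (v * liftOp (a x)) +
        (omega N * P.θ) • (w * liftOp (a x)) +
        (P.κ * (omega N)⁻¹) • (v * (p * (x • liftOp (c x) -
          ((1 + omega N) * P.θ) • liftOp (b x)))) +
        P.θ • (p * ((1 + omega N) • liftOp (c x) - x • liftOp (b x))) -
        (P.θ * ((omega N)⁻¹ * (omega N)⁻¹)) • (v * (p * (p * liftOp (d x)))) +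
        P.ηm • ((P.κ * (omega N)⁻¹ * (edgeQuot P n).1) • (v * p) +
          (P.θ * (edgeQuot P n).2) • p),
      fun x => w * (u * liftOp (a x)) + liftOp (c x),
      fun x => (-P.κ) • (u * liftOp (a x)) + P.θ • liftOp (b x),
      fun x => -(w * (u * (u * liftOp (a x)))), ?_, ?_, ?_, ?_, ?_⟩
    · have h1 := (hlift ha).var_smul.smul P.κ
      have h2 := (hmul v hA).smul (P.κ ^ 2)
      have h3 := (hmul w hA).smul (omega N * P.θ)
      have h4 := (hmul v (hmul p (hxC.sub (hB.smul ((1 + omega N) * P.θ))))).smul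
        (P.κ * (omega N)⁻¹)
      have h5 := (hmul p ((hC.smul (1 + omega N)).sub hxB)).smul P.θ
      have h6 := (hmul v (hmul p (hmul p hD))).smul (P.θ * ((omega N)⁻¹ * (omega N)⁻¹))
      have h7 := PolyLT.const n.succ_pos (P.ηm • ((P.κ * (omega N)⁻¹ * (edgeQuot P n).1) • (v * p) +
          (P.θ * (edgeQuot P n).2) • p))
      convert (((((h1.add h2).add h3).add h4).add h5).sub h6).add h7 using 2 with x
      simp only [map_sub, map_smul, map_one]
      match_scalars <;> ring
    · exact (hmul w (hmul u hA)).add hC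
    · exact ((hmul u hA).smul (-P.κ)).add (hB.smul P.θ)
    · exact (hmul w (hmul u (hmul u hA))).neg
    · intro z hz
      obtain ⟨h00, h01, h10, h11⟩ := hU z hz
      obtain ⟨e00, e01, e10, e11⟩ := monodromy_succ_entries (N := N) (n := n) hP hz
      obtain ⟨s1, s2⟩ := edge_spec P hz n
      have hd : P.κ * z * (omega N)⁻¹ * (edge P z n).1 -
          P.θ * (P.κ / z) * (omega N)⁻¹ * (edge P z n).2 =
          (P.θ / z - z) * (P.κ * (omega N)⁻¹ * (edgeQuot P n).1) := by
        linear_combination (P.κ * (omega N)⁻¹) * s1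
      refine ⟨?_, ?_, ?_, ?_⟩
      · rw [e00, h00, h01, h10, h11]
        simp only [map_add, map_sub, map_smul, map_one, mul_add, mul_sub, mul_smul_comm, mul_one,
          v, w, p]
        match_scalars
        all_goals
          first
          | ring1
          | linear_combination P.ηm * hd
          | linear_combination P.ηm * P.θ * s2
          | (field_simp; ring1)
      · rw [e01, h00, h10]
        simp only [map_add, map_sub, map_smul, map_one, mul_smul_comm,
          w, u, edge]
        match_scalars <;> field_simp
      · rw [e10, h00, h01]
        simp only [map_add, map_sub, map_smul, map_one, mul_smul_comm,
          w, u, edge]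
        match_scalars <;> field_simp
      · rw [e11, h00]
        simp only [map_smul, mul_smul_comm, smul_neg, w, u]

/-- The transfer matrix is a polynomial in `z + ωθ / z`, up to explicit factors. -/
theorem transfer_poly {P : Params} (hP : P.Nondegenerate) (n : ℕ) :
    ∃ a b c : ℂ → Module.End ℂ (States N n),
      PolyLT n (fun x => a x - (P.αm * P.κ ^ n * x ^ n) • 1) ∧ PolyLT n b ∧ PolyLT n c ∧
      (∀ z : ℂ, z ≠ 0 →
        monodromy P z 0 0 = (P.θ / z - z) • a (z + omega N * P.θ / z) ∧
        monodromy P z 1 0 = (P.θ / z - z) • (z • b (z + omega N * P.θ / z) -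
          omega N • c (z + omega N * P.θ / z)) + (P.ηm * (edge P z n).2) • 1 ∧
        transfer P z = ((omega N ^ 2 * P.θ / z - z) * (P.θ / z - z)) •
          (P.αp • a (z + omega N * P.θ / z) - P.ηp • b (z + omega N * P.θ / z)) +
          (P.ηp * P.ηm * pPoly N n P z) • 1) := by
  obtain ⟨a, b, c, d, ha, hb, hc, hd, hU⟩ := monodromy_poly (N := N) hP n
  refine ⟨a, b, c, ha, hb, hc, fun z hz => ?_⟩
  obtain ⟨h00, h01, h10, h11⟩ := hU z hz
  refine ⟨h00, h10, ?_⟩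
  rw [transfer, Matrix.trace_fin_two, Matrix.mul_apply, Matrix.mul_apply, Fin.sum_univ_two,
    Fin.sum_univ_two]
  simp only [kPlus, Matrix.of_apply, Matrix.cons_val_zero, Matrix.cons_val_one,
    Matrix.cons_val', Matrix.cons_val_fin_one, h00, h01, h10, h11, smul_mul_assoc, one_mul,
    zero_mul, add_zero, ← edge_pPoly P hz n]
  -- In η₊(U₁₀ + ωU₀₁) the terms with c cancel, and those with b add up to -(ω²θ/z - z)b; this puts
  -- the same factor in front of b as K₊ puts in front of a.
  match_scalars <;> field_simp <;> ring

end structure_U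

/-! ### Products over pairs of indices -/

section products
variable {n : ℕ}

/-- The effect on a product over ordered pairs of a change that involves a single index. -/
theorem prod_pairs_update (r : Fin n) (f g : Fin n → Fin n → ℂ) (ρ σ : Fin n → ℂ)
    (h : ∀ j l, j ≠ r → l ≠ r → f j l = g j l) (h1 : ∀ l, l ≠ r → f r l = g r l * ρ l)
    (h2 : ∀ l, l ≠ r → f l r = g l r * σ l) :
    ∏ j, ∏ l ∈ Finset.univ.erase j, f j l =
      (∏ j, ∏ l ∈ Finset.univ.erase j, g j l) * ∏ l ∈ Finset.univ.erase r, (ρ l * σ l) := by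
  have e : ∀ j, ∏ l ∈ Finset.univ.erase j, f j l = (∏ l ∈ Finset.univ.erase j, g j l) *
      (if j = r then ∏ l ∈ Finset.univ.erase r, ρ l else σ j) := by
    intro j
    split_ifs with hj
    · subst hj
      rw [← Finset.prod_mul_distrib]
      exact Finset.prod_congr rfl fun l hl => h1 l (Finset.ne_of_mem_erase hl)
    · have hr : r ∈ Finset.univ.erase j := Finset.mem_erase.2 ⟨Ne.symm hj, Finset.mem_univ r⟩
      rw [← Finset.mul_prod_erase _ _ hr, ← Finset.mul_prod_erase _ _ hr, h2 j hj,
        Finset.prod_congr rfl fun l hl => h j l hj (Finset.ne_of_mem_erase hl)]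
      ring
  rw [Finset.prod_congr rfl fun j _ => e j, Finset.prod_mul_distrib, Finset.prod_mul_distrib]
  congr 1
  rw [← Finset.mul_prod_erase Finset.univ _ (Finset.mem_univ r), if_pos rfl]
  congr 1
  exact Finset.prod_congr rfl fun j hj => if_neg (Finset.ne_of_mem_erase hj)

/-- The effect on a product over unordered pairs of a change that involves a single index. -/
theorem prod_Ioi_update (r : Fin n) (f g : Fin n → Fin n → ℂ) (ρ : Fin n → ℂ)
    (h : ∀ j l, j < l → j ≠ r → l ≠ r → f j l = g j l)
    (h1 : ∀ l, r < l → f r l = g r l * ρ l) (h2 : ∀ l, l < r → f l r = g l r * ρ l) :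
    ∏ j, ∏ l ∈ Finset.Ioi j, f j l =
      (∏ j, ∏ l ∈ Finset.Ioi j, g j l) * ∏ l ∈ Finset.univ.erase r, ρ l := by
  have e : ∀ j, ∏ l ∈ Finset.Ioi j, f j l = (∏ l ∈ Finset.Ioi j, g j l) *
      (if j = r then ∏ l ∈ Finset.Ioi r, ρ l else if j < r then ρ j else 1) := by
    intro j
    split_ifs with hj hjr
    · subst hj
      rw [← Finset.prod_mul_distrib]
      exact Finset.prod_congr rfl fun l hl => h1 l (Finset.mem_Ioi.1 hl)
    · have hr : r ∈ Finset.Ioi j := Finset.mem_Ioi.2 hjr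
      rw [← Finset.mul_prod_erase _ _ hr, ← Finset.mul_prod_erase _ _ hr, h2 j hjr,
        Finset.prod_congr rfl fun l hl => h j l
          (Finset.mem_Ioi.1 (Finset.mem_of_mem_erase hl)) hj (Finset.ne_of_mem_erase hl)]
      ring
    · rw [mul_one]
      refine Finset.prod_congr rfl fun l hl => h j l (Finset.mem_Ioi.1 hl) hj ?_
      rintro rfl
      exact hjr (Finset.mem_Ioi.1 hl)
  rw [Finset.prod_congr rfl fun j _ => e j, Finset.prod_mul_distrib]
  congr 1
  rw [← Finset.mul_prod_erase Finset.univ _ (Finset.mem_univ r), if_pos rfl]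
  have e2 : ∏ l ∈ Finset.Ioi r, ρ l =
      ∏ l ∈ Finset.univ.erase r, if r < l then ρ l else 1 := by
    rw [← Finset.prod_filter]
    refine Finset.prod_congr ?_ fun _ _ => rfl
    ext l
    simp only [Finset.mem_Ioi, Finset.mem_filter, Finset.mem_erase, Finset.mem_univ, and_true]
    exact ⟨fun hl => ⟨hl.ne', hl⟩, fun hl => hl.2⟩
  rw [e2, ← Finset.prod_mul_distrib]
  refine Finset.prod_congr rfl fun l hl => ?_
  have hl' := Finset.ne_of_mem_erase hl
  rw [if_neg hl']
  rcases lt_or_gt_of_ne hl' with hlt | hlt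
  · rw [if_neg hlt.not_gt, if_pos hlt, one_mul]
  · rw [if_pos hlt, if_neg hlt.not_gt, mul_one]

/-- Lagrange interpolation in the inverse variable. -/
theorem PolyLT.lagrange_inv {V : Type*} [AddCommGroup V] [Module ℂ V] {f : ℂ → V}
    (hf : PolyLT n f) {x : Fin n → ℂ} (hx : Function.Injective x) (h0 : ∀ r, x r ≠ 0) {z : ℂ}
    (hz : z ≠ 0) :
    f (1 / z) = ∑ r, (∏ s ∈ Finset.univ.erase r, ((1 - x s * (1 / z)) / (1 - x s / x r))) •
      f (1 / x r) := by
  have h1 : PolyLT (Fintype.card (Fin n)) f := by rwa [Fintype.card_fin]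
  have hx' : Function.Injective (fun r => 1 / x r) := fun r s h =>
    hx (inv_injective (by simpa using h))
  rw [h1.lagrange hx' (1 / z)]
  refine Finset.sum_congr rfl fun r _ => ?_
  congr 1
  refine Finset.prod_congr rfl fun s hs => ?_
  have hs1 := h0 s
  have hr1 := h0 r
  have e1 : 1 / z - 1 / x s = -(1 / x s) * (1 - x s * (1 / z)) := by
    field_simp
    ring
  have e2 : 1 / x r - 1 / x s = -(1 / x s) * (1 - x s / x r) := by
    field_simp
    ring
  rw [e1, e2, mul_div_mul_left _ _ (neg_ne_zero.2 (one_div_ne_zero hs1))]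

/-- A partial fraction identity. -/
theorem partial_fraction {m : ℕ} (a : Fin m → ℂ) (ha : ∀ r, a r ≠ 0)
    (hinj : Function.Injective a) (b : Fin (m + 1) → ℂ) (hb : ∀ k, b k ≠ 0) (y : ℂ)
    (hy : y * ∏ l, -a l = ∏ k, -b k) (t : ℂ) :
    (1 + y * t) * ∏ l, (1 - a l * t) -
        ∑ r, y * (∏ k, (1 - a r / b k)) / (∏ l ∈ Finset.univ.erase r, (1 - a r / a l)) *
          (t * ∏ l ∈ Finset.univ.erase r, (1 - a l * t)) =
      ∏ k, (1 - b k * t) := by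
  rw [← sub_eq_zero]
  -- By `hy` the coefficients of t^(m+1) agree, so the difference has degree at most m. It vanishes
  -- at the m + 1 points 0 and 1/a_r, at the latter because a single summand survives.
  have hdeg : PolyLT (Fintype.card (Option (Fin m))) (fun t : ℂ =>
      (1 + y * t) * ∏ l, (1 - a l * t) -
        ∑ r, y * (∏ k, (1 - a r / b k)) / (∏ l ∈ Finset.univ.erase r, (1 - a r / a l)) *
          (t * ∏ l ∈ Finset.univ.erase r, (1 - a l * t)) - ∏ k, (1 - b k * t)) := by
    rw [Fintype.card_option, Fintype.card_fin]
    have h1 := (PolyLT.prod_sub Finset.univ (fun _ => (1 : ℂ)) (fun l : Fin m => -a l)).linear_mul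
      1 y
    have h2 := PolyLT.prod_sub Finset.univ (fun _ => (1 : ℂ)) (fun l : Fin (m + 1) => -b l)
    have h3 : PolyLT (m + 1) (fun t : ℂ => ∑ r,
        (y * (∏ k, (1 - a r / b k)) / (∏ l ∈ Finset.univ.erase r, (1 - a r / a l))) •
          (t • ∏ l ∈ Finset.univ.erase r, (1 - a l * t))) := by
      refine PolyLT.sum _ fun r _ => PolyLT.smul ?_ _
      have h4 := (PolyLT.prod (Finset.univ.erase r) (fun _ => (1 : ℂ)) (fun l => -a l)).var_smul
      rw [Finset.card_erase_of_mem (Finset.mem_univ r), Finset.card_univ, Fintype.card_fin] at h4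
      have hm : m - 1 + 1 + 1 = m + 1 := by
        have := r.pos
        omega
      rw [hm] at h4
      simpa [sub_eq_add_neg] using h4
    have h5 := PolyLT.pow_smul (m.lt_succ_self) (∏ l, -a l)
    rw [Finset.card_univ, Fintype.card_fin] at h1 h2
    convert ((h1.add h5).sub h3).sub h2 using 2 with t
    simp only [smul_eq_mul, ← hy]
    simp only [neg_mul, ← sub_eq_add_neg]
    ring
  let x : Option (Fin m) → ℂ := fun o => o.elim 0 fun r => 1 / a r
  have hx : Function.Injective x := by
    rintro (_ | r) (_ | s) hrs
    · rfl
    · simp only [x, Option.elim_none, Option.elim_some] at hrs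
      exact absurd hrs.symm (one_div_ne_zero (ha s))
    · simp only [x, Option.elim_none, Option.elim_some] at hrs
      exact absurd hrs (one_div_ne_zero (ha r))
    · simp only [x, Option.elim_some, one_div, inv_inj] at hrs
      rw [hinj hrs]
  refine PolyLT.eq_zero hdeg hx ?_ t
  rintro (_ | r)
  · simp [x]
  · simp only [x, Option.elim_some]
    have e1 : ∏ l, (1 - a l * (1 / a r)) = 0 :=
      Finset.prod_eq_zero (Finset.mem_univ r) (by rw [mul_one_div, div_self (ha r), sub_self])
    have e2 : ∀ s ∈ Finset.univ, s ≠ r →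
        y * (∏ k, (1 - a s / b k)) / (∏ l ∈ Finset.univ.erase s, (1 - a s / a l)) *
          (1 / a r * ∏ l ∈ Finset.univ.erase s, (1 - a l * (1 / a r))) = 0 := by
      intro s _ hs
      rw [Finset.prod_eq_zero (f := fun l => 1 - a l * (1 / a r))
        (Finset.mem_erase.2 ⟨Ne.symm hs, Finset.mem_univ r⟩)
        (by rw [mul_one_div, div_self (ha r), sub_self])]
      simp
    rw [e1, mul_zero, Finset.sum_eq_single r e2 (by simp)]
    have e3 : ∏ k, (1 - a r / b k) =
        a r ^ (m + 1) / (∏ k, -b k) * ∏ k, (1 - b k * (1 / a r)) := by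
      have : a r ^ (m + 1) = ∏ _k : Fin (m + 1), a r := by simp
      rw [this, ← Finset.prod_div_distrib, ← Finset.prod_mul_distrib]
      refine Finset.prod_congr rfl fun k _ => ?_
      have := hb k
      have := ha r
      field_simp
      ring
    have e4 : ∏ l ∈ Finset.univ.erase r, (1 - a l * (1 / a r)) =
        (∏ l ∈ Finset.univ.erase r, (1 - a r / a l)) *
          ((∏ l ∈ Finset.univ.erase r, -a l) / ∏ l ∈ Finset.univ.erase r, a r) := by
      rw [← Finset.prod_div_distrib, ← Finset.prod_mul_distrib]
      refine Finset.prod_congr rfl fun k _ => ?_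
      have := ha k
      have := ha r
      field_simp
      ring
    have hne : ∏ l ∈ Finset.univ.erase r, (1 - a r / a l) ≠ 0 := by
      refine Finset.prod_ne_zero_iff.2 fun l hl h0 => Finset.ne_of_mem_erase hl (hinj ?_)
      rw [sub_eq_zero, eq_div_iff (ha l), one_mul] at h0
      exact h0
    have e5 : a r * ∏ l ∈ Finset.univ.erase r, a r = a r ^ m := by
      rw [Finset.mul_prod_erase Finset.univ (fun _ => a r) (Finset.mem_univ r)]
      simp
    have hne2 : ∏ l ∈ Finset.univ.erase r, a r ≠ 0 := Finset.prod_ne_zero_iff.2 fun _ _ => ha r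
    have hne3 : ∏ k, -b k ≠ 0 := Finset.prod_ne_zero_iff.2 fun k _ => neg_ne_zero.2 (hb k)
    rw [← Finset.mul_prod_erase Finset.univ _ (Finset.mem_univ r)] at hy
    rw [e3, e4, ← hy, pow_succ, ← e5]
    rw [← hy] at hne3
    have hyne : y ≠ 0 := left_ne_zero_of_mul hne3
    have hpne := right_ne_zero_of_mul (right_ne_zero_of_mul hne3)
    have har := ha r
    field_simp
    ring

end products

/-! ### Amplitudes of the open chain -/

section amplitudes
variable {N n : ℕ} [NeZero N] {P : Params} {D : Amplitudes n}

/-- By the product relation, the product over level m is v^m. -/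
theorem Amplitudes.IsOpen.v_ne (hD : D.IsOpen N P) (hP : P.Nondegenerate) :
    ∀ {m : ℕ}, m ≤ n → ∀ r, D.v m r ≠ 0 := by
  have h : ∀ m, m ≤ n → ∏ r, D.v m r ≠ 0 := by
    intro m
    induction m with
    | zero => simp
    | succ m ih =>
      intro hm
      rw [hD.prod_v m hm]
      exact mul_ne_zero (ih (by omega)) hP.v_ne
  exact fun {m} hm r => Finset.prod_ne_zero_iff.1 (h m hm) r (Finset.mem_univ r)

/-- This y is a numerator in a recurrence whose left side equals 1. The same argument applies to
`y_same_ne`, but only below the top level, where a recurrence is available. -/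
theorem Amplitudes.IsOpen.y_next_ne (hD : D.IsOpen N P) {m : ℕ} (hm : m + 1 ≤ n) (l : Fin m)
    (k : Fin (m + 1)) : D.y m l (m + 1) k ≠ 0 := by
  cases m with
  | zero => exact l.elim0
  | succ j =>
    intro h0
    have h := hD.recurrence j hm l
    rw [Finset.prod_eq_zero (Finset.mem_univ k) h0] at h
    simp at h

theorem Amplitudes.IsOpen.y_same_ne (hD : D.IsOpen N P) {m : ℕ} (hm : m + 1 ≤ n) {l s : Fin m}
    (hls : l ≠ s) : D.y m l m s ≠ 0 := by
  cases m with
  | zero => exact l.elim0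
  | succ j =>
    intro h0
    have h := hD.recurrence j hm s
    rw [Finset.prod_eq_zero (i := l) (Finset.mem_erase.2 ⟨hls, Finset.mem_univ l⟩)
      (by rw [h0, zero_div])] at h
    simp at h

theorem Amplitudes.IsOpen.y_prev_ne (hD : D.IsOpen N P) {m : ℕ} (hm : m + 1 ≤ n) (r : Fin m)
    (s : Fin (m - 1)) : D.y (m - 1) s m r ≠ 0 := by
  cases m with
  | zero => exact r.elim0
  | succ j => exact hD.y_next_ne (by omega) s r

/-- The recurrence solved for κ. In this form it disposes of all y-coordinates produced by μ, Q and
h_{m,r} in the eigenvalue computation for A. -/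
theorem Amplitudes.IsOpen.recurrence_inv (hD : D.IsOpen N P) {m : ℕ} (hm : m + 1 ≤ n)
    (r : Fin m) :
    (∏ l ∈ Finset.univ.erase r, D.y m r m l / D.y m l m r) *
      (∏ s : Fin (m - 1), D.y (m - 1) s m r) / ∏ k, D.y m r (m + 1) k = P.κ := by
  have h1 : ∏ k, D.y m r (m + 1) k ≠ 0 :=
    Finset.prod_ne_zero_iff.2 fun k _ => hD.y_next_ne hm r k
  have h2 : ∏ s : Fin (m - 1), D.y (m - 1) s m r ≠ 0 :=
    Finset.prod_ne_zero_iff.2 fun s _ => hD.y_prev_ne hm r s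
  have h3 : ∏ l ∈ Finset.univ.erase r, D.y m r m l ≠ 0 :=
    Finset.prod_ne_zero_iff.2 fun l hl => hD.y_same_ne hm (Finset.ne_of_mem_erase hl).symm
  have h4 : ∏ l ∈ Finset.univ.erase r, D.y m l m r ≠ 0 :=
    Finset.prod_ne_zero_iff.2 fun l hl => hD.y_same_ne hm (Finset.ne_of_mem_erase hl)
  have h : P.κ * (∏ l ∈ Finset.univ.erase r, D.y m l m r / D.y m r m l) *
      ((∏ k, D.y m r (m + 1) k) / ∏ s : Fin (m - 1), D.y (m - 1) s m r) = 1 := by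
    cases m with
    | zero => exact r.elim0
    | succ j => exact hD.recurrence j hm r
  rw [Finset.prod_div_distrib] at h ⊢
  field_simp at h ⊢
  linear_combination -h

/-- `v_{m,r} ^ N ≠ v_{m,s} ^ N` on all levels. -/
theorem Amplitudes.v_pow_ne (hD : D.IsOpen N P) (hP : P.Nondegenerate)
    (hgen : ∀ r r', r ≠ r' → D.v n r ^ N ≠ D.v n r' ^ N) {m : ℕ} (hm : m ≤ n) {r s : Fin m}
    (hrs : r ≠ s) : D.v m r ^ N ≠ D.v m s ^ N := by
  -- Below the top level, equal N-th powers would give y_{m,r;m,s} = 0 on the Fermat curve, against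
  -- the recurrence. At the top level this is the assumption of general position.
  rcases hm.lt_or_eq with hlt | rfl
  · intro h
    have hf := hD.fermat m hm m hm r s
    rw [Amplitudes.x, div_pow, h, div_self (pow_ne_zero _ (hD.v_ne hP hm s)), add_eq_left] at hf
    exact hD.y_same_ne hlt hrs ((pow_eq_zero_iff (NeZero.ne N)).1 hf)
  · exact hgen r s hrs

/-- Raising the label in position `r`. -/
def incr {m : ℕ} (γ : Fin m → ZMod N) (r : Fin m) : Fin m → ZMod N := γ + Pi.single r 1

/-- Lowering the label in position `r`. -/
def decr {m : ℕ} (γ : Fin m → ZMod N) (r : Fin m) : Fin m → ZMod N := γ - Pi.single r 1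

theorem incr_same {m : ℕ} (γ : Fin m → ZMod N) (r : Fin m) : incr γ r r = γ r + 1 := by
  simp [incr]

theorem incr_of_ne {m : ℕ} (γ : Fin m → ZMod N) {r s : Fin m} (h : s ≠ r) :
    incr γ r s = γ s := by
  simp [incr, h]

theorem decr_same {m : ℕ} (γ : Fin m → ZMod N) (r : Fin m) : decr γ r r = γ r - 1 := by
  simp [decr]

theorem decr_of_ne {m : ℕ} (γ : Fin m → ZMod N) {r s : Fin m} (h : s ≠ r) :
    decr γ r s = γ s := by
  simp [decr, h]

theorem incr_decr {m : ℕ} (γ : Fin m → ZMod N) (r : Fin m) : incr (decr γ r) r = γ := by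
  simp [incr, decr]

theorem decr_incr {m : ℕ} (γ : Fin m → ZMod N) (r : Fin m) : decr (incr γ r) r = γ := by
  simp [incr, decr]

theorem sum_comp_incr {m : ℕ} {V : Type*} [AddCommMonoid V] (f : (Fin m → ZMod N) → V)
    (r : Fin m) : ∑ γ, f (incr γ r) = ∑ γ, f γ :=
  Equiv.sum_comp (Equiv.addRight (Pi.single r 1 : Fin m → ZMod N)) f

theorem sum_comp_decr {m : ℕ} {V : Type*} [AddCommMonoid V] (f : (Fin m → ZMod N) → V)
    (r : Fin m) : ∑ γ, f (decr γ r) = ∑ γ, f γ :=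
  Equiv.sum_comp (Equiv.subRight (Pi.single r 1 : Fin m → ZMod N)) f

/-- The zeros `-κ v_{m,r} ω^{γ_r}` of the eigenvalue of the first entry of the open monodromy
matrix. -/
def node (P : Params) (D : Amplitudes n) (m : ℕ) (γ : Fin m → ZMod N) (r : Fin m) : ℂ :=
  -P.κ * D.v m r * omegaPow (γ r)

theorem node_ne_zero (hD : D.IsOpen N P) (hP : P.Nondegenerate) {m : ℕ} (hm : m ≤ n)
    (γ : Fin m → ZMod N) (r : Fin m) : node P D m γ r ≠ 0 :=
  mul_ne_zero (mul_ne_zero (neg_ne_zero.2 hP.κ_ne) (hD.v_ne hP hm r)) (omegaPow_ne_zero _)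

theorem node_pow (γ : Fin m → ZMod N) (r : Fin m) :
    node P D m γ r ^ N = (-P.κ) ^ N * D.v m r ^ N := by
  rw [node, mul_pow, mul_pow, omegaPow_pow_self, mul_one]

theorem node_injective (hD : D.IsOpen N P) (hP : P.Nondegenerate)
    (hgen : ∀ r r', r ≠ r' → D.v n r ^ N ≠ D.v n r' ^ N) {m : ℕ} (hm : m ≤ n)
    (γ : Fin m → ZMod N) : Function.Injective (node P D m γ) := by
  intro r s h
  by_contra hrs
  refine Amplitudes.v_pow_ne hD hP hgen hm hrs ?_
  have h2 := congrArg (· ^ N) h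
  simp only [node_pow] at h2
  exact mul_left_cancel₀ (pow_ne_zero _ (neg_ne_zero.2 hP.κ_ne)) h2

theorem node_incr_same (P : Params) (D : Amplitudes n) (m : ℕ) (γ : Fin m → ZMod N)
    (r : Fin m) : node P D m (incr γ r) r = omega N * node P D m γ r := by
  simp only [node, incr_same, omegaPow_add_one]
  ring

theorem node_incr_of_ne (P : Params) (D : Amplitudes n) (m : ℕ) (γ : Fin m → ZMod N)
    {r s : Fin m} (h : s ≠ r) : node P D m (incr γ r) s = node P D m γ s := by
  simp only [node, incr_of_ne γ h]

/-- Ratios of nodes. -/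
theorem node_div_node (hP : P.Nondegenerate) (D : Amplitudes n) {m m' : ℕ}
    (γ : Fin m → ZMod N) (γ' : Fin m' → ZMod N) (r : Fin m) (k : Fin m') :
    D.x m r m' k * omegaPow (γ r - γ' k) = node P D m γ r / node P D m' γ' k := by
  have := hP.κ_ne
  rw [Amplitudes.x, omegaPow_sub, node, node, mul_div_mul_comm, mul_div_mul_left _ _ (neg_ne_zero.2 this)]

/-! ### The eigenvectors of the open chain -/

/-- The coefficients `h_{m,r}`; `hCoeff P D n` is `D.h P`. -/
def hCoeff (P : Params) (D : Amplitudes n) (m : ℕ) (r : Fin m) : ℂ :=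
  P.u * ∏ l : Fin (m - 1), D.y (m - 1) l m r

theorem openVec_succ (D : Amplitudes n) (m : ℕ) (γ' : Fin (m + 1) → ZMod N) :
    openVec D (m + 1) γ' = ∑ γ : Fin m → ZMod N,
      (mu D m γ * openQ D m γ γ') • tens (openVec D m γ) (∑ k, γ' k - ∑ l, γ l) := by
  funext τ
  simp only [openVec, Finset.sum_apply, Pi.smul_apply, smul_eq_mul, tens]

theorem sum_decr {m : ℕ} (γ : Fin m → ZMod N) (r : Fin m) :
    ∑ k, (decr γ r) k = ∑ k, γ k - 1 := by
  simp [decr, Finset.sum_sub_distrib]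

theorem sum_incr {m : ℕ} (γ : Fin m → ZMod N) (r : Fin m) :
    ∑ k, (incr γ r) k = ∑ k, γ k + 1 := by
  simp [incr, Finset.sum_add_distrib]

/-- Only the m factors with k = r depend on the lowered label, and their arguments grow by one; the
recursion of w_p turns each change into a ratio of nodes. -/
theorem openQ_decr (hD : D.IsOpen N P) (hP : P.Nondegenerate) {m : ℕ} (hm : m + 1 ≤ n)
    (γ : Fin m → ZMod N) (γ' : Fin (m + 1) → ZMod N) (r : Fin (m + 1)) :
    openQ D m γ (decr γ' r) = openQ D m γ γ' *
      ((∏ l, (1 - node P D m γ l / node P D (m + 1) γ' r)) / ∏ l, D.y m l (m + 1) r) := by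
  rw [openQ, openQ, ← Finset.mul_prod_erase Finset.univ _ (Finset.mem_univ r),
    ← Finset.mul_prod_erase Finset.univ (fun k => ∏ l, cyc (D.x m l (m + 1) k)
      (D.y m l (m + 1) k) (γ l - γ' k - 1)) (Finset.mem_univ r)]
  have e1 : ∏ k ∈ Finset.univ.erase r, ∏ l, cyc (D.x m l (m + 1) k) (D.y m l (m + 1) k)
        (γ l - (decr γ' r) k - 1) =
      ∏ k ∈ Finset.univ.erase r, ∏ l, cyc (D.x m l (m + 1) k) (D.y m l (m + 1) k)
        (γ l - γ' k - 1) :=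
    Finset.prod_congr rfl fun k hk => by
      rw [decr_of_ne γ' (Finset.ne_of_mem_erase hk)]
  have e2 : ∏ l, cyc (D.x m l (m + 1) r) (D.y m l (m + 1) r)
        (γ l - (decr γ' r) r - 1) =
      (∏ l, cyc (D.x m l (m + 1) r) (D.y m l (m + 1) r) (γ l - γ' r - 1)) *
        ((∏ l, D.y m l (m + 1) r) / ∏ l, (1 - node P D m γ l / node P D (m + 1) γ' r)) := by
    rw [← Finset.prod_div_distrib, ← Finset.prod_mul_distrib]
    refine Finset.prod_congr rfl fun l _ => ?_
    have e : γ l - (decr γ' r) r - 1 = γ l - γ' r := by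
      rw [decr_same]; ring
    rw [e, cyc_eq_sub_one (hD.fermat m (by omega) (m + 1) hm l r) (hD.y_next_ne hm l r),
      node_div_node hP]
  rw [e1, e2]
  simp only [div_eq_mul_inv, mul_inv, inv_inv]
  ring

theorem openQ_incr (hD : D.IsOpen N P) (hP : P.Nondegenerate) {m : ℕ} (hm : m + 1 ≤ n)
    (γ : Fin m → ZMod N) (γ' : Fin (m + 1) → ZMod N) (r : Fin m) :
    openQ D m (incr γ r) γ' = openQ D m γ γ' *
      (omega N * ((∏ k, (1 - node P D m γ r / node P D (m + 1) γ' k)) /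
        ∏ k, D.y m r (m + 1) k)) := by
  have e1 : ∀ k, ∏ l, cyc (D.x m l (m + 1) k) (D.y m l (m + 1) k)
        ((incr γ r) l - γ' k - 1) =
      (∏ l, cyc (D.x m l (m + 1) k) (D.y m l (m + 1) k) (γ l - γ' k - 1)) *
        (D.y m r (m + 1) k / (1 - node P D m γ r / node P D (m + 1) γ' k)) := by
    intro k
    rw [← Finset.mul_prod_erase Finset.univ _ (Finset.mem_univ r),
      ← Finset.mul_prod_erase Finset.univ (fun l => cyc (D.x m l (m + 1) k)
        (D.y m l (m + 1) k) (γ l - γ' k - 1)) (Finset.mem_univ r)]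
    have e : (incr γ r) r - γ' k - 1 = γ r - γ' k := by
      rw [incr_same]; ring
    rw [e, cyc_eq_sub_one (hD.fermat m (by omega) (m + 1) hm r k) (hD.y_next_ne hm r k),
      node_div_node hP]
    have e2 : ∏ l ∈ Finset.univ.erase r, cyc (D.x m l (m + 1) k) (D.y m l (m + 1) k)
        ((incr γ r) l - γ' k - 1) = ∏ l ∈ Finset.univ.erase r,
          cyc (D.x m l (m + 1) k) (D.y m l (m + 1) k) (γ l - γ' k - 1) :=
      Finset.prod_congr rfl fun l hl => by
        rw [incr_of_ne γ (Finset.ne_of_mem_erase hl)]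
    rw [e2]
    ring
  rw [openQ, openQ, Finset.prod_congr rfl fun k _ => e1 k, Finset.prod_mul_distrib,
    Finset.prod_div_distrib, sum_incr, omegaPow_add_one]
  simp only [div_eq_mul_inv, mul_inv, inv_inv]
  ring

/-- For each l ≠ r two factors change, with arguments moving in opposite directions. The second one
starts from an argument already lowered by one, whence ω times the node in its denominator. -/
theorem mu_incr (hD : D.IsOpen N P) (hP : P.Nondegenerate) {m : ℕ} (hm : m + 1 ≤ n)
    (γ : Fin m → ZMod N) (r : Fin m) :
    mu D m (incr γ r) = mu D m γ * ∏ l ∈ Finset.univ.erase r,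
      (D.y m r m l / (1 - node P D m γ r / node P D m γ l) *
        ((1 - node P D m γ l / (omega N * node P D m γ r)) / D.y m l m r)) := by
  have hf := fun r s => hD.fermat m (by omega) m (by omega) r s
  refine prod_pairs_update r _ _ _ _ ?_ ?_ ?_
  · intro j l hj hl
    rw [incr_of_ne γ hj, incr_of_ne γ hl]
  · intro l hl
    have e : (incr γ r) r - (incr γ r) l - 1 = γ r - γ l := by
      rw [incr_of_ne γ hl, incr_same]; ring
    rw [e, cyc_eq_sub_one (hf r l) (hD.y_same_ne hm (Ne.symm hl)), node_div_node hP]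
  · intro l hl
    have e : (incr γ r) l - (incr γ r) r - 1 = γ l - γ r - 1 - 1 := by
      rw [incr_of_ne γ hl, incr_same]; ring
    have e2 : γ l - γ r - 1 = γ l - (incr γ r) r := by
      rw [incr_same]; ring
    rw [e, cyc_sub_one (hf l r) (hD.y_same_ne hm hl)]
    congr 3
    rw [e2, node_div_node hP, node_incr_same]

/-- The product of the nodes, through the defining relation of the `v_{m,r}`. -/
theorem prod_node_succ (hD : D.IsOpen N P) {m : ℕ} (hm : m + 1 ≤ n)
    (γ : Fin m → ZMod N) (γ' : Fin (m + 1) → ZMod N) :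
    P.κ * (P.v * omegaPow (∑ k, γ' k - ∑ l, γ l)) * ∏ l, -node P D m γ l =
      ∏ k, -node P D (m + 1) γ' k := by
  have e : ∀ (j : ℕ) (δ : Fin j → ZMod N), ∏ l, -node P D j δ l =
      P.κ ^ j * (∏ l, D.v j l) * omegaPow (∑ l, δ l) := by
    intro j δ
    simp only [node, neg_mul, neg_neg]
    rw [Finset.prod_mul_distrib, Finset.prod_mul_distrib, omegaPow_sum]
    simp
  rw [e, e, hD.prod_v m hm, omegaPow_sub, pow_succ]
  have := omegaPow_ne_zero (∑ l, γ l)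
  field_simp

/-- The action of the first row of the open monodromy matrix on the vectors `|γ_m⟩`. -/
theorem openMon_openVec (hD : D.IsOpen N P) (hP : P.Nondegenerate)
    (hgen : ∀ r r', r ≠ r' → D.v n r ^ N ≠ D.v n r' ^ N) (m : ℕ) (hm : m ≤ n) {z : ℂ}
    (hz : z ≠ 0) :
    (∀ γ : Fin m → ZMod N, openMon P m z 0 0 (openVec D m γ) =
      (∏ r, (1 - node P D m γ r * (1 / z))) • openVec D m γ) ∧
    (∀ γ : Fin m → ZMod N, openMon P m z 0 1 (openVec D m γ) =
      ∑ r, (-(hCoeff P D m r * (1 / z)) * ∏ s ∈ Finset.univ.erase r,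
        ((1 - node P D m γ s * (1 / z)) / (1 - node P D m γ s / node P D m γ r))) •
          openVec D m (decr γ r)) := by
  induction m with
  | zero => simp [openMon_zero]
  | succ m ih =>
    obtain ⟨ihA, ihB⟩ := ih (by omega)
    have hinj := fun γ : Fin (m + 1) → ZMod N => node_injective hD hP hgen hm γ
    have hinj' := fun γ : Fin m → ZMod N =>
      node_injective hD hP hgen (show m ≤ n by omega) γ
    have hn0 := fun γ : Fin (m + 1) → ZMod N => node_ne_zero hD hP hm γ
    have hn0' := fun γ : Fin m → ZMod N => node_ne_zero hD hP (show m ≤ n by omega) γ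
    constructor
    · intro γ'
      have hu := hP.u_ne
      have hω := omega_ne_zero N
      let F : (Fin m → ZMod N) → Fin m → ℂ := fun γ r =>
        P.v * omegaPow (∑ k, γ' k - ∑ l, γ l) * P.u⁻¹ *
          (-(hCoeff P D m r * (1 / z)) * ∏ s ∈ Finset.univ.erase r,
            ((1 - node P D m γ s * (1 / z)) / (1 - node P D m γ s / node P D m γ r)))
      -- The second entry lowers a label of γ while u⁻¹ raises the last spin, so the result is again
      -- a combination of the vectors occurring in |γ'⟩. The coefficient F comes from u⁻¹vB.
      have step : ∀ γ : Fin m → ZMod N,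
          openMon P (m + 1) z 0 0 (tens (openVec D m γ) (∑ k, γ' k - ∑ l, γ l)) =
            ((1 + P.κ / z * (P.v * omegaPow (∑ k, γ' k - ∑ l, γ l))) *
              ∏ r, (1 - node P D m γ r * (1 / z))) •
                tens (openVec D m γ) (∑ k, γ' k - ∑ l, γ l) +
            ∑ r, F γ r • tens (openVec D m (decr γ r)) (∑ k, γ' k - ∑ l, decr γ r l) := by
        intro γ
        rw [openMon_succ_00, LinearMap.add_apply, Module.End.mul_apply, Module.End.mul_apply,
          Module.End.mul_apply, liftOp_tens, liftOp_tens, ihA, ihB, tens_smul, tens_sum,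
          map_sum, map_sum, LinearMap.add_apply, LinearMap.smul_apply, map_smul, map_smul,
          Module.End.one_apply, vOp_tens]
        congr 1
        · module
        · refine Finset.sum_congr rfl fun r _ => ?_
          rw [tens_smul, map_smul, map_smul, vOp_tens, map_smul, uInv_tens, sum_decr, smul_smul,
            smul_smul, sub_sub_eq_add_sub, add_sub_right_comm]
          congr 1
          simp only [F]
          ring
      rw [openVec_succ, map_sum]
      simp only [map_smul, step, smul_add, Finset.sum_add_distrib, Finset.smul_sum, smul_smul]
      rw [Finset.sum_comm (s := Finset.univ) (t := Finset.univ) (f := fun γ r =>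
        (mu D m γ * openQ D m γ γ' * F γ r) • tens (openVec D m (decr γ r))
          (∑ k, γ' k - ∑ l, decr γ r l))]
      -- Relabelling the sum collects all contributions to the same |γ⟩; the eigenvector property
      -- becomes a scalar identity for each γ.
      have hshift : ∀ r, ∑ γ, (mu D m γ * openQ D m γ γ' * F γ r) • tens (openVec D m (decr γ r))
          (∑ k, γ' k - ∑ l, decr γ r l) = ∑ γ, (mu D m (incr γ r) * openQ D m (incr γ r) γ' *
            F (incr γ r) r) • tens (openVec D m γ) (∑ k, γ' k - ∑ l, γ l) := by
        intro r
        rw [← sum_comp_incr _ r]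
        simp only [decr_incr]
      simp only [hshift]
      rw [Finset.sum_comm, ← Finset.sum_add_distrib]
      refine Finset.sum_congr rfl fun γ _ => ?_
      rw [← Finset.sum_smul, ← add_smul]
      congr 1
      -- The scalar identity: a are the nodes of level m, b those of level m + 1, and y is κ times
      -- the eigenvalue of v at the last site. The condition on the leading coefficients is the
      -- product relation between the two levels.
      have hpf := partial_fraction (node P D m γ) (hn0' γ) (hinj' γ) (node P D (m + 1) γ')
        (hn0 γ') _ (prod_node_succ hD hm γ γ') (1 / z)
      rw [← hpf, sub_mul, Finset.sum_mul]
      refine Eq.trans ?_ (sub_eq_add_neg _ _).symm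
      rw [← Finset.sum_neg_distrib]
      congr 1
      · ring
      refine Finset.sum_congr rfl fun r _ => ?_
      have hrec := hD.recurrence_inv hm r
      have e1 : F (incr γ r) r = P.v * (omegaPow (∑ k, γ' k - ∑ l, γ l) / omega N) * P.u⁻¹ *
          (-(hCoeff P D m r * (1 / z)) *
            ((∏ s ∈ Finset.univ.erase r, (1 - node P D m γ s * (1 / z))) /
              ∏ s ∈ Finset.univ.erase r, (1 - node P D m γ s / (omega N * node P D m γ r)))) := by
        simp only [F]
        rw [sum_incr, ← sub_sub, omegaPow_sub_one, Finset.prod_div_distrib]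
        congr 3
        · exact Finset.prod_congr rfl fun s hs => by
            rw [node_incr_of_ne P D m γ (Finset.ne_of_mem_erase hs)]
        · exact Finset.prod_congr rfl fun s hs => by
            rw [node_incr_of_ne P D m γ (Finset.ne_of_mem_erase hs), node_incr_same]
      have hne : ∏ s ∈ Finset.univ.erase r, (1 - node P D m γ s / (omega N * node P D m γ r)) ≠
          0 := by
        refine Finset.prod_ne_zero_iff.2 fun s hs h0 => ?_
        have hs' := Finset.ne_of_mem_erase hs
        have hi := (hinj' (incr γ r)).ne hs'
        rw [node_incr_of_ne P D m γ hs', node_incr_same] at hi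
        rw [sub_eq_zero, eq_div_iff (mul_ne_zero hω (hn0' γ r)), one_mul] at h0
        exact hi h0.symm
      rw [e1, mu_incr hD hP hm, openQ_incr hD hP hm, ← hrec, hCoeff]
      simp only [Finset.prod_mul_distrib, Finset.prod_div_distrib]
      have h1 : ∏ k, D.y m r (m + 1) k ≠ 0 :=
        Finset.prod_ne_zero_iff.2 fun k _ => hD.y_next_ne hm r k
      have h4 : ∏ l ∈ Finset.univ.erase r, D.y m l m r ≠ 0 :=
        Finset.prod_ne_zero_iff.2 fun l hl => hD.y_same_ne hm (Finset.ne_of_mem_erase hl)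
      have h5 : ∏ l ∈ Finset.univ.erase r, (1 - node P D m γ r / node P D m γ l) ≠ 0 := by
        refine Finset.prod_ne_zero_iff.2 fun s hs h0 => ?_
        rw [sub_eq_zero, eq_div_iff (hn0' γ s), one_mul] at h0
        exact Finset.ne_of_mem_erase hs (hinj' γ h0)
      generalize ∏ s ∈ Finset.univ.erase r, (1 - node P D m γ s / (omega N * node P D m γ r)) =
        X1 at *
      generalize ∏ l ∈ Finset.univ.erase r, (1 - node P D m γ r / node P D m γ l) = X2 at *
      generalize ∏ s ∈ Finset.univ.erase r, (1 - node P D m γ s * (1 / z)) = X3 at *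
      generalize ∏ k, (1 - node P D m γ r / node P D (m + 1) γ' k) = X4 at *
      field_simp
    · intro γ'
      -- The eigenvalue of A on level m has degree m in 1/z, so it can be interpolated at the m + 1
      -- nodes of γ'. The value at the node r is, up to the y-coordinates, the ratio in
      -- `openQ_decr`, which yields |γ' - e_r⟩.
      have hz' : ∀ γ : Fin m → ZMod N, ∏ l, (1 - node P D m γ l * (1 / z)) =
          ∑ r, (∏ s ∈ Finset.univ.erase r, ((1 - node P D (m + 1) γ' s * (1 / z)) /
            (1 - node P D (m + 1) γ' s / node P D (m + 1) γ' r))) *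
              ∏ l, (1 - node P D m γ l / node P D (m + 1) γ' r) := by
        intro γ
        have h1 := PolyLT.prod Finset.univ (fun _ => (1 : ℂ)) (fun l => -node P D m γ l)
        rw [Finset.card_univ, Fintype.card_fin] at h1
        have h3 := h1.lagrange_inv (hinj γ') (hn0 γ') hz
        simp only [neg_mul, ← sub_eq_add_neg] at h3
        rw [h3]
        refine Finset.sum_congr rfl fun r _ => ?_
        rw [smul_eq_mul]
        congr 1
        exact Finset.prod_congr rfl fun l _ => by rw [mul_one_div]
      have step : ∀ γ : Fin m → ZMod N,
          openMon P (m + 1) z 0 1 (tens (openVec D m γ) (∑ k, γ' k - ∑ l, γ l)) =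
            (-(1 / z) * (P.u * ∏ l, (1 - node P D m γ l * (1 / z)))) •
              tens (openVec D m γ) (∑ k, γ' k - 1 - ∑ l, γ l) := by
        intro γ
        rw [openMon_succ_01, LinearMap.neg_apply, LinearMap.smul_apply, Module.End.mul_apply,
          liftOp_tens, ihA, tens_smul, map_smul, uOp_tens, sub_right_comm]
        module
      rw [openVec_succ, map_sum]
      simp only [map_smul, step, openVec_succ, sum_decr, Finset.smul_sum, smul_smul]
      rw [Finset.sum_comm]
      refine Finset.sum_congr rfl fun γ _ => ?_
      rw [← Finset.sum_smul]
      congr 1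
      rw [hz' γ]
      simp only [Finset.mul_sum]
      refine Finset.sum_congr rfl fun r _ => ?_
      have hy : ∏ l, D.y m l (m + 1) r ≠ 0 :=
        Finset.prod_ne_zero_iff.2 fun l _ => hD.y_next_ne hm l r
      have e : hCoeff P D (m + 1) r = P.u * ∏ l, D.y m l (m + 1) r := rfl
      rw [openQ_decr hD hP hm, e]
      field_simp

end amplitudes

/-! ### The action of the monodromy matrices on the eigenvectors of the open chain -/

section action
variable {N n : ℕ} [NeZero N] {P : Params} {D : Amplitudes n}

/-- The variable `z + ωθ / z`. -/
def symVar (N : ℕ) (P : Params) (z : ℂ) : ℂ := z + omega N * P.θ / z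

theorem symVar_inv (hP : P.Nondegenerate) {z : ℂ} (hz : z ≠ 0) :
    symVar N P (omega N * P.θ / z) = symVar N P z := by
  have := omega_ne_zero N
  have := hP.θ_ne
  rw [symVar, symVar]
  field_simp
  ring

theorem symVar_sub {z w : ℂ} (hz : z ≠ 0) (hw : w ≠ 0) :
    symVar N P z - symVar N P w =
      (z - w) * (1 - omega N * P.θ / (z * w)) := by
  rw [symVar, symVar]
  field_simp
  ring

/-- The reflection z ↦ ωθ/z exchanges the two factors of a node, so a product of eigenvalues of A at
z and ωθ/z depends on z only through Λ. -/
theorem mul_symVar_sub (hP : P.Nondegenerate) {z w : ℂ} (hz : z ≠ 0) (hw : w ≠ 0) :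
    omega N * P.θ * ((1 - w * (1 / z)) * (1 - w * (1 / (omega N * P.θ / z)))) =
      -w * (symVar N P z - symVar N P w) := by
  have := omega_ne_zero N
  have := hP.θ_ne
  rw [symVar, symVar]
  field_simp
  ring

/-- All basis states in |γ_m⟩ have total spin ∑γ_m, so the product of the v_k⁻¹ is a scalar on it;
`prod_node_succ` expresses this scalar through the nodes. -/
theorem vInvProd_openVec (hD : D.IsOpen N P) (hP : P.Nondegenerate) (m : ℕ) (hm : m ≤ n)
    (γ : Fin m → ZMod N) :
    vInvProd P m (openVec D m γ) =
      (∏ r, (omega N * P.θ * P.κ / -node P D m γ r)) • openVec D m γ := by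
  induction m with
  | zero => simp [vInvProd]
  | succ m ih =>
    rw [openVec_succ, map_sum, Finset.smul_sum]
    refine Finset.sum_congr rfl fun δ _ => ?_
    rw [vInvProd, map_smul, LinearMap.smul_apply, Module.End.mul_apply, liftOp_tens,
      ih (by omega), tens_smul, map_smul, vInv_tens]
    simp only [smul_smul]
    congr 1
    rw [Finset.prod_div_distrib, Finset.prod_div_distrib, ← prod_node_succ hD hm δ γ]
    have h1 := hP.κ_ne
    have h2 := hP.v_ne
    have h3 := omegaPow_ne_zero (∑ k, γ k - ∑ l, δ l)
    have h4 : ∏ l, -node P D m δ l ≠ 0 :=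
      Finset.prod_ne_zero_iff.2 fun l _ => neg_ne_zero.2 (node_ne_zero hD hP (by omega) δ l)
    simp only [Finset.prod_const, Finset.card_univ, Fintype.card_fin, pow_succ]
    field_simp

/-- Only the degree of C matters later: being below n, it allows C to be interpolated from its
values at n nodes. -/
theorem openMon_poly (P : Params) (n : ℕ) :
    ∃ c d : ℂ → Module.End ℂ (States N n), PolyLT n c ∧ PolyLT (n + 1) d ∧
      ∀ z : ℂ, openMon P n z 1 0 = c (1 / z) ∧ openMon P n z 1 1 = d (1 / z) := by
  induction n with
  | zero =>
    refine ⟨0, fun _ => 1, PolyLT.zero 0, PolyLT.const one_pos 1, fun z => ?_⟩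
    simp [openMon_zero]
  | succ n ih =>
    obtain ⟨c, d, hc, hd, h⟩ := ih
    have hlift : ∀ {f : ℂ → Module.End ℂ (States N n)} {m : ℕ}, PolyLT m f →
        PolyLT m (fun x => (liftOp (f x) : Module.End ℂ (States N (n + 1)))) :=
      fun hf => hf.map liftOp.toLinearMap
    have hmul : ∀ {f : ℂ → Module.End ℂ (States N (n + 1))} {m : ℕ}
        (O : Module.End ℂ (States N (n + 1))), PolyLT m f → PolyLT m (fun x => O * f x) :=
      fun O hf => hf.map (LinearMap.mulLeft ℂ O)
    refine ⟨fun t => (liftOp (c t) + t • ((P.κ • vOp P (Fin.last n)) * liftOp (c t))) +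
        uInv P (Fin.last n) * vOp P (Fin.last n) * liftOp (d t),
      fun t => -(t • (uOp P (Fin.last n) * liftOp (c t))), ?_, ?_, fun z => ?_⟩
    · exact (((hlift hc).mono n.le_succ).add (hmul _ (hlift hc)).var_smul).add
        (hmul _ (hlift hd))
    · exact ((hmul _ (hlift hc)).var_smul.mono (n + 1).le_succ).neg
    · rw [openMon_succ_10, openMon_succ_11, (h z).1, (h z).2]
      refine ⟨?_, rfl⟩
      have e : P.κ / z = 1 / z * P.κ := by ring
      simp only [add_mul, one_mul, smul_mul_assoc, smul_smul, e]

/-- `C(λ_r) |γ⟩` is a multiple of `|γ + e_r⟩`, with this factor. -/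
def raiseCoeff (P : Params) (D : Amplitudes n) (γ : Fin n → ZMod N) (r : Fin n) : ℂ :=
  (P.θ / node P D n γ r) ^ n * (omega N * node P D n γ r) /
    (hCoeff P D n r * ∏ s, (omega N * P.θ * P.κ / -node P D n γ s))

theorem hCoeff_ne_zero (hD : D.IsOpen N P) (hP : P.Nondegenerate) (r : Fin n) :
    hCoeff P D n r ≠ 0 := by
  refine mul_ne_zero hP.u_ne (Finset.prod_ne_zero_iff.2 fun l _ => ?_)
  cases n with
  | zero => exact r.elim0
  | succ j => exact hD.y_next_ne le_rfl l r

/-- Let ν be the r-th node of γ and z = θ/ν. Crossing turns the lower left component of the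
inversion formula into D(ν)V A(ων) - C(ν)V B(ων) = zⁿ, where V is `vInvProd`. On |γ + e_r⟩, whose
r-th node is ων, A(ων) vanishes and B(ων) produces only |γ⟩, which determines C(ν)|γ⟩. -/
theorem openMon_10_node (hD : D.IsOpen N P) (hP : P.Nondegenerate)
    (hgen : ∀ r r', r ≠ r' → D.v n r ^ N ≠ D.v n r' ^ N) (γ : Fin n → ZMod N) (r : Fin n) :
    openMon P n (node P D n γ r) 1 0 (openVec D n γ) =
      raiseCoeff P D γ r • openVec D n (incr γ r) := by
  have hθ := hP.θ_ne
  have hω := omega_ne_zero N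
  have hn0 := node_ne_zero hD hP le_rfl γ
  have hn1 := node_ne_zero hD hP le_rfl (incr γ r)
  have hinj := node_injective hD hP hgen le_rfl (incr γ r)
  have hz : P.θ / node P D n γ r ≠ 0 := div_ne_zero hθ (hn0 r)
  have e1 : P.θ / (P.θ / node P D n γ r) = node P D n γ r := div_div_cancel₀ hθ
  have e2 : omega N * P.θ / (P.θ / node P D n γ r) = node P D n (incr γ r) r := by
    rw [node_incr_same, mul_div_assoc, e1]
  have h := congrFun (congrFun (openMon_mul_openMonTilde (N := N) hP n hz) 1) 0
  obtain ⟨h00, -, h10, -⟩ := crossing (N := N) hP n hz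
  simp only [Matrix.mul_apply, Fin.sum_univ_two, Matrix.smul_apply, Matrix.of_apply,
    Matrix.cons_val_zero, Matrix.cons_val_one, Matrix.cons_val', Matrix.cons_val_fin_one,
    mul_zero, mul_one, zero_add, add_zero, e1, h00, h10, e2] at h
  have h2 := congrArg (fun O : Module.End ℂ (States N n) => O (openVec D n (incr γ r))) h
  obtain ⟨hA, hB⟩ := openMon_openVec hD hP hgen n le_rfl (hn1 r)
  have hzero : 1 - node P D n (incr γ r) r * (1 / node P D n (incr γ r) r) = 0 := by
    rw [mul_one_div, div_self (hn1 r), sub_self]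
  simp only [LinearMap.add_apply, Module.End.mul_apply, LinearMap.neg_apply,
    LinearMap.smul_apply, Module.End.one_apply] at h2
  rw [hA, hB, Finset.prod_eq_zero (Finset.mem_univ r) hzero, zero_smul, map_zero, map_zero,
    zero_add, Finset.sum_eq_single r] at h2
  · rw [decr_incr, map_smul, vInvProd_openVec hD hP n le_rfl, smul_smul, ← neg_smul, map_smul]
      at h2
    have h3 : ∏ s ∈ Finset.univ.erase r,
        ((1 - node P D n (incr γ r) s * (1 / node P D n (incr γ r) r)) /
          (1 - node P D n (incr γ r) s / node P D n (incr γ r) r)) = 1 := by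
      refine Finset.prod_eq_one fun s hs => ?_
      rw [mul_one_div, div_self]
      intro h0
      rw [sub_eq_zero, eq_div_iff (hn1 r), one_mul] at h0
      exact Finset.ne_of_mem_erase hs (hinj h0.symm)
    rw [h3] at h2
    have hh := hCoeff_ne_zero hD hP r
    have hV : ∏ s, (omega N * P.θ * P.κ / -node P D n γ s) ≠ 0 :=
      Finset.prod_ne_zero_iff.2 fun s _ =>
        div_ne_zero (mul_ne_zero (mul_ne_zero hω hθ) hP.κ_ne) (neg_ne_zero.2 (hn0 s))
    rw [node_incr_same] at h2
    have hr := hn0 r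
    have h4 := congrArg (fun ψ : States N n => ((omega N * node P D n γ r) /
      (hCoeff P D n r * ∏ s, (omega N * P.θ * P.κ / -node P D n γ s))) • ψ) h2
    simp only [smul_smul] at h4
    rw [raiseCoeff]
    convert h4 using 1
    · conv_lhs => rw [← one_smul ℂ (openMon P n (node P D n γ r) 1 0 (openVec D n γ))]
      congr 1
      generalize ∏ s, (omega N * P.θ * P.κ / -node P D n γ s) = Y at hV ⊢
      field_simp
    · congr 1
      ring
  · intro s _ hs
    rw [Finset.prod_eq_zero (i := r) (Finset.mem_erase.2 ⟨Ne.symm hs, Finset.mem_univ r⟩)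
      (by rw [hzero, zero_div]), mul_zero, zero_smul]
  · simp

theorem openMon_10_openVec (hD : D.IsOpen N P) (hP : P.Nondegenerate)
    (hgen : ∀ r r', r ≠ r' → D.v n r ^ N ≠ D.v n r' ^ N) (γ : Fin n → ZMod N) {z : ℂ}
    (hz : z ≠ 0) :
    openMon P n z 1 0 (openVec D n γ) =
      ∑ r, ((∏ s ∈ Finset.univ.erase r, ((1 - node P D n γ s * (1 / z)) /
        (1 - node P D n γ s / node P D n γ r))) * raiseCoeff P D γ r) •
          openVec D n (incr γ r) := by
  obtain ⟨c, d, hc, -, h⟩ := openMon_poly (N := N) P n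
  have hc' := hc.map (LinearMap.applyₗ (R := ℂ) (openVec D n γ))
  have h2 := hc'.lagrange_inv (node_injective hD hP hgen le_rfl γ)
    (node_ne_zero hD hP le_rfl γ) hz
  simp only [LinearMap.applyₗ_apply_apply, ← (h _).1] at h2
  rw [h2]
  refine Finset.sum_congr rfl fun r _ => ?_
  rw [openMon_10_node hD hP hgen, smul_smul]

/-- Crossing leaves only A and C, at z and at ωθ/z, so the first entry of U can be evaluated on |γ⟩
without B and D. -/
theorem monodromy_00 (hP : P.Nondegenerate) {z : ℂ} (hz : z ≠ 0) :
    (monodromy P z 0 0 : Module.End ℂ (States N n)) =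
      (P.αm * (P.θ / z - z)) •
          (vInvProd P n * openMon P n (omega N * P.θ / z) 0 0 * openMon P n z 0 0) +
        P.ηm • (vInvProd P n * openMon P n (omega N * P.θ / z) 0 0 * openMon P n z 1 0 -
          vInvProd P n * openMon P n (omega N * P.θ / z) 1 0 * openMon P n z 0 0) := by
  obtain ⟨h00, h01, -, -⟩ := crossing (N := N) hP n hz
  rw [monodromy_eq]
  simp only [Matrix.mul_apply, Fin.sum_univ_two, kMinus, Matrix.of_apply,
    Matrix.cons_val_zero, Matrix.cons_val_one, Matrix.cons_val', Matrix.cons_val_fin_one, h00,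
    h01, mul_smul_comm, mul_zero, add_zero, add_mul, smul_mul_assoc, end_neg_mul,
    mul_assoc, one_mul, zero_mul, neg_zero]
  module

/-- The coefficients of `|γ + e_r⟩` in the action of the first entry of the monodromy matrix. -/
def hopCoeff (P : Params) (D : Amplitudes n) (γ : Fin n → ZMod N) (r : Fin n) : ℂ :=
  -(P.ηm * raiseCoeff P D γ r * P.κ ^ n /
    ∏ s ∈ Finset.univ.erase r, (1 - node P D n γ s / node P D n γ r))

/-- On |γ⟩ the products A(ωθ/z)C(z) and C(ωθ/z)A(z) lead to the same vectors |γ + e_r⟩, with the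
same factors for all nodes s ≠ r. Their difference thus comes from the node r alone. -/
theorem monodromy_00_openVec (hD : D.IsOpen N P) (hP : P.Nondegenerate)
    (hgen : ∀ r r', r ≠ r' → D.v n r ^ N ≠ D.v n r' ^ N) (γ : Fin n → ZMod N) {z : ℂ}
    (hz : z ≠ 0) :
    monodromy P z 0 0 (openVec D n γ) = (P.θ / z - z) •
      ((P.αm * P.κ ^ n * ∏ s, (symVar N P z - symVar N P (node P D n γ s))) • openVec D n γ +
        ∑ r, (hopCoeff P D γ r * ∏ s ∈ Finset.univ.erase r,
          (symVar N P z - symVar N P (node P D n γ s))) • openVec D n (incr γ r)) := by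
  have hθ := hP.θ_ne
  have hω := omega_ne_zero N
  have hν : omega N * P.θ / z ≠ 0 := div_ne_zero (mul_ne_zero hω hθ) hz
  have hn0 := node_ne_zero hD hP le_rfl γ
  have hA := fun γ => (openMon_openVec hD hP hgen n le_rfl hz).1 γ
  have hA' := fun γ => (openMon_openVec hD hP hgen n le_rfl hν).1 γ
  have hfac : ∀ s, omega N * P.θ * P.κ / -node P D n γ s *
      ((1 - node P D n γ s * (1 / z)) * (1 - node P D n γ s * (1 / (omega N * P.θ / z)))) =
      P.κ * (symVar N P z - symVar N P (node P D n γ s)) := by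
    intro s
    have h := mul_symVar_sub (N := N) hP hz (hn0 s)
    rw [div_mul_eq_mul_div, div_eq_iff (neg_ne_zero.2 (hn0 s))]
    linear_combination P.κ * h
  rw [monodromy_00 hP hz]
  simp only [LinearMap.add_apply, LinearMap.smul_apply, LinearMap.sub_apply,
    Module.End.mul_apply, hA, openMon_10_openVec hD hP hgen γ hz, map_sum, map_smul, hA',
    openMon_10_openVec hD hP hgen γ hν, vInvProd_openVec hD hP n le_rfl, smul_add, smul_smul]
  congr 1
  · congr 1
    have h1 := Finset.prod_congr rfl fun s (_ : s ∈ Finset.univ) => hfac s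
    simp only [Finset.prod_mul_distrib, Finset.prod_const, Finset.card_univ,
      Fintype.card_fin] at h1
    linear_combination (P.αm * (P.θ / z - z)) * h1
  · simp only [Finset.smul_sum]
    rw [← Finset.sum_sub_distrib, Finset.smul_sum]
    refine Finset.sum_congr rfl fun r _ => ?_
    simp only [smul_smul]
    rw [← sub_smul, smul_smul]
    congr 1
    have h1 := Finset.prod_congr rfl fun s (_ : s ∈ Finset.univ.erase r) => hfac s
    rw [← Finset.mul_prod_erase Finset.univ _ (Finset.mem_univ r),
      ← Finset.mul_prod_erase Finset.univ (fun s => 1 - node P D n γ s * (1 / z))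
        (Finset.mem_univ r),
      ← Finset.mul_prod_erase Finset.univ (fun s => omega N * P.θ * P.κ / -node P D n (incr γ r) s)
        (Finset.mem_univ r)]
    have e1 : ∏ s ∈ Finset.univ.erase r,
        (1 - node P D n (incr γ r) s * (1 / (omega N * P.θ / z))) =
        ∏ s ∈ Finset.univ.erase r, (1 - node P D n γ s * (1 / (omega N * P.θ / z))) :=
      Finset.prod_congr rfl fun s hs => by
        rw [node_incr_of_ne P D n γ (Finset.ne_of_mem_erase hs)]
    have e2 : ∏ s ∈ Finset.univ.erase r, (omega N * P.θ * P.κ / -node P D n (incr γ r) s) =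
        ∏ s ∈ Finset.univ.erase r, (omega N * P.θ * P.κ / -node P D n γ s) :=
      Finset.prod_congr rfl fun s hs => by
        rw [node_incr_of_ne P D n γ (Finset.ne_of_mem_erase hs)]
    have e3 : P.κ ^ n = P.κ * ∏ s ∈ Finset.univ.erase r, P.κ := by
      rw [Finset.mul_prod_erase Finset.univ (fun _ => P.κ) (Finset.mem_univ r)]
      simp
    rw [e1, e2, node_incr_same, hopCoeff, e3]
    have e5 : ∀ w : ℂ, ∏ s ∈ Finset.univ.erase r,
        ((1 - node P D n γ s * (1 / w)) / (1 - node P D n γ s / node P D n γ r)) =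
        (∏ s ∈ Finset.univ.erase r, (1 - node P D n γ s * (1 / w))) /
          ∏ s ∈ Finset.univ.erase r, (1 - node P D n γ s / node P D n γ r) :=
      fun w => Finset.prod_div_distrib _ _
    rw [e5, e5]
    simp only [Finset.prod_mul_distrib] at h1 ⊢
    have hr := hn0 r
    generalize ∏ s ∈ Finset.univ.erase r, (1 - node P D n γ s / node P D n γ r) = X1 at *
    generalize ∏ s ∈ Finset.univ.erase r, (1 - node P D n γ s * (1 / z)) = X2 at *
    generalize ∏ s ∈ Finset.univ.erase r,
      (1 - node P D n γ s * (1 / (omega N * P.θ / z))) = X3 at *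
    generalize ∏ s ∈ Finset.univ.erase r, (omega N * P.θ * P.κ / -node P D n γ s) = X4 at *
    generalize ∏ s ∈ Finset.univ.erase r,
      (symVar N P z - symVar N P (node P D n γ s)) = X5 at *
    generalize ∏ s ∈ Finset.univ.erase r, P.κ = X6 at *
    generalize raiseCoeff P D γ r = X7 at *
    -- The difference of the two factors of the node r supplies the common factor θ/z - z.
    have e4 : omega N * P.θ * P.κ / -(omega N * node P D n γ r) *
        ((1 - omega N * node P D n γ r * (1 / (omega N * P.θ / z))) -
          (1 - node P D n γ r * (1 / z))) = -P.κ * (P.θ / z - z) := by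
      field_simp
      ring
    linear_combination (P.ηm * X7 / X1) * (X4 * (X2 * X3)) * e4 - (P.ηm * X7 / X1) * P.κ * (P.θ / z - z) * h1

end action

/-! ### The eigenvectors of the one-boundary chain -/

section boundary
variable {N n : ℕ} [NeZero N] {P : Params} {D : Amplitudes n}

/-- In general position the left side of the equation on the boundary amplitudes does not vanish,
hence no factor on its right side does. -/
theorem Amplitudes.IsBoundary.yB_ne (hD : D.IsOpen N P) (hbd : D.IsBoundary N P)
    (hgen : D.IsGeneric N P) (hP : P.Nondegenerate) (r k : Fin n) :
    D.yB r k ≠ 0 ∧ D.ytB r k ≠ 0 := by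
  have h := hbd.equation r
  have hl : P.ηm * D.v n r ^ 2 / (P.κ ^ ((n : ℤ) - 2) * omega N ^ (n + 1) * P.θ) *
      ∏ r' ∈ Finset.univ.erase r, D.yt r r' ≠ 0 := by
    refine mul_ne_zero (div_ne_zero (mul_ne_zero hP.ηm_ne (pow_ne_zero _ (hD.v_ne hP le_rfl r)))
      (mul_ne_zero (mul_ne_zero (zpow_ne_zero _ hP.κ_ne) (pow_ne_zero _ (omega_ne_zero N)))
        hP.θ_ne)) (Finset.prod_ne_zero_iff.2 fun s hs => ?_)
    exact hgen.yt_ne r s (Finset.ne_of_mem_erase hs).symm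
  rw [h] at hl
  have h2 := Finset.prod_ne_zero_iff.1 (right_ne_zero_of_mul hl) k (Finset.mem_univ k)
  exact ⟨left_ne_zero_of_mul h2, right_ne_zero_of_mul h2⟩

theorem lam_ne_zero (hP : P.Nondegenerate) (hbd : D.IsBoundary N P) (k : Fin n) (σ : ZMod N) :
    lam P D k σ ≠ 0 :=
  mul_ne_zero (mul_ne_zero (neg_ne_zero.2 hP.κ_ne) (hbd.s_ne k)) (omegaPow_ne_zero σ)

theorem lam_add_one (P : Params) (D : Amplitudes n) (k : Fin n) (σ : ZMod N) :
    lam P D k (σ + 1) = omega N * lam P D k σ := by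
  rw [lam, lam, omegaPow_add_one]
  ring

theorem lam_sub_one (P : Params) (D : Amplitudes n) (k : Fin n) (σ : ZMod N) :
    lam P D k (σ - 1) = lam P D k σ / omega N := by
  rw [lam, lam, omegaPow_sub_one]
  ring

theorem lam_pow (P : Params) (D : Amplitudes n) (k : Fin n) (σ : ZMod N) :
    lam P D k σ ^ N = (-P.κ) ^ N * D.s k ^ N := by
  rw [lam, mul_pow, mul_pow, omegaPow_pow_self, mul_one]

theorem xB_mul (hP : P.Nondegenerate) (D : Amplitudes n) (γ : Fin n → ZMod N) (r k : Fin n)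
    (σ : ZMod N) :
    D.xB r k * omegaPow (γ r - σ) = node P D n γ r / lam P D k σ := by
  rw [Amplitudes.xB, omegaPow_sub, node, lam, mul_div_mul_comm,
    mul_div_mul_left _ _ (neg_ne_zero.2 hP.κ_ne)]

theorem xtB_mul (D : Amplitudes n) (γ : Fin n → ZMod N) (r k : Fin n) (σ : ZMod N) :
    D.xtB N P r k * omegaPow (γ r + σ) = node P D n γ r * lam P D k σ / (omega N * P.θ) := by
  rw [Amplitudes.xtB, omegaPow_add, node, lam]
  ring

theorem xt_mul (D : Amplitudes n) (γ : Fin n → ZMod N) (r s : Fin n) :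
    D.xt N P r s * omegaPow (γ r + γ s) =
      node P D n γ r * node P D n γ s / (omega N * P.θ) := by
  rw [Amplitudes.xt, omegaPow_add, node, node]
  ring

theorem xt_symm (D : Amplitudes n) (r s : Fin n) : D.xt N P r s = D.xt N P s r := by
  rw [Amplitudes.xt, Amplitudes.xt]
  ring

/-- The factor of `boundaryQ` that belongs to the labels `γ_r` and `σ_k`. -/
theorem cyc_pair_decr (hD : D.IsOpen N P) (hbd : D.IsBoundary N P)
    (hgen : D.IsGeneric N P) (hP : P.Nondegenerate) (γ : Fin n → ZMod N) (r k : Fin n)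
    (σ : ZMod N) :
    cyc (D.xB r k) (D.yB r k) (γ r - σ) * cyc (D.xtB N P r k) (D.ytB r k) (γ r + σ) =
      cyc (D.xB r k) (D.yB r k) (decr γ r r - σ) *
          cyc (D.xtB N P r k) (D.ytB r k) (decr γ r r + σ) *
        (D.yB r k / (1 - node P D n γ r / lam P D k σ) *
          (D.ytB r k / (1 - node P D n γ r * lam P D k σ / (omega N * P.θ)))) := by
  obtain ⟨h1, h2⟩ := hbd.yB_ne hD hgen hP r k
  rw [cyc_eq_sub_one (hbd.fermat_B r k) h1 (γ r - σ),
    cyc_eq_sub_one (hbd.fermat_tB r k) h2 (γ r + σ), xB_mul hP, xtB_mul, decr_same,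
    sub_right_comm, sub_add_eq_add_sub]
  ring

/-- Every group of factors obeys a first-order difference equation in γ_r. The Gaussian factor
ω^{γ²+γ} contributes ω^{2γ_r}, which later matches the square of the node in `hopCoeff_decr`. -/
theorem boundaryQ_eq_decr (hD : D.IsOpen N P) (hbd : D.IsBoundary N P)
    (hgen : D.IsGeneric N P) (hP : P.Nondegenerate) (γ σ : Fin n → ZMod N) (r : Fin n) :
    boundaryQ P D γ σ = boundaryQ P D (decr γ r) σ *
      (omegaPow (γ r) ^ 2 *
        (∏ k, (D.yB r k / (1 - node P D n γ r / lam P D k (σ k)) *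
          (D.ytB r k / (1 - node P D n γ r * lam P D k (σ k) / (omega N * P.θ))))) *
        ∏ s ∈ Finset.univ.erase r,
          ((node P D n γ r - node P D n γ s) / (node P D n (decr γ r) r - node P D n γ s) *
            ((1 - node P D n γ r * node P D n γ s / (omega N * P.θ)) / D.yt r s))) := by
  have e1 : ∏ s, omegaPow (γ s ^ 2 + γ s) =
      (∏ s, omegaPow (decr γ r s ^ 2 + decr γ r s)) * omegaPow (γ r) ^ 2 := by
    rw [← Finset.mul_prod_erase Finset.univ _ (Finset.mem_univ r),
      ← Finset.mul_prod_erase Finset.univ (fun s => omegaPow (decr γ r s ^ 2 + decr γ r s))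
        (Finset.mem_univ r)]
    have : ∏ s ∈ Finset.univ.erase r, omegaPow (decr γ r s ^ 2 + decr γ r s) =
        ∏ s ∈ Finset.univ.erase r, omegaPow (γ s ^ 2 + γ s) :=
      Finset.prod_congr rfl fun s hs => by rw [decr_of_ne γ (Finset.ne_of_mem_erase hs)]
    have e : γ r ^ 2 + γ r = (decr γ r r ^ 2 + decr γ r r) + (γ r + γ r) := by
      rw [decr_same]; ring
    rw [this, e, omegaPow_add, omegaPow_add (γ r)]
    ring
  have e2 : ∏ k, ∏ s, cyc (D.xB s k) (D.yB s k) (γ s - σ k) *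
        cyc (D.xtB N P s k) (D.ytB s k) (γ s + σ k) =
      (∏ k, ∏ s, cyc (D.xB s k) (D.yB s k) (decr γ r s - σ k) *
        cyc (D.xtB N P s k) (D.ytB s k) (decr γ r s + σ k)) *
        ∏ k, (D.yB r k / (1 - node P D n γ r / lam P D k (σ k)) *
          (D.ytB r k / (1 - node P D n γ r * lam P D k (σ k) / (omega N * P.θ)))) := by
    rw [← Finset.prod_mul_distrib]
    refine Finset.prod_congr rfl fun k _ => ?_
    rw [← Finset.mul_prod_erase Finset.univ _ (Finset.mem_univ r),
      ← Finset.mul_prod_erase Finset.univ (fun s => cyc (D.xB s k) (D.yB s k)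
        (decr γ r s - σ k) * cyc (D.xtB N P s k) (D.ytB s k) (decr γ r s + σ k))
        (Finset.mem_univ r), cyc_pair_decr hD hbd hgen hP γ r k (σ k)]
    have : ∏ s ∈ Finset.univ.erase r, cyc (D.xB s k) (D.yB s k) (decr γ r s - σ k) *
        cyc (D.xtB N P s k) (D.ytB s k) (decr γ r s + σ k) =
        ∏ s ∈ Finset.univ.erase r, cyc (D.xB s k) (D.yB s k) (γ s - σ k) *
        cyc (D.xtB N P s k) (D.ytB s k) (γ s + σ k) :=
      Finset.prod_congr rfl fun s hs => by rw [decr_of_ne γ (Finset.ne_of_mem_erase hs)]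
    rw [this]
    ring
  have hv : ∀ (δ : Fin n → ZMod N) s, D.v n s * omegaPow (δ s) = node P D n δ s / (-P.κ) := by
    intro δ s
    rw [node, mul_assoc, mul_div_cancel_left₀ _ (neg_ne_zero.2 hP.κ_ne)]
  have hne : ∀ s, s ≠ r → node P D n (decr γ r) r - node P D n γ s ≠ 0 := by
    intro s hs h0
    refine hs (node_injective hD hP hgen.v_pow_ne le_rfl (decr γ r) ?_)
    rw [sub_eq_zero.1 h0, node, node, decr_of_ne γ hs]
  have hκ := neg_ne_zero.2 hP.κ_ne
  have e3 : ∏ j, ∏ l ∈ Finset.Ioi j,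
        (D.v n j * omegaPow (γ j) - D.v n l * omegaPow (γ l)) /
          cyc (D.xt N P j l) (D.yt j l) (γ j + γ l) =
      (∏ j, ∏ l ∈ Finset.Ioi j,
        (D.v n j * omegaPow (decr γ r j) - D.v n l * omegaPow (decr γ r l)) /
          cyc (D.xt N P j l) (D.yt j l) (decr γ r j + decr γ r l)) *
        ∏ s ∈ Finset.univ.erase r,
          ((node P D n γ r - node P D n γ s) / (node P D n (decr γ r) r - node P D n γ s) *
            ((1 - node P D n γ r * node P D n γ s / (omega N * P.θ)) / D.yt r s)) := by
    refine prod_Ioi_update r _ _ _ ?_ ?_ ?_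
    · intro j l _ hj hl
      rw [decr_of_ne γ hj, decr_of_ne γ hl]
    · intro l hl
      have hl' := hl.ne'
      have hd := hne l hl'
      have hy := hgen.yt_ne r l hl.ne
      have hc := one_sub_mul_omegaPow_ne_zero (hbd.fermat_t r l hl.ne) hy (γ r + γ l)
      have hc2 := cyc_ne_zero (hbd.fermat_t r l hl.ne) hy (decr γ r r + γ l)
      rw [hv, hv, hv, decr_of_ne γ hl', hv,
        cyc_eq_sub_one (hbd.fermat_t r l hl.ne) hy (γ r + γ l)]
      rw [xt_mul] at hc ⊢
      have e : γ r + γ l - 1 = decr γ r r + γ l := by rw [decr_same]; ring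
      rw [e, ← sub_div, ← sub_div]
      generalize cyc (D.xt N P r l) (D.yt r l) (decr γ r r + γ l) = X at *
      generalize 1 - node P D n γ r * node P D n γ l / (omega N * P.θ) = Y at *
      field_simp
    · intro l hl
      have hl' := hl.ne
      have hd := hne l hl'
      have hy := hgen.yt_ne r l hl.ne'
      have hc := one_sub_mul_omegaPow_ne_zero (hbd.fermat_t r l hl.ne') hy (γ r + γ l)
      have hc2 := cyc_ne_zero (hbd.fermat_t r l hl.ne') hy (decr γ r r + γ l)
      rw [decr_of_ne γ hl', hv, hv, hv, xt_symm, hbd.yt_symm l r, add_comm (γ l),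
        add_comm (γ l), cyc_eq_sub_one (hbd.fermat_t r l hl.ne') hy (γ r + γ l)]
      rw [xt_mul] at hc ⊢
      have e : γ r + γ l - 1 = decr γ r r + γ l := by rw [decr_same]; ring
      rw [e, ← sub_div, ← sub_div, ← neg_sub (node P D n γ r),
        ← neg_sub (node P D n (decr γ r) r)]
      generalize cyc (D.xt N P r l) (D.yt r l) (decr γ r r + γ l) = X at *
      generalize 1 - node P D n γ r * node P D n γ l / (omega N * P.θ) = Y at *
      field_simp
  rw [boundaryQ, boundaryQ, e1, e2, e3]
  ring

theorem hopCoeff_decr (hD : D.IsOpen N P) (hP : P.Nondegenerate)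
    (γ : Fin n → ZMod N) (r : Fin n) :
    hopCoeff P D (decr γ r) r =
      P.ηm * node P D n γ r ^ 2 / (omega N * hCoeff P D n r * node P D n γ r ^ n) *
        ∏ s ∈ Finset.univ.erase r,
          (-node P D n γ s / (1 - omega N * node P D n γ s / node P D n γ r)) := by
  have hω := omega_ne_zero N
  have hθ := hP.θ_ne
  have hκ := hP.κ_ne
  have hr := node_ne_zero hD hP le_rfl γ r
  have hh := hCoeff_ne_zero hD hP r
  have e1 : node P D n (decr γ r) r = node P D n γ r / omega N := by
    rw [eq_div_iff hω, mul_comm, ← node_incr_same, incr_decr]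
  have e2 : ∀ s ∈ Finset.univ.erase r, node P D n (decr γ r) s = node P D n γ s := by
    intro s hs
    conv_rhs => rw [← incr_decr γ r]
    rw [node_incr_of_ne P D n _ (Finset.ne_of_mem_erase hs)]
  have e3 : ∏ s ∈ Finset.univ.erase r,
      (1 - node P D n (decr γ r) s / node P D n (decr γ r) r) =
      ∏ s ∈ Finset.univ.erase r, (1 - omega N * node P D n γ s / node P D n γ r) :=
    Finset.prod_congr rfl fun s hs => by
      rw [e2 s hs, e1, div_div_eq_mul_div, mul_comm]
  have e4 : ∏ s, -node P D n (decr γ r) s =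
      -(node P D n γ r / omega N) * ∏ s ∈ Finset.univ.erase r, -node P D n γ s := by
    rw [← Finset.mul_prod_erase Finset.univ _ (Finset.mem_univ r), e1]
    congr 1
    exact Finset.prod_congr rfl fun s hs => by rw [e2 s hs]
  rw [hopCoeff, raiseCoeff, e3, Finset.prod_div_distrib, Finset.prod_div_distrib, e4, e1]
  have hne : ∏ s ∈ Finset.univ.erase r, -node P D n γ s ≠ 0 :=
    Finset.prod_ne_zero_iff.2 fun s _ => neg_ne_zero.2 (node_ne_zero hD hP le_rfl γ s)
  generalize ∏ s ∈ Finset.univ.erase r, -node P D n γ s = X at *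
  generalize ∏ s ∈ Finset.univ.erase r, (1 - omega N * node P D n γ s / node P D n γ r) = Y at *
  simp only [Finset.prod_const, Finset.card_univ, Fintype.card_fin, div_pow, mul_pow]
  field_simp

/-- The equation on the amplitudes, in the form in which it enters the eigenvector equation. -/
theorem hop_boundaryQ (hD : D.IsOpen N P) (hbd : D.IsBoundary N P)
    (hgen : D.IsGeneric N P) (hP : P.Nondegenerate) (γ σ : Fin n → ZMod N) (r : Fin n) :
    hopCoeff P D (decr γ r) r * (∏ s ∈ Finset.univ.erase r,
        (symVar N P (node P D n γ r) - symVar N P (node P D n γ s))) *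
        boundaryQ P D (decr γ r) σ =
      P.αm * P.κ ^ n * (∏ k, (symVar N P (node P D n γ r) - symVar N P (lam P D k (σ k)))) *
        boundaryQ P D γ σ := by
  have hω := omega_ne_zero N
  have hθ := hP.θ_ne
  have hκ := hP.κ_ne
  have hn0 := node_ne_zero hD hP le_rfl γ
  have hl0 := fun k => lam_ne_zero (N := N) hP hbd k (σ k)
  have e1 : node P D n (decr γ r) r = node P D n γ r / omega N := by
    rw [eq_div_iff hω, mul_comm, ← node_incr_same, incr_decr]
  -- Each s ≠ r contributes θ ỹ_{r,s} and, by `hfacB`, each k contributes ωθ y^B_{r,k} ỹ^B_{r,k}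
  -- divided by the node; all other dependence on the remaining nodes and on σ cancels.
  have hfac : ∀ s ∈ Finset.univ.erase r,
      -node P D n γ s / (1 - omega N * node P D n γ s / node P D n γ r) *
        (symVar N P (node P D n γ r) - symVar N P (node P D n γ s)) =
      P.θ * D.yt r s *
        ((node P D n γ r - node P D n γ s) / (node P D n (decr γ r) r - node P D n γ s) *
          ((1 - node P D n γ r * node P D n γ s / (omega N * P.θ)) / D.yt r s)) := by
    intro s hs
    have hs' := Finset.ne_of_mem_erase hs
    have hy := hgen.yt_ne r s (Ne.symm hs')
    have hd : node P D n γ r - omega N * node P D n γ s ≠ 0 := by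
      intro h0
      refine hs' (node_injective hD hP hgen.v_pow_ne le_rfl (decr γ r) ?_)
      rw [e1, sub_eq_zero.1 h0, mul_div_cancel_left₀ _ hω, node, node, decr_of_ne γ hs']
    have d1 : 1 - omega N * node P D n γ s / node P D n γ r =
        (node P D n γ r - omega N * node P D n γ s) / node P D n γ r := by
      have := hn0 r
      field_simp
    have d2 : node P D n γ r / omega N - node P D n γ s =
        (node P D n γ r - omega N * node P D n γ s) / omega N := by
      field_simp
    rw [symVar_sub (hn0 r) (hn0 s), e1, d1, d2]
    have h1 := hn0 r
    have h2 := hn0 s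
    field_simp
    ring
  have hfacB : ∀ k, (symVar N P (node P D n γ r) - symVar N P (lam P D k (σ k))) *
      (D.yB r k / (1 - node P D n γ r / lam P D k (σ k)) *
        (D.ytB r k / (1 - node P D n γ r * lam P D k (σ k) / (omega N * P.θ)))) =
      omega N * P.θ / node P D n γ r * (D.yB r k * D.ytB r k) := by
    intro k
    obtain ⟨h1, h2⟩ := hbd.yB_ne hD hgen hP r k
    have d1 := one_sub_mul_omegaPow_ne_zero (hbd.fermat_B r k) h1 (γ r - σ k)
    have d2 := one_sub_mul_omegaPow_ne_zero (hbd.fermat_tB r k) h2 (γ r + σ k)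
    rw [xB_mul hP] at d1
    rw [xtB_mul] at d2
    have h3 := hn0 r
    have h4 := hl0 k
    have d3 : symVar N P (node P D n γ r) - symVar N P (lam P D k (σ k)) =
        omega N * P.θ / node P D n γ r * ((1 - node P D n γ r / lam P D k (σ k)) *
          (1 - node P D n γ r * lam P D k (σ k) / (omega N * P.θ))) := by
      rw [symVar, symVar]
      field_simp
      ring
    rw [d3]
    generalize 1 - node P D n γ r / lam P D k (σ k) = X at *
    generalize 1 - node P D n γ r * lam P D k (σ k) / (omega N * P.θ) = Y at *
    field_simp
  have hp := Finset.prod_congr rfl hfac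
  have hpB := Finset.prod_congr rfl fun k (_ : k ∈ Finset.univ) => hfacB k
  rw [hopCoeff_decr hD hP, boundaryQ_eq_decr hD hbd hgen hP γ σ r]
  simp only [Finset.prod_mul_distrib] at hp hpB ⊢
  have heq := hbd.equation r
  have hh0 := hCoeff_ne_zero hD hP r
  have hh : D.h P r = hCoeff P D n r := rfl
  rw [hh, zpow_sub₀ hκ, zpow_natCast, Finset.prod_mul_distrib] at heq
  have hθn : P.θ * ∏ s ∈ Finset.univ.erase r, P.θ = P.θ ^ n := by
    rw [Finset.mul_prod_erase Finset.univ (fun _ => P.θ) (Finset.mem_univ r)]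
    simp
  have hv : node P D n γ r ^ 2 = P.κ ^ 2 * D.v n r ^ 2 * omegaPow (γ r) ^ 2 := by
    rw [node]
    ring
  have hyt : ∏ s ∈ Finset.univ.erase r, D.yt r s ≠ 0 :=
    Finset.prod_ne_zero_iff.2 fun s hs => hgen.yt_ne r s (Finset.ne_of_mem_erase hs).symm
  have hr := hn0 r
  -- What remains is the equation on the boundary amplitudes: the square of the node equals κ²
  -- v_{n,r}² ω^{2γ_r}, and the label γ_r drops out.
  have key : P.ηm * node P D n γ r ^ 2 / (omega N * hCoeff P D n r * node P D n γ r ^ n) *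
      ((∏ s ∈ Finset.univ.erase r, P.θ) * ∏ s ∈ Finset.univ.erase r, D.yt r s) =
      P.αm * P.κ ^ n * omegaPow (γ r) ^ 2 * ((∏ k : Fin n, omega N * P.θ / node P D n γ r) *
        ((∏ k, D.yB r k) * ∏ k, D.ytB r k)) := by
    have heq' : P.ηm * D.v n r ^ 2 * P.κ ^ 2 * ∏ s ∈ Finset.univ.erase r, D.yt r s =
        P.αm * hCoeff P D n r * ((∏ k, D.yB r k) * ∏ k, D.ytB r k) *
          (P.κ ^ n * omega N ^ (n + 1) * P.θ) := by
      rw [← heq]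
      have : (P.κ ^ (2 : ℤ)) = P.κ ^ 2 := by norm_cast
      rw [this]
      field_simp
    have hpc : ∏ _k : Fin n, omega N * P.θ / node P D n γ r =
        (omega N * P.θ) ^ n / node P D n γ r ^ n := by
      simp
    have hrn := pow_ne_zero n hr
    rw [hpc, mul_pow, ← hθn, div_mul_eq_mul_div,
      div_eq_iff (mul_ne_zero (mul_ne_zero hω hh0) hrn), hv]
    rw [pow_succ] at heq'
    generalize ∏ s ∈ Finset.univ.erase r, P.θ = Θ at *
    generalize node P D n γ r ^ n = R at *
    field_simp
    linear_combination Θ * omegaPow (γ r) ^ 2 * heq'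
  linear_combination (P.ηm * node P D n γ r ^ 2 /
      (omega N * hCoeff P D n r * node P D n γ r ^ n)) * boundaryQ P D (decr γ r) σ * hp +
    boundaryQ P D (decr γ r) σ *
      ((∏ s ∈ Finset.univ.erase r, (node P D n γ r - node P D n γ s) /
          (node P D n (decr γ r) r - node P D n γ s)) *
        ∏ s ∈ Finset.univ.erase r, (1 - node P D n γ r * node P D n γ s / (omega N * P.θ)) /
          D.yt r s) * key -
    P.αm * P.κ ^ n * omegaPow (γ r) ^ 2 * boundaryQ P D (decr γ r) σ *
      ((∏ s ∈ Finset.univ.erase r, (node P D n γ r - node P D n γ s) /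
          (node P D n (decr γ r) r - node P D n γ s)) *
        ∏ s ∈ Finset.univ.erase r, (1 - node P D n γ r * node P D n γ s / (omega N * P.θ)) /
          D.yt r s) * hpB

end boundary

/-! ### The eigenvectors Ψ_σ of the first entry U₀₀ -/

section sov
variable {N n : ℕ} [NeZero N] {P : Params} {D : Amplitudes n}

/-- Two nodes have the same Λ only if they coincide or their product is ωθ. The second case would
make the point p̃_{r,s} have ỹ_{r,s} = 0. -/
theorem symVar_node_injective (hD : D.IsOpen N P) (hbd : D.IsBoundary N P)
    (hgen : D.IsGeneric N P) (hP : P.Nondegenerate) (γ : Fin n → ZMod N) :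
    Function.Injective fun r => symVar N P (node P D n γ r) := by
  intro r s h
  by_contra hrs
  have hr := node_ne_zero hD hP le_rfl γ r
  have hs := node_ne_zero hD hP le_rfl γ s
  have h2 := symVar_sub (N := N) (P := P) hr hs
  rw [show symVar N P (node P D n γ r) = symVar N P (node P D n γ s) from h, sub_self] at h2
  rcases mul_eq_zero.1 h2.symm with h3 | h3
  · exact hrs (node_injective hD hP hgen.v_pow_ne le_rfl γ (sub_eq_zero.1 h3))
  · have h4 := one_sub_mul_omegaPow_ne_zero (hbd.fermat_t r s hrs) (hgen.yt_ne r s hrs) (γ r + γ s)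
    rw [xt_mul] at h4
    have hω := omega_ne_zero N
    have hθ := hP.θ_ne
    refine h4 ?_
    field_simp at h3 ⊢
    linear_combination -h3

theorem node_decr_of_ne (P : Params) (D : Amplitudes n) (m : ℕ) (γ : Fin m → ZMod N)
    {r s : Fin m} (h : s ≠ r) : node P D m (decr γ r) s = node P D m γ s := by
  simp only [node, decr_of_ne γ h]

/-- The eigenvector equation for the coefficients of `Ψ_σ`. -/
theorem boundaryQ_eigen (hD : D.IsOpen N P) (hbd : D.IsBoundary N P)
    (hgen : D.IsGeneric N P) (hP : P.Nondegenerate) (γ σ : Fin n → ZMod N) (x : ℂ) :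
    P.αm * P.κ ^ n * (∏ s, (x - symVar N P (node P D n γ s))) * boundaryQ P D γ σ +
        ∑ r, hopCoeff P D (decr γ r) r * (∏ s ∈ Finset.univ.erase r,
          (x - symVar N P (node P D n (decr γ r) s))) * boundaryQ P D (decr γ r) σ =
      P.αm * P.κ ^ n * (∏ k, (x - symVar N P (lam P D k (σ k)))) * boundaryQ P D γ σ := by
  have e : ∀ r, ∏ s ∈ Finset.univ.erase r, (x - symVar N P (node P D n (decr γ r) s)) =
      ∏ s ∈ Finset.univ.erase r, (x - symVar N P (node P D n γ s)) := fun r =>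
    Finset.prod_congr rfl fun s hs => by rw [node_decr_of_ne P D n γ (Finset.ne_of_mem_erase hs)]
  simp only [e]
  have h1 := PolyLT.prod_sub Finset.univ (fun s => -symVar N P (node P D n γ s)) (fun _ => 1)
  have h2 := PolyLT.prod_sub Finset.univ (fun k => -symVar N P (lam P D k (σ k))) (fun _ => 1)
  have h3 := fun r => PolyLT.prod (Finset.univ.erase r)
    (fun s => -symVar N P (node P D n γ s)) (fun _ => 1)
  have hcard : ∀ r : Fin n, (Finset.univ.erase r).card + 1 = Finset.univ.card := fun r =>
    Finset.card_erase_add_one (Finset.mem_univ r)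
  simp only [hcard] at h3
  have h4 := ((h1.sub h2).smul (P.αm * P.κ ^ n * boundaryQ P D γ σ)).add
    (PolyLT.sum Finset.univ fun r _ =>
      (h3 r).smul (hopCoeff P D (decr γ r) r * boundaryQ P D (decr γ r) σ))
  rw [Finset.card_univ] at h4
  -- Both sides have the same leading term, so the difference has degree below n in x. At each of
  -- the n nodes only one hopping term survives, and `hop_boundaryQ` balances it.
  have h5 := h4.eq_zero (symVar_node_injective hD hbd hgen hP γ) (fun r => by
    have hz : ∀ t, t ≠ r → ∏ s ∈ Finset.univ.erase t, (-symVar N P (node P D n γ s) +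
        1 * symVar N P (node P D n γ r)) = 0 := fun t ht =>
      Finset.prod_eq_zero (Finset.mem_erase.2 ⟨Ne.symm ht, Finset.mem_univ r⟩) (by ring)
    rw [Finset.sum_eq_single r (fun t _ ht => by rw [hz t ht, smul_zero]) (by simp),
      Finset.prod_eq_zero (i := r) (Finset.mem_univ r) (by ring)]
    have h := hop_boundaryQ hD hbd hgen hP γ σ r
    simp only [neg_add_eq_sub, one_mul, smul_eq_mul]
    linear_combination h) x
  simp only [neg_add_eq_sub, one_mul, smul_eq_mul] at h5
  rw [← sub_eq_zero, ← h5]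
  have : ∀ r, hopCoeff P D (decr γ r) r * (∏ s ∈ Finset.univ.erase r,
      (x - symVar N P (node P D n γ s))) * boundaryQ P D (decr γ r) σ =
      hopCoeff P D (decr γ r) r * boundaryQ P D (decr γ r) σ * ∏ s ∈ Finset.univ.erase r,
      (x - symVar N P (node P D n γ s)) := fun r => by ring
  simp only [this]
  ring

/-- `Ψ_σ` is an eigenvector of the first entry of the one-boundary monodromy matrix. -/
theorem monodromy_00_psi (hD : D.IsOpen N P) (hbd : D.IsBoundary N P)
    (hgen : D.IsGeneric N P) (hP : P.Nondegenerate) (σ : Fin n → ZMod N) {z : ℂ} (hz : z ≠ 0) :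
    monodromy P z 0 0 (psi P D σ) = ((P.θ / z - z) * (P.αm * P.κ ^ n *
      ∏ k, (symVar N P z - symVar N P (lam P D k (σ k))))) • psi P D σ := by
  rw [psi, map_sum, mul_smul, Finset.smul_sum]
  simp only [map_smul, monodromy_00_openVec hD hP hgen.v_pow_ne _ hz]
  simp only [smul_comm _ (P.θ / z - z)]
  rw [← Finset.smul_sum, ← Finset.smul_sum]
  congr 1
  simp only [smul_add, Finset.sum_add_distrib, Finset.smul_sum, smul_smul]
  rw [Finset.sum_comm (s := Finset.univ) (t := Finset.univ) (f := fun γ r =>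
    (boundaryQ P D γ σ * (hopCoeff P D γ r * ∏ s ∈ Finset.univ.erase r,
      (symVar N P z - symVar N P (node P D n γ s)))) • openVec D n (incr γ r))]
  have hshift : ∀ r, ∑ γ, (boundaryQ P D γ σ * (hopCoeff P D γ r * ∏ s ∈ Finset.univ.erase r,
      (symVar N P z - symVar N P (node P D n γ s)))) • openVec D n (incr γ r) =
      ∑ γ, (boundaryQ P D (decr γ r) σ * (hopCoeff P D (decr γ r) r *
        ∏ s ∈ Finset.univ.erase r,
          (symVar N P z - symVar N P (node P D n (decr γ r) s)))) • openVec D n γ := by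
    intro r
    rw [← sum_comp_decr _ r]
    simp only [incr_decr]
  simp only [hshift]
  rw [Finset.sum_comm, ← Finset.sum_add_distrib]
  refine Finset.sum_congr rfl fun γ _ => ?_
  rw [← Finset.sum_smul, ← add_smul, ← boundaryQ_eigen hD hbd hgen hP γ σ (symVar N P z)]
  congr 1
  congr 1
  · ring
  · exact Finset.sum_congr rfl fun r _ => by ring

end sov

/-! ### Linear independence of the eigenvectors -/

section independence

/-- The argument for eigenvectors with distinct eigenvalues, except that each pair may be separated
by a different operator: O x - e x a removes the a-th term and, for x chosen to separate i from a,
keeps the i-th one. -/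
theorem linearIndependent_of_separating {ι κ V : Type*} [AddCommGroup V] [Module ℂ V]
    (O : κ → Module.End ℂ V) (e : κ → ι → ℂ) (ψ : ι → V) (h0 : ∀ i, ψ i ≠ 0)
    (h : ∀ x i, O x (ψ i) = e x i • ψ i) (hsep : ∀ i j, i ≠ j → ∃ x, e x i ≠ e x j) :
    LinearIndependent ℂ ψ := by
  classical
  rw [linearIndependent_iff']
  intro s
  induction s using Finset.induction_on with
  | empty => simp
  | insert a s ha ih =>
    intro c hc
    have hs : ∀ i ∈ s, c i = 0 := by
      intro i hi
      obtain ⟨x, hx⟩ := hsep i a (fun hia => ha (hia ▸ hi))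
      have h1 := congrArg (O x) hc
      rw [map_zero, map_sum, Finset.sum_insert ha] at h1
      rw [Finset.sum_insert ha] at hc
      have h2 := ih (fun i => c i * (e x i - e x a)) (by
        have h3 := congrArg (e x a • ·) hc
        simp only [smul_zero, smul_add, Finset.smul_sum] at h3
        rw [← sub_eq_zero.2 (h1.trans h3.symm)]
        simp only [map_smul, h, smul_smul, mul_sub, sub_smul, Finset.sum_sub_distrib]
        simp only [mul_comm (e x a)]
        abel) i hi
      exact (mul_eq_zero.1 h2).resolve_right (sub_ne_zero.2 hx)
    rw [Finset.sum_insert ha, Finset.sum_eq_zero fun i hi => by rw [hs i hi, zero_smul],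
      add_zero] at hc
    intro i hi
    rcases Finset.mem_insert.1 hi with rfl | hi
    · exact (smul_eq_zero.1 hc).resolve_right (h0 _)
    · exact hs i hi

variable {N n : ℕ} [NeZero N] {P : Params} {D : Amplitudes n}

/-- There are as many labels as basis states. -/
theorem span_eq_top_of_linearIndependent {ψ : (Fin n → ZMod N) → States N n}
    (h : LinearIndependent ℂ ψ) : Submodule.span ℂ (Set.range ψ) = ⊤ :=
  h.span_eq_top_of_card_eq_finrank (by rw [Module.finrank_fintype_fun_eq_card])

theorem mu_mul_openQ_ne_zero (hD : D.IsOpen N P) {m : ℕ} (hm : m + 1 ≤ n) (γ : Fin m → ZMod N)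
    (γ' : Fin (m + 1) → ZMod N) : mu D m γ * openQ D m γ γ' ≠ 0 := by
  refine mul_ne_zero ?_ (div_ne_zero (omegaPow_ne_zero _) ?_)
  · refine Finset.prod_ne_zero_iff.2 fun j _ => Finset.prod_ne_zero_iff.2 fun l hl => ?_
    exact cyc_ne_zero (hD.fermat m (by omega) m (by omega) j l)
      (hD.y_same_ne hm (Finset.ne_of_mem_erase hl).symm) _
  · refine Finset.prod_ne_zero_iff.2 fun k _ => Finset.prod_ne_zero_iff.2 fun l _ => ?_
    exact cyc_ne_zero (hD.fermat m (by omega) (m + 1) hm l k) (hD.y_next_ne hm l k) _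

/-- If γ and δ differ at r, then A at the r-th node of γ annihilates |γ⟩ but not |δ⟩, since equal
nodes must agree in position and label. -/
theorem openVec_linearIndependent_of_ne_zero (hD : D.IsOpen N P) (hP : P.Nondegenerate)
    (hgen : ∀ r r', r ≠ r' → D.v n r ^ N ≠ D.v n r' ^ N) {m : ℕ} (hm : m ≤ n)
    (hne : ∀ γ, openVec (N := N) D m γ ≠ 0) : LinearIndependent ℂ (openVec (N := N) D m) := by
  refine linearIndependent_of_separating (fun z : {z : ℂ // z ≠ 0} => openMon P m z 0 0) _ _ hne
    (fun z γ => (openMon_openVec hD hP hgen m hm z.2).1 γ) fun γ δ hγδ => ?_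
  obtain ⟨r, hr⟩ := Function.ne_iff.1 hγδ
  have hr0 := node_ne_zero hD hP hm γ r
  refine ⟨⟨node P D m γ r, hr0⟩, ?_⟩
  rw [Finset.prod_eq_zero (Finset.mem_univ r) (by
    rw [mul_one_div, div_self hr0, sub_self])]
  refine (Finset.prod_ne_zero_iff.2 fun s _ h0 => ?_).symm
  rw [mul_one_div, sub_eq_zero, eq_div_iff hr0, one_mul] at h0
  have h1 := congrArg (· ^ N) h0
  simp only [node_pow] at h1
  have h2 := mul_left_cancel₀ (pow_ne_zero _ (neg_ne_zero.2 hP.κ_ne)) h1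
  by_cases hrs : r = s
  · subst hrs
    rw [node, node] at h0
    exact hr (omegaPow_injective (mul_left_cancel₀
      (mul_ne_zero (neg_ne_zero.2 hP.κ_ne) (hD.v_ne hP hm r)) h0))
  · exact Amplitudes.v_pow_ne hD hP hgen hm hrs h2

theorem openVec_ne_zero (hD : D.IsOpen N P) (hP : P.Nondegenerate)
    (hgen : ∀ r r', r ≠ r' → D.v n r ^ N ≠ D.v n r' ^ N) (m : ℕ) (hm : m ≤ n)
    (γ' : Fin m → ZMod N) : openVec D m γ' ≠ 0 := by
  induction m with
  | zero => exact fun h => one_ne_zero (congrFun h 0)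
  | succ m ih =>
    intro h
    have hli := openVec_linearIndependent_of_ne_zero hD hP hgen (by omega) (ih (by omega))
    -- The component of |γ'⟩ with last spin ∑γ' involves exactly the γ with ∑γ = 0. The label γ = 0
    -- is among them, with nonzero coefficient, so independence on level m gives a contradiction.
    have hsum : ∑ γ : Fin m → ZMod N, (if ∑ k, γ' k = ∑ k, γ' k - ∑ l, γ l then
        mu D m γ * openQ D m γ γ' else 0) • openVec D m γ = 0 := by
      funext τ
      have h1 := congrFun h (Fin.snoc τ (∑ k, γ' k))
      simp only [openVec, Fin.snoc_castSucc, Fin.snoc_last, Pi.zero_apply] at h1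
      rw [Finset.sum_apply]
      refine Eq.trans (Finset.sum_congr rfl fun γ _ => ?_) h1
      simp only [Pi.smul_apply, smul_eq_mul]
      split_ifs <;> ring
    have h2 := linearIndependent_iff'.1 hli Finset.univ _ hsum 0 (Finset.mem_univ _)
    simp only [Pi.zero_apply, Finset.sum_const_zero, sub_zero, if_true] at h2
    exact mu_mul_openQ_ne_zero hD hm 0 γ' h2

theorem openVec_linearIndependent (hD : D.IsOpen N P) (hP : P.Nondegenerate)
    (hgen : ∀ r r', r ≠ r' → D.v n r ^ N ≠ D.v n r' ^ N) :
    LinearIndependent ℂ (openVec (N := N) D n) :=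
  openVec_linearIndependent_of_ne_zero hD hP hgen le_rfl (openVec_ne_zero hD hP hgen n le_rfl)

theorem boundaryQ_ne_zero (hD : D.IsOpen N P) (hbd : D.IsBoundary N P)
    (hgen : D.IsGeneric N P) (hP : P.Nondegenerate) (γ σ : Fin n → ZMod N) :
    boundaryQ P D γ σ ≠ 0 := by
  refine mul_ne_zero (mul_ne_zero (Finset.prod_ne_zero_iff.2 fun r _ => omegaPow_ne_zero _)
    (Finset.prod_ne_zero_iff.2 fun k _ => Finset.prod_ne_zero_iff.2 fun r _ => ?_))
    (Finset.prod_ne_zero_iff.2 fun r _ => Finset.prod_ne_zero_iff.2 fun s hs => ?_)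
  · obtain ⟨h1, h2⟩ := hbd.yB_ne hD hgen hP r k
    exact mul_ne_zero (cyc_ne_zero (hbd.fermat_B r k) h1 _) (cyc_ne_zero (hbd.fermat_tB r k) h2 _)
  · have hrs : r ≠ s := (Finset.mem_Ioi.1 hs).ne
    refine div_ne_zero (fun h0 => hrs (node_injective hD hP hgen.v_pow_ne le_rfl γ ?_))
      (cyc_ne_zero (hbd.fermat_t r s hrs) (hgen.yt_ne r s hrs) _)
    rw [node, node]
    linear_combination -P.κ * h0

theorem psi_ne_zero (hD : D.IsOpen N P) (hbd : D.IsBoundary N P)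
    (hgen : D.IsGeneric N P) (hP : P.Nondegenerate) (σ : Fin n → ZMod N) : psi P D σ ≠ 0 :=
  fun h => boundaryQ_ne_zero hD hbd hgen hP 0 σ (linearIndependent_iff'.1
    (openVec_linearIndependent hD hP hgen.v_pow_ne) Finset.univ _ h 0 (Finset.mem_univ _))

/-- Passing to N-th powers removes the labels and the root of unity. With c a power of ω this keeps
the prefactor and all denominators away from zero at the separated variables. -/
theorem lam_mul_lam_ne (hgen : D.IsGeneric N P) (k l : Fin n) (a b : ZMod N) {c : ℂ}
    (hc : c ^ N = 1) : lam P D k a * lam P D l b ≠ c * P.θ := by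
  intro h
  refine hgen.s_mul_pow_ne k l ?_
  have h2 := congrArg (· ^ N) h
  simp only [mul_pow, hc, one_mul, lam, omegaPow_pow_self] at h2
  rw [← h2]
  have : (-P.κ) ^ N * (-P.κ) ^ N = P.κ ^ N * P.κ ^ N := by rw [← mul_pow, ← mul_pow, neg_mul_neg]
  simp only [mul_pow]
  linear_combination -(D.s k ^ N * D.s l ^ N) * this

theorem lam_inj (hbd : D.IsBoundary N P) (hgen : D.IsGeneric N P) (hP : P.Nondegenerate)
    {k l : Fin n} {a b : ZMod N} (h : lam P D k a = lam P D l b) : k = l ∧ a = b := by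
  have hkl : k = l := by
    by_contra hkl
    have h1 := congrArg (· ^ N) h
    simp only [lam_pow] at h1
    exact hgen.s_pow_ne k l hkl (mul_left_cancel₀ (pow_ne_zero _ (neg_ne_zero.2 hP.κ_ne)) h1)
  subst hkl
  exact ⟨rfl, omegaPow_injective (mul_left_cancel₀
    (mul_ne_zero (neg_ne_zero.2 hP.κ_ne) (hbd.s_ne k)) h)⟩

theorem symVar_lam_inj (hbd : D.IsBoundary N P) (hgen : D.IsGeneric N P) (hP : P.Nondegenerate)
    {k l : Fin n} {a b : ZMod N} (h : symVar N P (lam P D k a) = symVar N P (lam P D l b)) :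
    k = l ∧ a = b := by
  have h1 := lam_ne_zero hP hbd k a
  have h2 := lam_ne_zero hP hbd l b
  have h3 := symVar_sub (N := N) (P := P) h1 h2
  rw [h, sub_self] at h3
  rcases mul_eq_zero.1 h3.symm with h4 | h4
  · exact lam_inj hbd hgen hP (sub_eq_zero.1 h4)
  · refine absurd ?_ (lam_mul_lam_ne hgen k l a b (omega_pow_self N))
    rw [sub_eq_zero, eq_div_iff (mul_ne_zero h1 h2), one_mul] at h4
    exact h4

theorem theta_div_lam_sub_ne (hbd : D.IsBoundary N P) (hgen : D.IsGeneric N P)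
    (hP : P.Nondegenerate) (k : Fin n) (a : ZMod N) {c : ℂ} (hc : c ^ N = 1) :
    c * P.θ / lam P D k a - lam P D k a ≠ 0 := by
  intro h
  refine lam_mul_lam_ne hgen k k a a hc ?_
  rw [sub_eq_zero, div_eq_iff (lam_ne_zero hP hbd k a)] at h
  exact h.symm

/-- If σ and τ differ at r, then U₀₀ at λ_r(σ_r) annihilates Ψ_σ but not Ψ_τ. -/
theorem psi_linearIndependent (hD : D.IsOpen N P) (hbd : D.IsBoundary N P)
    (hgen : D.IsGeneric N P) (hP : P.Nondegenerate) :
    LinearIndependent ℂ (psi (N := N) P D) := by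
  refine linearIndependent_of_separating (fun z : {z : ℂ // z ≠ 0} => monodromy P z 0 0) _ _
    (psi_ne_zero hD hbd hgen hP) (fun z σ => monodromy_00_psi hD hbd hgen hP σ z.2)
    fun σ τ hστ => ?_
  obtain ⟨r, hr⟩ := Function.ne_iff.1 hστ
  refine ⟨⟨lam P D r (σ r), lam_ne_zero hP hbd r (σ r)⟩, ?_⟩
  rw [Finset.prod_eq_zero (Finset.mem_univ r) (sub_self _), mul_zero, mul_zero]
  refine (mul_ne_zero ?_ (mul_ne_zero (mul_ne_zero hP.αm_ne (pow_ne_zero _ hP.κ_ne))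
    (Finset.prod_ne_zero_iff.2 fun k _ h0 => ?_))).symm
  · simpa using theta_div_lam_sub_ne hbd hgen hP r (σ r) (one_pow N)
  · obtain ⟨rfl, h⟩ := symVar_lam_inj hbd hgen hP (sub_eq_zero.1 h0)
    exact hr h

end independence

/-! ### The shift operators of the separated variables -/

section shift
variable {N n : ℕ} [NeZero N] {P : Params} {D : Amplitudes n}

/-- A is diagonal in the basis |γ⟩ with nonzero eigenvalues. This allows A to be cancelled from both
sides of an equation between vectors. -/
theorem openMon_00_injective (hD : D.IsOpen N P) (hP : P.Nondegenerate)
    (hgen : ∀ r r', r ≠ r' → D.v n r ^ N ≠ D.v n r' ^ N) {w : ℂ} (hw : w ≠ 0)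
    (h : ∀ (γ : Fin n → ZMod N) r, 1 - node P D n γ r * (1 / w) ≠ 0) :
    Function.Injective (openMon P n w 0 0 : Module.End ℂ (States N n)) := by
  rw [LinearMap.injective_iff_surjective, ← LinearMap.range_eq_top, eq_top_iff,
    ← span_eq_top_of_linearIndependent (openVec_linearIndependent hD hP hgen),
    Submodule.span_le]
  rintro _ ⟨γ, rfl⟩
  have hp : ∏ r, (1 - node P D n γ r * (1 / w)) ≠ 0 := Finset.prod_ne_zero_iff.2 fun r _ => h γ r
  refine ⟨(∏ r, (1 - node P D n γ r * (1 / w)))⁻¹ • openVec D n γ, ?_⟩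
  rw [map_smul, (openMon_openVec hD hP hgen n le_rfl hw).1, smul_smul, inv_mul_cancel₀ hp,
    one_smul]

/-- The relation between the third and the first entry of the one-boundary monodromy matrix. -/
theorem openMon_mul_monodromy_10 (hP : P.Nondegenerate) {z : ℂ} (hz : z ≠ 0) :
    (openMon P n (P.θ / z) 0 1 * monodromy P z 0 0 + openMon P n (P.θ / z) 0 0 * monodromy P z 1 0 :
      Module.End ℂ (States N n)) = (z ^ n * P.ηm) • openMon P n z 0 0 := by
  have h := openMon_mul_openMonTilde (N := N) hP n hz
  have h2 := congrArg (fun M : Matrix (Fin 2) (Fin 2) (Module.End ℂ (States N n)) => (M * kMinus P z * openMon P n z :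
    Matrix (Fin 2) (Fin 2) (Module.End ℂ (States N n))) 0 0) h
  simp only [Matrix.mul_assoc] at h2
  rw [← Matrix.mul_assoc (openMonTilde P n z), ← monodromy_eq] at h2
  simp only [Matrix.mul_apply, Fin.sum_univ_two, Matrix.smul_apply, kMinus, Matrix.of_apply,
    Matrix.cons_val_zero, Matrix.cons_val_one, Matrix.cons_val', Matrix.cons_val_fin_one,
    mul_zero, zero_mul, one_mul, smul_zero, zero_add, add_zero, mul_add,
    smul_mul_assoc, smul_smul] at h2
  rw [← h2, add_comm]

/-- When σ_k is raised, the argument of w_{p^B} falls by one and that of w_{p̃^B} rises by one. The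
resulting factors are those of the eigenvalues of A at λ_k and at θ/λ_k, so summation over γ gives a
relation between vectors. -/
theorem boundaryQ_incr_label (hD : D.IsOpen N P) (hbd : D.IsBoundary N P)
    (hgen : D.IsGeneric N P) (hP : P.Nondegenerate) (γ σ : Fin n → ZMod N) (k : Fin n) :
    lam P D k (σ k) ^ n * (∏ r, (1 - node P D n γ r * (1 / lam P D k (σ k)))) *
        boundaryQ P D γ σ =
      fCoeff P D k (σ k) * (∏ r, (1 - node P D n γ r * (1 / (P.θ / lam P D k (σ k))))) *
        boundaryQ P D γ (incr σ k) := by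
  have hθ := hP.θ_ne
  have hω := omega_ne_zero N
  have hl := lam_ne_zero (N := N) hP hbd k (σ k)
  have hf : ∀ r, lam P D k (σ k) * (1 - node P D n γ r * (1 / lam P D k (σ k))) *
      (cyc (D.xB r k) (D.yB r k) (γ r - σ k) *
        cyc (D.xtB N P r k) (D.ytB r k) (γ r + σ k)) =
      lam P D k (σ k) * D.yB r k / D.ytB r k *
        (1 - node P D n γ r * (1 / (P.θ / lam P D k (σ k)))) *
      (cyc (D.xB r k) (D.yB r k) (γ r - incr σ k k) *
        cyc (D.xtB N P r k) (D.ytB r k) (γ r + incr σ k k)) := by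
    intro r
    obtain ⟨h1, h2⟩ := hbd.yB_ne hD hgen hP r k
    have d2 := one_sub_mul_omegaPow_ne_zero (hbd.fermat_tB r k) h2 (γ r + incr σ k k)
    rw [xtB_mul, incr_same, lam_add_one] at d2
    have e1 : γ r - incr σ k k = γ r - σ k - 1 := by rw [incr_same]; ring
    have e2 : γ r + incr σ k k - 1 = γ r + σ k := by rw [incr_same]; ring
    rw [cyc_eq_sub_one (hbd.fermat_tB r k) h2 (γ r + incr σ k k), e1, e2,
      cyc_sub_one (hbd.fermat_B r k) h1 (γ r - σ k), xB_mul hP, xtB_mul, incr_same, lam_add_one]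
    have e3 : node P D n γ r * (omega N * lam P D k (σ k)) / (omega N * P.θ) =
        node P D n γ r * (1 / (P.θ / lam P D k (σ k))) := by field_simp
    rw [e3] at d2 ⊢
    rw [mul_one_div (node P D n γ r) (lam P D k (σ k))]
    generalize 1 - node P D n γ r * (1 / (P.θ / lam P D k (σ k))) = X at *
    generalize 1 - node P D n γ r / lam P D k (σ k) = Y at *
    field_simp
  have hp := Finset.prod_congr rfl fun r (_ : r ∈ Finset.univ) => hf r
  have e : ∀ τ : Fin n → ZMod N, (∏ l, ∏ r, cyc (D.xB r l) (D.yB r l) (γ r - τ l) *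
      cyc (D.xtB N P r l) (D.ytB r l) (γ r + τ l)) =
      (∏ r, cyc (D.xB r k) (D.yB r k) (γ r - τ k) *
        cyc (D.xtB N P r k) (D.ytB r k) (γ r + τ k)) *
      ∏ l ∈ Finset.univ.erase k, ∏ r, cyc (D.xB r l) (D.yB r l) (γ r - τ l) *
        cyc (D.xtB N P r l) (D.ytB r l) (γ r + τ l) := fun τ =>
    (Finset.mul_prod_erase Finset.univ _ (Finset.mem_univ k)).symm
  have e' : ∏ l ∈ Finset.univ.erase k, ∏ r, cyc (D.xB r l) (D.yB r l) (γ r - incr σ k l) *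
        cyc (D.xtB N P r l) (D.ytB r l) (γ r + incr σ k l) =
      ∏ l ∈ Finset.univ.erase k, ∏ r, cyc (D.xB r l) (D.yB r l) (γ r - σ l) *
        cyc (D.xtB N P r l) (D.ytB r l) (γ r + σ l) :=
    Finset.prod_congr rfl fun l hl => by rw [incr_of_ne σ (Finset.ne_of_mem_erase hl)]
  rw [boundaryQ, boundaryQ, e, e (incr σ k), e', fCoeff]
  simp only [Finset.prod_mul_distrib, Finset.prod_div_distrib, Finset.prod_const,
    Finset.card_univ, Fintype.card_fin] at hp ⊢
  linear_combination (∏ r, omegaPow (γ r ^ 2 + γ r)) *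
    ((∏ l ∈ Finset.univ.erase k, ∏ r, cyc (D.xB r l) (D.yB r l) (γ r - σ l)) *
      ∏ l ∈ Finset.univ.erase k, ∏ r, cyc (D.xtB N P r l) (D.ytB r l) (γ r + σ l)) *
    ((∏ r, ∏ r' ∈ Finset.Ioi r, (D.v n r * omegaPow (γ r) - D.v n r' * omegaPow (γ r'))) /
      ∏ r, ∏ r' ∈ Finset.Ioi r, cyc (D.xt N P r r') (D.yt r r') (γ r + γ r')) * hp

theorem fCoeff_ne_zero (hD : D.IsOpen N P) (hbd : D.IsBoundary N P)
    (hgen : D.IsGeneric N P) (hP : P.Nondegenerate) (k : Fin n) (a : ZMod N) :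
    fCoeff P D k a ≠ 0 := by
  refine Finset.prod_ne_zero_iff.2 fun r _ => ?_
  obtain ⟨h1, h2⟩ := hbd.yB_ne hD hgen hP r k
  exact div_ne_zero (mul_ne_zero (lam_ne_zero hP hbd k a) h1) h2

theorem fCoeff_sub_one (P : Params) (D : Amplitudes n) (k : Fin n) (a : ZMod N) :
    fCoeff P D k (a - 1) = fCoeff P D k a / omega N ^ n := by
  have e : ∀ r, lam P D k (a - 1) * D.yB r k / D.ytB r k =
      lam P D k a * D.yB r k / D.ytB r k / omega N := fun r => by rw [lam_sub_one]; ring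
  rw [fCoeff, Finset.prod_congr rfl fun r _ => e r, Finset.prod_div_distrib, fCoeff]
  simp

theorem openMon_00_psi_incr (hD : D.IsOpen N P) (hbd : D.IsBoundary N P)
    (hgen : D.IsGeneric N P) (hP : P.Nondegenerate) (σ : Fin n → ZMod N) (k : Fin n) :
    lam P D k (σ k) ^ n • openMon P n (lam P D k (σ k)) 0 0 (psi P D σ) =
      fCoeff P D k (σ k) • openMon P n (P.θ / lam P D k (σ k)) 0 0 (psi P D (incr σ k)) := by
  have hl := lam_ne_zero (N := N) hP hbd k (σ k)
  have hl' : P.θ / lam P D k (σ k) ≠ 0 := div_ne_zero hP.θ_ne hl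
  simp only [psi, map_sum, map_smul, (openMon_openVec hD hP hgen.v_pow_ne n le_rfl hl).1,
    (openMon_openVec hD hP hgen.v_pow_ne n le_rfl hl').1, Finset.smul_sum, smul_smul]
  refine Finset.sum_congr rfl fun γ _ => ?_
  congr 1
  linear_combination boundaryQ_incr_label hD hbd hgen hP γ σ k

/-- U₀₀(λ_k) annihilates Ψ_σ, so A(θ/λ_k)U₁₀(λ_k)Ψ_σ = η₋λ_kⁿA(λ_k)Ψ_σ. The right side is also
A(θ/λ_k) of a multiple of Ψ_{σ+e_k}, and A(θ/λ_k) is injective. -/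
theorem monodromy_10_psi_lam (hD : D.IsOpen N P) (hbd : D.IsBoundary N P)
    (hgen : D.IsGeneric N P) (hP : P.Nondegenerate) (σ : Fin n → ZMod N) (k : Fin n) :
    monodromy P (lam P D k (σ k)) 1 0 (psi P D σ) =
      (P.ηm * fCoeff P D k (σ k)) • psi P D (incr σ k) := by
  have hl := lam_ne_zero (N := N) hP hbd k (σ k)
  have hl' : P.θ / lam P D k (σ k) ≠ 0 := div_ne_zero hP.θ_ne hl
  have hθ := hP.θ_ne
  have hω := omega_ne_zero N
  refine openMon_00_injective hD hP hgen.v_pow_ne hl' (fun γ r => ?_) ?_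
  · obtain ⟨h1, h2⟩ := hbd.yB_ne hD hgen hP r k
    have d2 := one_sub_mul_omegaPow_ne_zero (hbd.fermat_tB r k) h2 (γ r + (σ k + 1))
    rw [xtB_mul, lam_add_one] at d2
    convert d2 using 2
    field_simp
  · have h := congrArg (fun O : Module.End ℂ (States N n) => O (psi P D σ))
      (openMon_mul_monodromy_10 (N := N) (n := n) hP hl)
    simp only [LinearMap.add_apply, Module.End.mul_apply, LinearMap.smul_apply] at h
    rw [monodromy_00_psi hD hbd hgen hP σ hl,
      Finset.prod_eq_zero (Finset.mem_univ k) (sub_self _), mul_zero, mul_zero, zero_smul,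
      map_zero, zero_add] at h
    rw [h, map_smul, mul_smul P.ηm, ← openMon_00_psi_incr hD hbd hgen hP, smul_smul,
      mul_comm P.ηm]

/-- Since Λ is invariant under z ↦ ωθ/z, U₀₀ annihilates Ψ_σ at ωθ/λ_k as well. Now θ/z equals
λ_k/ω, the separated variable for σ_k - 1, so the relation between neighbours is used at σ - e_k. -/
theorem monodromy_10_psi_dual (hD : D.IsOpen N P) (hbd : D.IsBoundary N P)
    (hgen : D.IsGeneric N P) (hP : P.Nondegenerate) (σ : Fin n → ZMod N) (k : Fin n) :
    monodromy P (omega N * P.θ / lam P D k (σ k)) 1 0 (psi P D σ) =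
      (P.ηm * (omega N * P.θ) ^ n * (fCoeff P D k (σ k))⁻¹) • psi P D (decr σ k) := by
  have hl := lam_ne_zero (N := N) hP hbd k (σ k)
  have hθ := hP.θ_ne
  have hω := omega_ne_zero N
  have hz : omega N * P.θ / lam P D k (σ k) ≠ 0 := div_ne_zero (mul_ne_zero hω hθ) hl
  have hf := fCoeff_ne_zero hD hbd hgen hP k (σ k)
  have e1 : P.θ / (omega N * P.θ / lam P D k (σ k)) = lam P D k (decr σ k k) := by
    rw [decr_same, lam_sub_one]
    field_simp
  have e2 : P.θ / lam P D k (decr σ k k) = omega N * P.θ / lam P D k (σ k) := by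
    rw [decr_same, lam_sub_one]
    field_simp
  refine openMon_00_injective hD hP hgen.v_pow_ne (div_ne_zero hθ hz) (fun γ r => ?_) ?_
  · obtain ⟨h1, h2⟩ := hbd.yB_ne hD hgen hP r k
    have d2 := one_sub_mul_omegaPow_ne_zero (hbd.fermat_B r k) h1 (γ r - decr σ k k)
    rwa [xB_mul hP, ← mul_one_div, ← e1] at d2
  · have h := congrArg (fun O : Module.End ℂ (States N n) => O (psi P D σ))
      (openMon_mul_monodromy_10 (N := N) (n := n) hP hz)
    simp only [LinearMap.add_apply, Module.End.mul_apply, LinearMap.smul_apply] at h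
    rw [monodromy_00_psi hD hbd hgen hP σ hz, symVar_inv hP hl,
      Finset.prod_eq_zero (Finset.mem_univ k) (sub_self _), mul_zero, mul_zero, zero_smul,
      map_zero, zero_add] at h
    have h2 := openMon_00_psi_incr hD hbd hgen hP (decr σ k) k
    rw [incr_decr, e2] at h2
    have h3 := congrArg (fun ψ : States N n => ((omega N * P.θ / lam P D k (σ k)) ^ n * P.ηm *
      (fCoeff P D k (decr σ k k))⁻¹) • ψ) h2
    simp only [smul_smul] at h3
    rw [h, map_smul, e1]
    have hf' : fCoeff P D k (decr σ k k) ≠ 0 := fCoeff_ne_zero hD hbd hgen hP k _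
    rw [inv_mul_cancel_right₀ hf'] at h3
    rw [← h3]
    congr 1
    rw [decr_same, lam_sub_one, fCoeff_sub_one]
    simp only [div_pow, mul_pow]
    field_simp

end shift

/-! ### The transfer matrix in the separated variables -/

section transferAction
variable {N n : ℕ} [NeZero N] {P : Params} {D : Amplitudes n}

/-- The η₋ parts of U₁₀ at z and at ωθ/z balance p_n. This removes the Ψ_σ term from t(λ_k)Ψ_σ. -/
theorem edge_dual (hP : P.Nondegenerate) {z : ℂ} (hz : z ≠ 0) (n : ℕ) :
    omega N * (P.θ / z - z) * (edge P (omega N * P.θ / z) n).2 +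
        (omega N ^ 2 * P.θ / z - z) * (edge P z n).2 +
        (z - omega N * P.θ / z) * pPoly N n P z = 0 := by
  have hω := omega_ne_zero N
  have hθ := hP.θ_ne
  have hν : omega N * P.θ / z ≠ 0 := div_ne_zero (mul_ne_zero hω hθ) hz
  rw [← edge_pPoly P hz]
  induction n using Nat.twoStepInduction with
  | zero =>
    simp only [edge]
    field_simp
    ring
  | one =>
    simp only [edge]
    field_simp
    ring
  | more n ih _ =>
    rw [edge_add_two P hz, edge_add_two P hν]
    linear_combination P.θ * ih

theorem prefactor_eq (hP : P.Nondegenerate) (n : ℕ) {z : ℂ} (hz : z ≠ 0) :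
    prefactor N n P z =
      (omega N ^ 2 * P.θ / z - z) * (P.θ / z - z) * (P.αp * P.αm * P.κ ^ n) := by
  have hθ := hP.θ_ne
  rw [prefactor]
  field_simp
  ring

/-- Here β and χ stand for bΨ_σ and cΨ_σ, which are the same at l = λ_k and at ν = ωθ/λ_k. The two
values of U₁₀ give two linear equations for them, and the elimination of χ leaves the vector β that
occurs in t. -/
theorem eliminate_entry {V : Type*} [AddCommGroup V] [Module ℂ V] {β χ ψ φ φ' : V}
    {p s l ν ηm ηp q e e' c f g : ℂ} (hlν : l - ν ≠ 0)
    (h1 : p • (l • β - q • χ) + (ηm * e) • ψ = (ηm * f) • φ)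
    (h2 : s • (ν • β - q • χ) + (ηm * e') • ψ = (ηm * g) • φ')
    (he : q * p * e' - q * s * e + (l - ν) * c = 0) :
    (q * s * p * ηp) • β + (ηp * ηm * c) • ψ =
      (ηp * ηm * (q * s / (l - ν)) * f) • φ - (ηp * ηm * (q * p / (l - ν)) * g) • φ' := by
  have hi : (l - ν) * (l - ν)⁻¹ = 1 := mul_inv_cancel₀ hlν
  rw [div_eq_mul_inv, div_eq_mul_inv]
  generalize (l - ν)⁻¹ = i at hi ⊢
  linear_combination (norm := module) (ηp * q * s * i) • h1 - (ηp * q * p * i) • h2 -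
    ((q * s * p * ηp) * hi) • β - ((ηp * ηm * c) * hi) • ψ + (ηp * ηm * i * he) • ψ

/-- The polynomial a annihilates Ψ_σ at λ_k because U₀₀ does and θ/λ_k - λ_k ≠ 0. Only b and p_n are
left in t, and they follow from U₁₀ at λ_k and ωθ/λ_k. -/
theorem transfer_psi_lam (hD : D.IsOpen N P) (hbd : D.IsBoundary N P)
    (hgen : D.IsGeneric N P) (hP : P.Nondegenerate) (σ : Fin n → ZMod N) (k : Fin n) :
    transfer P (lam P D k (σ k)) (psi P D σ) =
      (P.ηp * P.ηm * ((lam P D k (σ k) ^ 2 - omega N ^ 2 * P.θ) /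
          (lam P D k (σ k) ^ 2 - omega N * P.θ)) * fCoeff P D k (σ k)) • psi P D (incr σ k) -
        (P.ηp * P.ηm * (omega N * (P.θ - lam P D k (σ k) ^ 2) /
          (lam P D k (σ k) ^ 2 - omega N * P.θ)) * ((omega N * P.θ) ^ n *
            (fCoeff P D k (σ k))⁻¹)) • psi P D (decr σ k) := by
  have hl := lam_ne_zero (N := N) hP hbd k (σ k)
  have hθ := hP.θ_ne
  have hω := omega_ne_zero N
  have hν : omega N * P.θ / lam P D k (σ k) ≠ 0 := div_ne_zero (mul_ne_zero hω hθ) hl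
  obtain ⟨a, b, c, -, -, -, h⟩ := transfer_poly (N := N) hP n
  obtain ⟨h00, h10, ht⟩ := h _ hl
  obtain ⟨-, h10', -⟩ := h _ hν
  have hx := symVar_inv (N := N) hP hl
  rw [symVar, symVar] at hx
  rw [hx] at h10'
  have hp0 := theta_div_lam_sub_ne hbd hgen hP k (σ k) (one_pow N)
  have hν0 := theta_div_lam_sub_ne hbd hgen hP k (σ k) (omega_pow_self N)
  rw [one_mul] at hp0
  have ha := monodromy_00_psi hD hbd hgen hP σ hl
  rw [Finset.prod_eq_zero (Finset.mem_univ k) (sub_self _), mul_zero, mul_zero, zero_smul, h00,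
    LinearMap.smul_apply] at ha
  have ha0 := (smul_eq_zero.1 ha).resolve_left hp0
  have h1 := monodromy_10_psi_lam hD hbd hgen hP σ k
  have h2 := monodromy_10_psi_dual hD hbd hgen hP σ k
  rw [h10] at h1
  rw [h10', mul_assoc] at h2
  simp only [LinearMap.add_apply, LinearMap.smul_apply, LinearMap.sub_apply,
    Module.End.one_apply] at h1 h2
  rw [ht]
  simp only [LinearMap.add_apply, LinearMap.smul_apply, LinearMap.sub_apply,
    Module.End.one_apply, ha0, smul_zero, zero_sub]
  have hd : lam P D k (σ k) ^ 2 - omega N * P.θ ≠ 0 := by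
    intro h0
    refine hν0 ?_
    field_simp
    linear_combination -h0
  have hd' : lam P D k (σ k) - omega N * P.θ / lam P D k (σ k) ≠ 0 := by
    rw [← neg_sub]
    exact neg_ne_zero.2 hν0
  have e0 := edge_dual (N := N) hP hl n
  -- The factor θ/z - z at the reflected point is, up to -1/ω, the factor ω²θ/z - z of the transfer
  -- matrix at λ_k.
  have es : P.θ / (omega N * P.θ / lam P D k (σ k)) - omega N * P.θ / lam P D k (σ k) =
      -(omega N ^ 2 * P.θ / lam P D k (σ k) - lam P D k (σ k)) / omega N := by
    field_simp
    ring
  have hfin := eliminate_entry (ηp := P.ηp) (c := pPoly N n P (lam P D k (σ k))) hd' h1 h2 (by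
    rw [es]
    field_simp
    field_simp at e0
    linear_combination e0)
  refine Eq.trans ?_ (hfin.trans ?_)
  · rw [es]
    generalize b _ (psi P D σ) = β
    match_scalars
    · field_simp
    · ring
  · rw [es]
    congr 2
    · field_simp
      ring
    · field_simp

/-- The polynomial `x^n + ∑ H_j x^{n-j}`. -/
def hamPoly {V : Type*} [AddCommGroup V] [Module ℂ V] (e : V) (H : Fin n → V) (x : ℂ) : V :=
  x ^ n • e + ∑ j : Fin n, x ^ (n - 1 - (j : ℕ)) • H j

/-- The polynomial α₊a - η₊b has the scalar leading coefficient α₊α₋κⁿ; its lower coefficients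
divided by this number, in the order of falling powers, are the Hamiltonians. -/
theorem exists_isHamiltonians (hP : P.Nondegenerate) :
    ∃ H : Fin n → Module.End ℂ (States N n), IsHamiltonians P H := by
  obtain ⟨a, b, c', ha, hb, -, h⟩ := transfer_poly (N := N) hP n
  obtain ⟨c, hc⟩ := (ha.smul P.αp).sub (hb.smul P.ηp)
  have h0 : P.αp * P.αm * P.κ ^ n ≠ 0 :=
    mul_ne_zero (mul_ne_zero hP.αp_ne hP.αm_ne) (pow_ne_zero _ hP.κ_ne)
  refine ⟨fun j => (P.αp * P.αm * P.κ ^ n)⁻¹ • c (n - 1 - (j : ℕ)), fun z hz => ?_⟩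
  rw [(h z hz).2.2, prefactor_eq hP n hz, mul_smul _ (P.αp * P.αm * P.κ ^ n)]
  congr 2
  have h2 := hc (z + omega N * P.θ / z)
  rw [Finset.sum_range, ← Equiv.sum_comp Fin.revPerm] at h2
  have e : ∑ j : Fin n, (z + omega N * P.θ / z) ^ (n - 1 - (j : ℕ)) •
      (P.αp * P.αm * P.κ ^ n)⁻¹ • c (n - 1 - (j : ℕ)) = (P.αp * P.αm * P.κ ^ n)⁻¹ •
      ∑ j : Fin n, (z + omega N * P.θ / z) ^ ((Fin.revPerm j : Fin n) : ℕ) •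
        c (Fin.revPerm j : Fin n) := by
    rw [Finset.smul_sum]
    refine Finset.sum_congr rfl fun j _ => ?_
    rw [smul_comm]
    have : ((Fin.revPerm j : Fin n) : ℕ) = n - 1 - (j : ℕ) := by
      simp only [Fin.revPerm_apply, Fin.val_rev]
      omega
    rw [this]
  rw [e, ← h2, smul_add, smul_smul _ (P.αp * P.αm * P.κ ^ n)⁻¹, mul_inv_cancel₀ h0, one_smul]
  match_scalars <;> ring

theorem prefactor_lam_ne_zero (hbd : D.IsBoundary N P) (hgen : D.IsGeneric N P)
    (hP : P.Nondegenerate) (k : Fin n) (a : ZMod N) : prefactor N n P (lam P D k a) ≠ 0 := by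
  rw [prefactor_eq hP n (lam_ne_zero hP hbd k a)]
  have h1 := theta_div_lam_sub_ne hbd hgen hP k a (one_pow N)
  have h2 := theta_div_lam_sub_ne hbd hgen hP k a (c := omega N ^ 2)
    (by rw [← pow_mul, mul_comm, pow_mul, omega_pow_self, one_pow])
  rw [one_mul] at h1
  exact mul_ne_zero (mul_ne_zero h2 h1)
    (mul_ne_zero (mul_ne_zero hP.αp_ne hP.αm_ne) (pow_ne_zero _ hP.κ_ne))

theorem transfer_eq {H : Fin n → Module.End ℂ (States N n)} (hH : IsHamiltonians P H) {z : ℂ}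
    (hz : z ≠ 0) : transfer P z = prefactor N n P z • hamPoly 1 H (symVar N P z) +
      (P.ηp * P.ηm * pPoly N n P z) • 1 := hH z hz

theorem symVar_lam_injective (hbd : D.IsBoundary N P) (hgen : D.IsGeneric N P)
    (hP : P.Nondegenerate) (σ : Fin n → ZMod N) :
    Function.Injective fun k => symVar N P (lam P D k (σ k)) :=
  fun _ _ h => (symVar_lam_inj hbd hgen hP h).1

/-- The separated variables provide n distinct arguments with nonzero prefactor, so this yields both
the uniqueness of the operators and the passage from t(z)X to the vectors H_jX. -/
theorem hamPoly_ext {V : Type*} [AddCommGroup V] [Module ℂ V] {e : V} {H H' : Fin n → V}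
    {x : Fin n → ℂ} (hx : Function.Injective x)
    (h : ∀ k, hamPoly e H (x k) = hamPoly e H' (x k)) : H = H' := by
  funext j
  refine sub_eq_zero.1 (coeff_rev_eq_zero hx (c := fun j => H j - H' j) (fun k => ?_) j)
  have := h k
  rw [hamPoly, hamPoly, add_right_inj] at this
  simp only [smul_sub, Finset.sum_sub_distrib, this, sub_self]

theorem isHamiltonians_unique (hbd : D.IsBoundary N P) (hgen : D.IsGeneric N P)
    (hP : P.Nondegenerate) {H H' : Fin n → Module.End ℂ (States N n)} (hH : IsHamiltonians P H)
    (hH' : IsHamiltonians P H') : H' = H := by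
  refine hamPoly_ext (e := 1) (symVar_lam_injective hbd hgen hP 0) fun k => ?_
  have hl := lam_ne_zero (N := N) hP hbd k ((0 : Fin n → ZMod N) k)
  have h := (transfer_eq hH' hl).symm.trans (transfer_eq hH hl)
  exact smul_right_injective _ (prefactor_lam_ne_zero hbd hgen hP k _) (add_right_cancel h)

theorem eigenvaluePoly_eq (E : Fin n → ℂ) (z : ℂ) :
    eigenvaluePoly N P E z = prefactor N n P z * hamPoly 1 E (symVar N P z) +
      P.ηp * P.ηm * pPoly N n P z := by
  simp [eigenvaluePoly, hamPoly, symVar, mul_comm]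

theorem hamPoly_apply (H : Fin n → Module.End ℂ (States N n)) (x : ℂ) (X : States N n) :
    hamPoly 1 H x X = hamPoly X (fun j => H j X) x := by
  simp [hamPoly]

theorem hamPoly_smul_const (E : Fin n → ℂ) (x : ℂ) (X : States N n) :
    hamPoly 1 E x • X = hamPoly X (fun j => E j • X) x := by
  simp [hamPoly, add_smul, Finset.sum_smul, smul_smul]

theorem transfer_apply_eq_iff (hbd : D.IsBoundary N P) (hgen : D.IsGeneric N P)
    (hP : P.Nondegenerate) {H : Fin n → Module.End ℂ (States N n)} (hH : IsHamiltonians P H)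
    (E : Fin n → ℂ) (X : States N n) :
    (∀ j, H j X = E j • X) ↔ ∀ z : ℂ, z ≠ 0 → transfer P z X = eigenvaluePoly N P E z • X := by
  have e : ∀ z : ℂ, z ≠ 0 → (transfer P z X = eigenvaluePoly N P E z • X ↔
      prefactor N n P z • hamPoly X (fun j => H j X) (symVar N P z) =
        prefactor N n P z • hamPoly X (fun j => E j • X) (symVar N P z)) := by
    intro z hz
    rw [transfer_eq hH hz, eigenvaluePoly_eq, add_smul, mul_smul (prefactor N n P z), ← hamPoly_apply,
      ← hamPoly_smul_const, LinearMap.add_apply,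
      LinearMap.smul_apply (prefactor N n P z), LinearMap.smul_apply, Module.End.one_apply,
      add_left_inj]
  constructor
  · intro h z hz
    rw [e z hz]
    simp only [h]
  · intro h
    refine congrFun (hamPoly_ext (e := X) (symVar_lam_injective hbd hgen hP 0) fun k => ?_)
    have hl := lam_ne_zero (N := N) hP hbd k ((0 : Fin n → ZMod N) k)
    exact smul_right_injective _ (prefactor_lam_ne_zero hbd hgen hP k _) ((e _ hl).1 (h _ hl))

/-- Replaces z by a free polynomial variable x, as `separation` requires. -/
theorem transfer_apply_eq_iff_hamPoly (hbd : D.IsBoundary N P) (hgen : D.IsGeneric N P)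
    (hP : P.Nondegenerate) {H : Fin n → Module.End ℂ (States N n)} (hH : IsHamiltonians P H)
    (E : Fin n → ℂ) (X : States N n) :
    (∀ z : ℂ, z ≠ 0 → transfer P z X = eigenvaluePoly N P E z • X) ↔
      ∀ x, hamPoly 1 H x X = hamPoly 1 E x • X := by
  rw [← transfer_apply_eq_iff hbd hgen hP hH]
  simp only [hamPoly_apply, hamPoly_smul_const]
  constructor
  · intro h x
    simp only [h]
  · intro h
    exact congrFun (hamPoly_ext (e := X) (symVar_lam_injective hbd hgen hP 0) fun k => h _)

end transferAction

/-! ### Separation of variables -/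

section separation
variable {N n : ℕ} [NeZero N]

/-- The Lagrange polynomials of the nodes `x k (σ k)`. -/
def lag (x : Fin n → ZMod N → ℂ) (σ : Fin n → ZMod N) (k : Fin n) (t : ℂ) : ℂ :=
  ∏ l ∈ Finset.univ.erase k, (t - x l (σ l)) / (x k (σ k) - x l (σ l))

theorem PolyLT.lag (x : Fin n → ZMod N → ℂ) (σ : Fin n → ZMod N) (k : Fin n) :
    PolyLT n (lag x σ k) := by
  have h := PolyLT.prod (Finset.univ.erase k)
    (fun l => -x l (σ l) / (x k (σ k) - x l (σ l))) (fun l => 1 / (x k (σ k) - x l (σ l)))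
  rw [Finset.card_erase_add_one (Finset.mem_univ k), Finset.card_univ, Fintype.card_fin] at h
  convert h using 2 with t
  refine Finset.prod_congr rfl fun l _ => ?_
  ring

theorem lag_eq_zero {x : Fin n → ZMod N → ℂ} {σ : Fin n → ZMod N} {j k : Fin n} (h : j ≠ k) :
    lag x σ k (x j (σ j)) = 0 :=
  Finset.prod_eq_zero (Finset.mem_erase.2 ⟨h, Finset.mem_univ j⟩) (by rw [sub_self, zero_div])

theorem lag_self {x : Fin n → ZMod N → ℂ} (hx : ∀ k l a b, x k a = x l b → k = l ∧ a = b)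
    (σ : Fin n → ZMod N) (k : Fin n) : lag x σ k (x k (σ k)) = 1 :=
  Finset.prod_eq_one fun _ hl => div_self fun h0 =>
    Finset.ne_of_mem_erase hl (hx _ _ _ _ (sub_eq_zero.1 h0)).1.symm

variable {V : Type*} [AddCommGroup V] [Module ℂ V] {ψ : (Fin n → ZMod N) → V}
  {x : Fin n → ZMod N → ℂ} {R : ℂ → Module.End ℂ V} {d u w : Fin n → ZMod N → ℂ}

/-- The coefficient of `ψ σ` in `R t (∑ G σ • ψ σ)`. -/
def sepCoeff (x : Fin n → ZMod N → ℂ) (d u w : Fin n → ZMod N → ℂ) (G : (Fin n → ZMod N) → ℂ)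
    (σ : Fin n → ZMod N) (t : ℂ) : ℂ :=
  G σ * ∏ k, (t - x k (σ k)) + ∑ k, (G σ * d k (σ k) * lag x σ k t +
    G (decr σ k) * u k (σ k - 1) * lag x (decr σ k) k t +
    G (incr σ k) * w k (σ k + 1) * lag x (incr σ k) k t)

/-- Each R t ψ_σ is tⁿψ_σ plus terms of lower degree, hence interpolated by its values at the n
points x_k(σ_k) adapted to this σ. Relabelling the shifted terms then collects the coefficient of
each ψ_σ. -/
theorem apply_sum_eq_sum_sepCoeff (hx : ∀ k l a b, x k a = x l b → k = l ∧ a = b)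
    (hR : PolyLT n fun t => R t - t ^ n • 1)
    (hact : ∀ σ k, R (x k (σ k)) (ψ σ) =
      d k (σ k) • ψ σ + u k (σ k) • ψ (incr σ k) + w k (σ k) • ψ (decr σ k))
    (G : (Fin n → ZMod N) → ℂ) (t : ℂ) :
    R t (∑ σ, G σ • ψ σ) = ∑ σ, sepCoeff x d u w G σ t • ψ σ := by
  have hL : ∀ σ, R t (ψ σ) = (∏ k, (t - x k (σ k))) • ψ σ + ∑ k, lag x σ k t •
      (d k (σ k) • ψ σ + u k (σ k) • ψ (incr σ k) + w k (σ k) • ψ (decr σ k)) := by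
    intro σ
    have h1 := hR.map (LinearMap.applyₗ (R := ℂ) (ψ σ))
    have h2 := (PolyLT.prod_sub Finset.univ (fun k => -x k (σ k)) (fun _ => 1)).map
      (LinearMap.toSpanSingleton ℂ V (ψ σ))
    rw [Finset.card_univ] at h2
    rw [← Fintype.card_fin n] at h1
    have h3 := (h1.sub h2).lagrange (x := fun k => x k (σ k))
      (fun k l h => (hx _ _ _ _ h).1) t
    have hz : ∀ k, ∏ l, (x k (σ k) - x l (σ l)) = 0 := fun k =>
      Finset.prod_eq_zero (Finset.mem_univ k) (sub_self _)
    simp only [LinearMap.applyₗ_apply_apply, LinearMap.sub_apply, LinearMap.smul_apply,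
      Module.End.one_apply, LinearMap.toSpanSingleton_apply, Finset.prod_const_one, one_mul,
      Fintype.card_fin, sub_smul, sub_sub_sub_cancel_right, neg_add_eq_sub, hact, hz, zero_smul,
      sub_zero] at h3
    rw [← sub_eq_iff_eq_add', h3]
    rfl
  simp only [map_sum, map_smul, hL, sepCoeff, add_smul, smul_add, Finset.smul_sum,
    Finset.sum_add_distrib, Finset.sum_smul, smul_smul]
  congr 1
  have hu : ∀ k, ∑ σ, (G σ * (lag x σ k t * u k (σ k))) • ψ (incr σ k) =
      ∑ σ, (G (decr σ k) * u k (σ k - 1) * lag x (decr σ k) k t) • ψ σ := by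
    intro k
    rw [← sum_comp_decr _ k]
    refine Finset.sum_congr rfl fun σ _ => ?_
    rw [incr_decr, decr_same]
    congr 1
    ring
  have hw : ∀ k, ∑ σ, (G σ * (lag x σ k t * w k (σ k))) • ψ (decr σ k) =
      ∑ σ, (G (incr σ k) * w k (σ k + 1) * lag x (incr σ k) k t) • ψ σ := by
    intro k
    rw [← sum_comp_incr _ k]
    refine Finset.sum_congr rfl fun σ _ => ?_
    rw [decr_incr, incr_same]
    congr 1
    ring
  congr 1
  · congr 1
    · refine Finset.sum_congr rfl fun σ _ => Finset.sum_congr rfl fun k _ => ?_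
      congr 1
      ring
    · rw [Finset.sum_comm, Finset.sum_congr rfl fun k _ => hu k, Finset.sum_comm]
  · rw [Finset.sum_comm, Finset.sum_congr rfl fun k _ => hw k, Finset.sum_comm]

/-- An eigenvector of a polynomial family of operators that acts by shifts at the separated
variables has coefficients which satisfy a difference equation in each variable. -/
theorem separation (hψ : LinearIndependent ℂ ψ)
    (hx : ∀ k l a b, x k a = x l b → k = l ∧ a = b)
    (hR : PolyLT n fun t => R t - t ^ n • 1)
    (hact : ∀ σ k, R (x k (σ k)) (ψ σ) =
      d k (σ k) • ψ σ + u k (σ k) • ψ (incr σ k) + w k (σ k) • ψ (decr σ k))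
    {r : ℂ → ℂ} (hr : PolyLT n fun t => r t - t ^ n) (G : (Fin n → ZMod N) → ℂ) :
    (∀ t, R t (∑ σ, G σ • ψ σ) = r t • ∑ σ, G σ • ψ σ) ↔
      ∀ σ k, (r (x k (σ k)) - d k (σ k)) * G σ =
        G (decr σ k) * u k (σ k - 1) * lag x (decr σ k) k (x k (σ k)) +
          G (incr σ k) * w k (σ k + 1) * lag x (incr σ k) k (x k (σ k)) := by
  -- For l ≠ k the neighbours of σ in direction l still have x_k(σ_k) among their interpolation
  -- points, so their Lagrange polynomials vanish there and only direction k remains.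
  have hval : ∀ σ k, sepCoeff x d u w G σ (x k (σ k)) = G σ * d k (σ k) +
      (G (decr σ k) * u k (σ k - 1) * lag x (decr σ k) k (x k (σ k)) +
        G (incr σ k) * w k (σ k + 1) * lag x (incr σ k) k (x k (σ k))) := by
    intro σ k
    rw [sepCoeff, Finset.prod_eq_zero (Finset.mem_univ k) (sub_self _), mul_zero, zero_add,
      Finset.sum_eq_single k, lag_self hx]
    · ring
    · intro l _ hl
      have h1 := lag_eq_zero (x := x) (σ := decr σ l) hl.symm
      have h2 := lag_eq_zero (x := x) (σ := incr σ l) hl.symm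
      rw [decr_of_ne σ hl.symm] at h1
      rw [incr_of_ne σ hl.symm] at h2
      rw [lag_eq_zero hl.symm, h1, h2]
      ring
    · simp
  -- The leading terms of R and r cancel, leaving degree below n. The n values at the points
  -- x_k(σ_k) therefore decide whether the difference vanishes.
  have hpoly : ∀ σ, PolyLT n fun t => sepCoeff x d u w G σ t - r t * G σ := by
    intro σ
    have h1 := (PolyLT.prod_sub Finset.univ (fun k => -x k (σ k)) (fun _ => 1)).smul (G σ)
    rw [Finset.card_univ, Fintype.card_fin] at h1
    have h2 := PolyLT.sum Finset.univ fun k _ =>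
      (((PolyLT.lag x σ k).smul (G σ * d k (σ k))).add
        ((PolyLT.lag x (decr σ k) k).smul (G (decr σ k) * u k (σ k - 1)))).add
        ((PolyLT.lag x (incr σ k) k).smul (G (incr σ k) * w k (σ k + 1)))
    convert (h1.add h2).sub (hr.smul (G σ)) using 2 with t
    simp only [sepCoeff, smul_eq_mul, Finset.prod_const_one, one_mul, neg_add_eq_sub]
    ring
  have hcoeff : (∀ t, R t (∑ σ, G σ • ψ σ) = r t • ∑ σ, G σ • ψ σ) ↔
      ∀ t σ, sepCoeff x d u w G σ t - r t * G σ = 0 := by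
    refine forall_congr' fun t => ?_
    rw [apply_sum_eq_sum_sepCoeff hx hR hact, Finset.smul_sum, ← sub_eq_zero,
      ← Finset.sum_sub_distrib]
    simp only [smul_smul, ← sub_smul]
    constructor
    · exact fun h σ => linearIndependent_iff'.1 hψ Finset.univ _ h σ (Finset.mem_univ σ)
    · exact fun h => Finset.sum_eq_zero fun σ _ => by rw [h, zero_smul]
  rw [hcoeff]
  constructor
  · intro h σ k
    have := h (x k (σ k)) σ
    rw [hval] at this
    linear_combination -this
  · intro h t σ
    refine ((hpoly σ).mono (Fintype.card_fin n).ge).eq_zero (x := fun k => x k (σ k)) (fun k l h => (hx _ _ _ _ h).1) (fun k => ?_) t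
    rw [hval]
    linear_combination -(h σ k)

end separation

/-! ### The Baxter equations and the eigenvectors -/

section final
variable {N n : ℕ} [NeZero N] {P : Params} {D : Amplitudes n}

/-- The factor `∏_{i<j} (λ_i - λ_j)(ωθ - λ_i λ_j)`. -/
def gauge (P : Params) (D : Amplitudes n) (σ : Fin n → ZMod N) : ℂ :=
  ∏ i, ∏ j ∈ Finset.Ioi i, (lam P D i (σ i) - lam P D j (σ j)) *
    (omega N * P.θ - lam P D i (σ i) * lam P D j (σ j))

/-- The gauge factor is a Vandermonde product in the variables Λ(λ_k) up to the monomials -λ_iλ_j,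
and can thus cancel Lagrange denominators in these variables. -/
theorem gauge_factor (hbd : D.IsBoundary N P) (hP : P.Nondegenerate) (k l : Fin n)
    (a b : ZMod N) :
    (lam P D k a - lam P D l b) * (omega N * P.θ - lam P D k a * lam P D l b) =
      -(lam P D k a * lam P D l b) * (symVar N P (lam P D k a) - symVar N P (lam P D l b)) := by
  have h1 := lam_ne_zero hP hbd k a
  have h2 := lam_ne_zero hP hbd l b
  rw [symVar_sub h1 h2]
  field_simp
  ring

theorem gauge_ne_zero (hbd : D.IsBoundary N P) (hgen : D.IsGeneric N P) (hP : P.Nondegenerate)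
    (σ : Fin n → ZMod N) : gauge P D σ ≠ 0 := by
  refine Finset.prod_ne_zero_iff.2 fun i _ => Finset.prod_ne_zero_iff.2 fun j hj => ?_
  rw [gauge_factor hbd hP]
  refine mul_ne_zero (neg_ne_zero.2 (mul_ne_zero (lam_ne_zero hP hbd i _)
    (lam_ne_zero hP hbd j _))) fun h => ?_
  exact (Finset.mem_Ioi.1 hj).ne (symVar_lam_inj hbd hgen hP (sub_eq_zero.1 h)).1

/-- A change of a single label changes the gauge factor by a Lagrange polynomial. -/
theorem gauge_mul_lag (hbd : D.IsBoundary N P) (hgen : D.IsGeneric N P) (hP : P.Nondegenerate)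
    (σ τ : Fin n → ZMod N) (k : Fin n) (h : ∀ l, l ≠ k → τ l = σ l) {c : ℂ}
    (hc : lam P D k (τ k) = c * lam P D k (σ k)) :
    gauge P D τ * lag (fun k a => symVar N P (lam P D k a)) τ k (symVar N P (lam P D k (σ k))) =
      c ^ (n - 1) * gauge P D σ := by
  have hc' : ∏ l ∈ Finset.univ.erase k, c = c ^ (n - 1) := by
    rw [Finset.prod_const, Finset.card_erase_of_mem (Finset.mem_univ k), Finset.card_univ,
      Fintype.card_fin]
  have hne : ∀ l, l ≠ k →
      symVar N P (lam P D k (τ k)) - symVar N P (lam P D l (σ l)) ≠ 0 := fun l hl h0 =>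
    hl (symVar_lam_inj hbd hgen hP (sub_eq_zero.1 h0)).1.symm
  have hne' : ∀ l, l ≠ k →
      symVar N P (lam P D k (σ k)) - symVar N P (lam P D l (σ l)) ≠ 0 := fun l hl h0 =>
    hl (symVar_lam_inj hbd hgen hP (sub_eq_zero.1 h0)).1.symm
  -- Each pair containing k changes by c, from the monomial, times a quotient of differences of Λ.
  -- The quotients cancel the Lagrange polynomial, and the n - 1 factors c remain.
  have key := prod_Ioi_update k
    (fun i j => (lam P D i (τ i) - lam P D j (τ j)) *
      (omega N * P.θ - lam P D i (τ i) * lam P D j (τ j)))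
    (fun i j => (lam P D i (σ i) - lam P D j (σ j)) *
      (omega N * P.θ - lam P D i (σ i) * lam P D j (σ j)))
    (fun l => c * ((symVar N P (lam P D k (τ k)) - symVar N P (lam P D l (σ l))) /
      (symVar N P (lam P D k (σ k)) - symVar N P (lam P D l (σ l)))))
    (fun j l _ hj hl => by rw [h j hj, h l hl])
    (fun l hl => by
      have := hne' l hl.ne'
      rw [gauge_factor hbd hP, gauge_factor hbd hP, h l hl.ne', hc]
      field_simp)
    (fun l hl => by
      have := hne' l hl.ne
      rw [gauge_factor hbd hP, gauge_factor hbd hP, h l hl.ne, hc]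
      field_simp
      ring)
  rw [gauge, key, lag, Finset.prod_mul_distrib, hc', gauge]
  have e : (∏ l ∈ Finset.univ.erase k,
      (symVar N P (lam P D k (τ k)) - symVar N P (lam P D l (σ l))) /
        (symVar N P (lam P D k (σ k)) - symVar N P (lam P D l (σ l)))) *
      ∏ l ∈ Finset.univ.erase k,
        (symVar N P (lam P D k (σ k)) - symVar N P (lam P D l (τ l))) /
          (symVar N P (lam P D k (τ k)) - symVar N P (lam P D l (τ l))) = 1 := by
    rw [← Finset.prod_mul_distrib]
    refine Finset.prod_eq_one fun l hl => ?_
    have hl' := Finset.ne_of_mem_erase hl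
    have h1 := hne l hl'
    have h2 := hne' l hl'
    rw [h l hl']
    field_simp
  linear_combination (c ^ (n - 1) * ∏ i, ∏ j ∈ Finset.Ioi i,
    (lam P D i (σ i) - lam P D j (σ j)) *
      (omega N * P.θ - lam P D i (σ i) * lam P D j (σ j))) * e

/-- The coefficient of `q (σ - 1)` in the Baxter equation. -/
def baxterMinus (P : Params) (D : Amplitudes n) (k : Fin n) (a : ZMod N) : ℂ :=
  P.ηp * P.ηm * ((P.θ - lam P D k a ^ 2) /
    (omega N * P.θ - omega N ^ (-2 : ℤ) * lam P D k a ^ 2)) *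
    omega N ^ (1 - 2 * (n : ℤ)) * fCoeff P D k a

/-- The coefficient of `q (σ + 1)` in the Baxter equation. -/
def baxterPlus (P : Params) (D : Amplitudes n) (k : Fin n) (a : ZMod N) : ℂ :=
  P.ηp * P.ηm * ((omega N ^ 2 * P.θ - lam P D k a ^ 2) /
    (P.θ - omega N * lam P D k a ^ 2)) *
    omega N ^ ((n : ℤ) - 1) * P.θ ^ n * (fCoeff P D k a)⁻¹

/-- The coefficient of `Ψ_{σ + e_k}` in `t(λ_k) Ψ_σ`. -/
def raising (P : Params) (D : Amplitudes n) (k : Fin n) (a : ZMod N) : ℂ :=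
  P.ηp * P.ηm * ((lam P D k a ^ 2 - omega N ^ 2 * P.θ) /
    (lam P D k a ^ 2 - omega N * P.θ)) * fCoeff P D k a

/-- The coefficient of `Ψ_{σ - e_k}` in `t(λ_k) Ψ_σ`. -/
def lowering (P : Params) (D : Amplitudes n) (k : Fin n) (a : ZMod N) : ℂ :=
  -(P.ηp * P.ηm * (omega N * (P.θ - lam P D k a ^ 2) /
    (lam P D k a ^ 2 - omega N * P.θ)) * ((omega N * P.θ) ^ n * (fCoeff P D k a)⁻¹))

theorem fCoeff_add_one (P : Params) (D : Amplitudes n) (k : Fin n) (a : ZMod N) :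
    fCoeff P D k (a + 1) = omega N ^ n * fCoeff P D k a := by
  have h := fCoeff_sub_one P D k (a + 1)
  have hω := pow_ne_zero n (omega_ne_zero N)
  rw [add_sub_cancel_right, eq_div_iff hω] at h
  rw [← h, mul_comm]

theorem lam_sq_ne (hgen : D.IsGeneric N P) (k : Fin n) (a : ZMod N) (j : ℕ) :
    lam P D k a ^ 2 - omega N ^ j * P.θ ≠ 0 := by
  rw [sq, sub_ne_zero]
  exact lam_mul_lam_ne hgen k k a a (by rw [← pow_mul, mul_comm, pow_mul, omega_pow_self, one_pow])

/-- The power ω^0 gives both factors the form treated in `lam_sq_ne`. -/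
theorem prefactor_eq_div (hP : P.Nondegenerate) (n : ℕ) {z : ℂ} (hz : z ≠ 0) :
    prefactor N n P z =
      (z ^ 2 - omega N ^ 2 * P.θ) * (z ^ 2 - omega N ^ 0 * P.θ) / z ^ 2 *
        (P.αp * P.αm * P.κ ^ n) := by
  rw [prefactor_eq hP n hz]
  field_simp
  ring

/-- A Baxter coefficient is the amplitude for arriving at the label a, here from a - 1. The
prefactors occur because t is divided by its prefactor before the separation and multiplied back
afterwards, at different labels; the power of 1/ω is the ratio from `gauge_mul_lag`. -/
theorem raising_sub_one (hn : 1 ≤ n) (hbd : D.IsBoundary N P) (hgen : D.IsGeneric N P)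
    (hP : P.Nondegenerate) (k : Fin n) (a : ZMod N) :
    prefactor N n P (lam P D k a) * (raising P D k (a - 1) / prefactor N n P (lam P D k (a - 1))) *
      (1 / omega N) ^ (n - 1) = baxterMinus P D k a := by
  have hω := omega_ne_zero N
  have hl := lam_ne_zero hP hbd k a
  have hl' := lam_ne_zero hP hbd k (a - 1)
  have hK : P.αp * P.αm * P.κ ^ n ≠ 0 :=
    mul_ne_zero (mul_ne_zero hP.αp_ne hP.αm_ne) (pow_ne_zero _ hP.κ_ne)
  have h1 := lam_sq_ne hgen k (a - 1) 1
  have h2 := lam_sq_ne hgen k (a - 1) 2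
  have h0 := lam_sq_ne hgen k (a - 1) 0
  rw [baxterMinus, raising, prefactor_eq_div hP n hl, prefactor_eq_div hP n hl', fCoeff_sub_one]
  have e1 : lam P D k a = omega N * lam P D k (a - 1) := by
    rw [← lam_add_one, sub_add_cancel]
  rw [e1]
  have e2 : omega N ^ (1 - 2 * (n : ℤ)) = (omega N * omega N ^ (n - 1) * omega N ^ (n - 1))⁻¹ := by
    rw [← pow_succ', ← pow_add, ← zpow_natCast, ← zpow_neg]
    congr 1
    omega
  have e3 : omega N ^ n = omega N * omega N ^ (n - 1) := by
    rw [← pow_succ']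
    congr 1
    omega
  have e4 : omega N ^ (-2 : ℤ) = (omega N ^ 2)⁻¹ := by
    rw [zpow_neg]
    norm_cast
  have hd : omega N * P.θ - (omega N ^ 2)⁻¹ * (omega N * lam P D k (a - 1)) ^ 2 =
      -(lam P D k (a - 1) ^ 2 - omega N ^ 1 * P.θ) := by
    field_simp
    ring
  have hd2 : (omega N * lam P D k (a - 1)) ^ 2 - omega N ^ 2 * P.θ =
      omega N ^ 2 * (lam P D k (a - 1) ^ 2 - omega N ^ 0 * P.θ) := by
    ring
  have hd3 : lam P D k (a - 1) ^ 2 - omega N * P.θ =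
      lam P D k (a - 1) ^ 2 - omega N ^ 1 * P.θ := by rw [pow_one]
  have hd4 : P.θ - (omega N * lam P D k (a - 1)) ^ 2 =
      -((omega N * lam P D k (a - 1)) ^ 2 - omega N ^ 0 * P.θ) := by ring
  rw [e4, hd, hd2, hd3, hd4, e2, e3, one_div_pow]
  have hωn := pow_ne_zero (n - 1) hω
  generalize omega N ^ (n - 1) = W at *
  generalize P.αp * P.αm * P.κ ^ n = K at *
  generalize lam P D k (a - 1) ^ 2 - omega N ^ 0 * P.θ = X0 at *
  generalize lam P D k (a - 1) ^ 2 - omega N ^ 1 * P.θ = X1 at *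
  generalize lam P D k (a - 1) ^ 2 - omega N ^ 2 * P.θ = X2 at *
  field_simp

/-- The counterpart for the arrival from a + 1, where the gauge ratio is ω^(n-1). -/
theorem lowering_add_one (hn : 1 ≤ n) (hbd : D.IsBoundary N P) (hgen : D.IsGeneric N P)
    (hP : P.Nondegenerate) (k : Fin n) (a : ZMod N) (hf : fCoeff P D k a ≠ 0) :
    prefactor N n P (lam P D k a) * (lowering P D k (a + 1) / prefactor N n P (lam P D k (a + 1))) *
      omega N ^ (n - 1) = baxterPlus P D k a := by
  have hω := omega_ne_zero N
  have hl := lam_ne_zero hP hbd k a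
  have hl' := lam_ne_zero hP hbd k (a + 1)
  have hK : P.αp * P.αm * P.κ ^ n ≠ 0 :=
    mul_ne_zero (mul_ne_zero hP.αp_ne hP.αm_ne) (pow_ne_zero _ hP.κ_ne)
  have h1 := lam_sq_ne hgen k (a + 1) 1
  have h2 := lam_sq_ne hgen k (a + 1) 2
  have h0 := lam_sq_ne hgen k (a + 1) 0
  rw [baxterPlus, lowering, prefactor_eq_div hP n hl, prefactor_eq_div hP n hl', fCoeff_add_one]
  have e1 : lam P D k a = lam P D k (a + 1) / omega N := by
    rw [lam_add_one, mul_div_cancel_left₀ _ hω]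
  rw [e1]
  have e2 : omega N ^ ((n : ℤ) - 1) = omega N ^ (n - 1) := by
    rw [← zpow_natCast]
    congr 1
    omega
  have hd : P.θ - omega N * (lam P D k (a + 1) / omega N) ^ 2 =
      -(lam P D k (a + 1) ^ 2 - omega N ^ 1 * P.θ) / omega N := by
    field_simp
    ring
  have hd2 : (lam P D k (a + 1) / omega N) ^ 2 - omega N ^ 0 * P.θ =
      (lam P D k (a + 1) ^ 2 - omega N ^ 2 * P.θ) / omega N ^ 2 := by
    field_simp
  have hd3 : lam P D k (a + 1) ^ 2 - omega N * P.θ =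
      lam P D k (a + 1) ^ 2 - omega N ^ 1 * P.θ := by rw [pow_one]
  have hd4 : omega N ^ 2 * P.θ - (lam P D k (a + 1) / omega N) ^ 2 =
      -((lam P D k (a + 1) / omega N) ^ 2 - omega N ^ 2 * P.θ) := by ring
  have hd5 : P.θ - lam P D k (a + 1) ^ 2 =
      -(lam P D k (a + 1) ^ 2 - omega N ^ 0 * P.θ) := by ring
  rw [hd, hd2, hd3, hd4, hd5, e2, mul_pow]
  have hωn := pow_ne_zero (n - 1) hω
  generalize omega N ^ (n - 1) = W at *
  generalize P.αp * P.αm * P.κ ^ n = K at *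
  generalize (lam P D k (a + 1) / omega N) ^ 2 - omega N ^ 2 * P.θ = Y2 at *
  generalize lam P D k (a + 1) ^ 2 - omega N ^ 0 * P.θ = X0 at *
  generalize lam P D k (a + 1) ^ 2 - omega N ^ 1 * P.θ = X1 at *
  generalize lam P D k (a + 1) ^ 2 - omega N ^ 2 * P.θ = X2 at *
  have hωn' := pow_ne_zero n hω
  generalize omega N ^ n = W' at *
  field_simp

theorem baxter_iff (E : Fin n → ℂ) (k : Fin n) (q : ZMod N → ℂ) :
    Baxter P D E k q ↔ ∀ a, eigenvaluePoly N P E (lam P D k a) * q a =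
      baxterMinus P D k a * q (a - 1) + baxterPlus P D k a * q (a + 1) := Iff.rfl

/-- In the basis `Ψ_σ` the eigenvector equation is the Baxter equation in each variable. -/
theorem eigenvector_iff (hn : 1 ≤ n) (hD : D.IsOpen N P) (hbd : D.IsBoundary N P)
    (hgen : D.IsGeneric N P) (hP : P.Nondegenerate) (E : Fin n → ℂ)
    (F : (Fin n → ZMod N) → ℂ) :
    (∀ z : ℂ, z ≠ 0 → transfer P z (∑ σ, (gauge P D σ * F σ) • psi P D σ) =
        eigenvaluePoly N P E z • ∑ σ, (gauge P D σ * F σ) • psi P D σ) ↔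
      ∀ σ k, eigenvaluePoly N P E (lam P D k (σ k)) * F σ =
        baxterMinus P D k (σ k) * F (decr σ k) + baxterPlus P D k (σ k) * F (incr σ k) := by
  obtain ⟨H, hH⟩ := exists_isHamiltonians (N := N) (n := n) hP
  have hpoly : ∀ {V : Type} [AddCommGroup V] [Module ℂ V] (e : V) (H : Fin n → V),
      PolyLT n fun t => hamPoly e H t - t ^ n • e := by
    intro V _ _ e H
    have h := PolyLT.sum Finset.univ fun (j : Fin n) _ =>
      PolyLT.pow_smul (show n - 1 - (j : ℕ) < n by omega) (H j)
    convert h using 2 with t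
    rw [hamPoly, add_sub_cancel_left]
  -- The action of t at λ_k with the p_n term subtracted and the prefactor divided out; the diagonal
  -- term consists of p_n alone.
  have hact : ∀ (σ : Fin n → ZMod N) k, hamPoly 1 H (symVar N P (lam P D k (σ k))) (psi P D σ) =
      (-(P.ηp * P.ηm * pPoly N n P (lam P D k (σ k))) / prefactor N n P (lam P D k (σ k))) •
          psi P D σ +
        (raising P D k (σ k) / prefactor N n P (lam P D k (σ k))) • psi P D (incr σ k) +
        (lowering P D k (σ k) / prefactor N n P (lam P D k (σ k))) • psi P D (decr σ k) := by
    intro σ k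
    have hp := prefactor_lam_ne_zero hbd hgen hP k (σ k)
    have h1 := transfer_psi_lam hD hbd hgen hP σ k
    rw [transfer_eq hH (lam_ne_zero hP hbd k (σ k)), LinearMap.add_apply,
      LinearMap.smul_apply (prefactor N n P (lam P D k (σ k))), LinearMap.smul_apply,
      Module.End.one_apply, ← eq_sub_iff_add_eq] at h1
    refine smul_right_injective _ hp ?_
    simp only [smul_add, smul_smul, mul_div_cancel₀ _ hp]
    rw [h1, raising, lowering]
    module
  -- The separation applies to an arbitrary function F of all labels, not only to products; this
  -- generality is needed for arbitrary eigenvectors.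
  rw [transfer_apply_eq_iff_hamPoly hbd hgen hP hH,
    separation (psi_linearIndependent hD hbd hgen hP)
      (x := fun k a => symVar N P (lam P D k a)) (fun k l a b h => symVar_lam_inj hbd hgen hP h)
      (R := hamPoly 1 H) (hpoly 1 H)
      (d := fun k a => -(P.ηp * P.ηm * pPoly N n P (lam P D k a)) / prefactor N n P (lam P D k a))
      (u := fun k a => raising P D k a / prefactor N n P (lam P D k a))
      (w := fun k a => lowering P D k a / prefactor N n P (lam P D k a)) hact
      (r := hamPoly 1 E) (by simpa using hpoly (1 : ℂ) E)]
  refine forall_congr' fun σ => forall_congr' fun k => ?_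
  have hω := omega_ne_zero N
  have hp := prefactor_lam_ne_zero hbd hgen hP k (σ k)
  have hg := gauge_ne_zero hbd hgen hP σ
  have g1 := gauge_mul_lag hbd hgen hP σ (decr σ k) k (fun l hl => decr_of_ne σ hl)
    (c := 1 / omega N) (by rw [decr_same, lam_sub_one]; ring)
  have g2 := gauge_mul_lag hbd hgen hP σ (incr σ k) k (fun l hl => incr_of_ne σ hl)
    (c := omega N) (by rw [incr_same, lam_add_one])
  have b1 := raising_sub_one hn hbd hgen hP k (σ k)
  have b2 := lowering_add_one hn hbd hgen hP k (σ k)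
    (fCoeff_ne_zero hD hbd hgen hP k (σ k))
  rw [eigenvaluePoly_eq, ← b1, ← b2]
  have hY : prefactor N n P (lam P D k (σ k)) *
      (-(P.ηp * P.ηm * pPoly N n P (lam P D k (σ k))) / prefactor N n P (lam P D k (σ k))) =
      -(P.ηp * P.ηm * pPoly N n P (lam P D k (σ k))) := mul_div_cancel₀ _ hp
  constructor
  · intro h
    refine mul_left_cancel₀ hg ?_
    linear_combination prefactor N n P (lam P D k (σ k)) * h + gauge P D σ * F σ * hY +
      prefactor N n P (lam P D k (σ k)) *
        (raising P D k (σ k - 1) / prefactor N n P (lam P D k (σ k - 1))) * F (decr σ k) * g1 +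
      prefactor N n P (lam P D k (σ k)) *
        (lowering P D k (σ k + 1) / prefactor N n P (lam P D k (σ k + 1))) * F (incr σ k) * g2
  · intro h
    refine mul_left_cancel₀ hp ?_
    linear_combination gauge P D σ * h - gauge P D σ * F σ * hY -
      prefactor N n P (lam P D k (σ k)) *
        (raising P D k (σ k - 1) / prefactor N n P (lam P D k (σ k - 1))) * F (decr σ k) * g1 -
      prefactor N n P (lam P D k (σ k)) *
        (lowering P D k (σ k + 1) / prefactor N n P (lam P D k (σ k + 1))) * F (incr σ k) * g2

theorem sum_gauge_smul_psi_eq_zero_iff (hD : D.IsOpen N P) (hbd : D.IsBoundary N P)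
    (hgen : D.IsGeneric N P) (hP : P.Nondegenerate) (F : (Fin n → ZMod N) → ℂ) :
    ∑ σ, (gauge P D σ * F σ) • psi P D σ = 0 ↔ F = 0 := by
  constructor
  · intro h
    funext σ
    have h2 := linearIndependent_iff'.1 (psi_linearIndependent hD hbd hgen hP) Finset.univ _ h σ
      (Finset.mem_univ σ)
    exact (mul_eq_zero.1 h2).resolve_left (gauge_ne_zero hbd hgen hP σ)
  · rintro rfl
    simp

theorem phi_eq (q : Fin n → ZMod N → ℂ) :
    phi P D q = ∑ σ, (gauge P D σ * ∏ k, q k (σ k)) • psi P D σ := rfl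

theorem prod_incr (q : Fin n → ZMod N → ℂ) (σ : Fin n → ZMod N) (k : Fin n) :
    ∏ l, q l (incr σ k l) = q k (σ k + 1) * ∏ l ∈ Finset.univ.erase k, q l (σ l) := by
  rw [← Finset.mul_prod_erase Finset.univ _ (Finset.mem_univ k), incr_same]
  congr 1
  exact Finset.prod_congr rfl fun l hl => by rw [incr_of_ne σ (Finset.ne_of_mem_erase hl)]

theorem prod_decr (q : Fin n → ZMod N → ℂ) (σ : Fin n → ZMod N) (k : Fin n) :
    ∏ l, q l (decr σ k l) = q k (σ k - 1) * ∏ l ∈ Finset.univ.erase k, q l (σ l) := by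
  rw [← Finset.mul_prod_erase Finset.univ _ (Finset.mem_univ k), decr_same]
  congr 1
  exact Finset.prod_congr rfl fun l hl => by rw [decr_of_ne σ (Finset.ne_of_mem_erase hl)]

/-- For a product, the equation in direction k is the k-th Baxter equation times ∏_{l≠k} q_l(σ_l),
and Φ ≠ 0 means that no q_k vanishes identically. The other factors can therefore be kept at nonzero
values. -/
theorem isEigenvector_phi_iff (hn : 1 ≤ n) (hD : D.IsOpen N P) (hbd : D.IsBoundary N P)
    (hgen : D.IsGeneric N P) (hP : P.Nondegenerate) (E : Fin n → ℂ) (q : Fin n → ZMod N → ℂ) :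
    IsEigenvector P E (phi P D q) ↔ ∀ k, q k ≠ 0 ∧ Baxter P D E k (q k) := by
  rw [IsEigenvector, phi_eq, eigenvector_iff hn hD hbd hgen hP, Ne,
    sum_gauge_smul_psi_eq_zero_iff hD hbd hgen hP]
  simp only [prod_incr, prod_decr, baxter_iff]
  constructor
  · rintro ⟨h0, h⟩ k
    obtain ⟨σ, hσ⟩ := Function.ne_iff.1 h0
    have hσ' := fun l => Finset.prod_ne_zero_iff.1 hσ l (Finset.mem_univ l)
    refine ⟨fun hk => hσ' k (congrFun hk _), fun a => ?_⟩
    have h2 := h (Function.update σ k a) k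
    rw [← Finset.mul_prod_erase Finset.univ _ (Finset.mem_univ k)] at h2
    have e : ∏ l ∈ Finset.univ.erase k, q l (Function.update σ k a l) =
        ∏ l ∈ Finset.univ.erase k, q l (σ l) :=
      Finset.prod_congr rfl fun l hl => by
        rw [Function.update_of_ne (Finset.ne_of_mem_erase hl)]
    rw [Function.update_self, e] at h2
    have hne : ∏ l ∈ Finset.univ.erase k, q l (σ l) ≠ 0 :=
      Finset.prod_ne_zero_iff.2 fun l _ => hσ' l
    refine mul_left_cancel₀ hne ?_
    linear_combination h2
  · intro h
    refine ⟨fun h0 => ?_, fun σ k => ?_⟩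
    · choose a ha using fun k => Function.ne_iff.1 (h k).1
      exact Finset.prod_ne_zero_iff.2 (fun k _ => ha k) (congrFun h0 a)
    · rw [← Finset.mul_prod_erase Finset.univ _ (Finset.mem_univ k)]
      linear_combination (∏ l ∈ Finset.univ.erase k, q l (σ l)) * (h k).2 (σ k)

/-- The converse direction takes products of solutions. In the other direction an eigenvector need
not have product coefficients, but each equation involves neighbours in a single direction, so every
slice in direction k solves the k-th Baxter equation. -/
theorem exists_isEigenvector_iff (hn : 1 ≤ n) (hD : D.IsOpen N P) (hbd : D.IsBoundary N P)
    (hgen : D.IsGeneric N P) (hP : P.Nondegenerate) (E : Fin n → ℂ) :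
    (∃ X : States N n, IsEigenvector P E X) ↔
      ∀ k, ∃ q : ZMod N → ℂ, q ≠ 0 ∧ Baxter P D E k q := by
  constructor
  · rintro ⟨X, hX0, hX⟩ k
    have hspan : X ∈ Submodule.span ℂ (Set.range (psi (N := N) P D)) := by
      rw [span_eq_top_of_linearIndependent (psi_linearIndependent hD hbd hgen hP)]
      exact Submodule.mem_top
    obtain ⟨c, rfl⟩ := (Submodule.mem_span_range_iff_exists_fun ℂ).1 hspan
    obtain ⟨F, rfl⟩ : ∃ F : (Fin n → ZMod N) → ℂ, c = fun σ => gauge P D σ * F σ :=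
      ⟨fun σ => c σ / gauge P D σ, funext fun σ =>
        (mul_div_cancel₀ _ (gauge_ne_zero hbd hgen hP σ)).symm⟩
    rw [eigenvector_iff hn hD hbd hgen hP E F] at hX
    rw [Ne, sum_gauge_smul_psi_eq_zero_iff hD hbd hgen hP F] at hX0
    obtain ⟨σ, hσ⟩ := Function.ne_iff.1 hX0
    -- The slice passes through a label at which F does not vanish.
    refine ⟨fun a => F (Function.update σ k a), fun h0 => hσ ?_, fun a => ?_⟩
    · simpa using congrFun h0 (σ k)
    · have h := hX (Function.update σ k a) k
      have e1 : decr (Function.update σ k a) k = Function.update σ k (a - 1) := by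
        funext l
        by_cases hl : l = k
        · subst hl
          simp [decr_same]
        · rw [decr_of_ne _ hl, Function.update_of_ne hl, Function.update_of_ne hl]
      have e2 : incr (Function.update σ k a) k = Function.update σ k (a + 1) := by
        funext l
        by_cases hl : l = k
        · subst hl
          simp [incr_same]
        · rw [incr_of_ne _ hl, Function.update_of_ne hl, Function.update_of_ne hl]
      rwa [e1, e2, Function.update_self] at h
  · intro h
    choose q hq using h
    exact ⟨_, (isEigenvector_phi_iff hn hD hbd hgen hP E q).2 hq⟩

end final

end

end RTC

theorem mainTheorem4 (N n : ℕ) [NeZero N] (hN : 2 ≤ N) (hn : 1 ≤ n)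
    (P : RTC.Params) (hP : P.Nondegenerate) (D : RTC.Amplitudes n)
    (hopen : D.IsOpen N P) (hbd : D.IsBoundary N P) (hgen : D.IsGeneric N P) :
    ∃ H : Fin n → Module.End ℂ (RTC.States N n),
      RTC.IsHamiltonians P H ∧
      (∀ H' : Fin n → Module.End ℂ (RTC.States N n), RTC.IsHamiltonians P H' → H' = H) ∧
      (∀ (E : Fin n → ℂ) (Φ : RTC.States N n),
        (Φ ≠ 0 ∧ ∀ j, H j Φ = E j • Φ) ↔ RTC.IsEigenvector P E Φ) ∧
      (∀ (E : Fin n → ℂ) (q : Fin n → ZMod N → ℂ),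
        RTC.IsEigenvector P E (RTC.phi P D q) ↔ ∀ k, q k ≠ 0 ∧ RTC.Baxter P D E k (q k)) ∧
      (∀ E : Fin n → ℂ,
        (∃ Φ : RTC.States N n, RTC.IsEigenvector P E Φ) ↔
          ∀ k, ∃ q : ZMod N → ℂ, q ≠ 0 ∧ RTC.Baxter P D E k q) := by
  obtain ⟨H, hH⟩ := RTC.exists_isHamiltonians (N := N) (n := n) hP
  exact ⟨H, hH, fun _ hH' => RTC.isHamiltonians_unique hbd hgen hP hH hH',
    fun E Φ => and_congr_right fun _ => RTC.transfer_apply_eq_iff hbd hgen hP hH E Φ,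
    RTC.isEigenvector_phi_iff hn hopen hbd hgen hP,
    RTC.exists_isEigenvector_iff hn hopen hbd hgen hP⟩
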